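/- Let $SU(2)\times SU(2)$ act on the complex manifold $SL(2,\mathbb C)$ by $(a,b)\cdot u=a\,u\,b^{-1}$, and let $|h|=\sqrt{2\operatorname{tr}(h^*h)}$ be the $\mathrm{Ad}\,SU(2)$-invariant norm on $\mathfrak{su}(2)$ for which $\tfrac{i}{2}\sigma_1,\tfrac{i}{2}\sigma_2,\tfrac{i}{2}\sigma_3$ ($\sigma_j$ the Pauli matrices) is an orthonormal basis. Every $u\in SL(2,\mathbb C)$ can be written as $u=g\exp(ih)$ with $g\in SU(2)$ and $h\in\mathfrak{su}(2)$, and $$K(u)=\int_0^{|h|}\sqrt[3]{\sinh(2t)-2t}\;dt$$ is a well-defined smooth function on $SL(2,\mathbb C)$. It is the Kähler potential of a Riemannian metric $g_0$ on $SL(2,\mathbb C)$ (that is, $(g_0)_{a\bar b}=\partial^2K/\partial z_a\partial\bar z_b$ in local holomorphic coordinates, so the Kähler form $g_0(i\,\cdot\,,\cdot)$ is $i\partial\bar\partial K$), and $g_0$ is a complete $SU(2)\times SU(2)$-invariant Ricci-flat Kähler metric. It is unique up to homothety: every complete $SU(2)\times SU(2)$-invariant Ricci-flat Kähler metric on $SL(2,\mathbb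 C)$ (with its standard complex structure) equals $c\,g_0$ for some constant $c>0$. -/

import Mathlib

open scoped ContDiff ENNReal Topology

noncomputable section

namespace SL2Kahler

/-- Complex `2 × 2` matrices. -/
abbrev M2 : Type := Matrix (Fin 2) (Fin 2) ℂ

/-- The group `SL(2, ℂ)`. -/
abbrev SL2 : Type := Matrix.SpecialLinearGroup (Fin 2) ℂ

/-- The model space `ℂ³` for holomorphic coordinates on `SL(2, ℂ)`. -/
abbrev C3 : Type := Fin 3 → ℂ

/-! ### `SL(2, ℂ)` as a complex submanifold of the space of matrices -/

/-- The inclusion of `SL(2, ℂ)` in the normed space `ℂ^{2 × 2}`, used for calculus. -/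
def entries (u : SL2) : Fin 2 → Fin 2 → ℂ := fun i j => (u : M2) i j

/-- The holomorphic tangent space `T_u SL(2, ℂ) = {X : tr (u⁻¹ X) = 0}`, the kernel of the
differential of `det` at `u`.  Its complex structure is multiplication by `i`. -/
def tangentSpace (u : SL2) : Submodule ℂ M2 where
  carrier := {X | (((u⁻¹ : SL2) : M2) * X).trace = 0}
  zero_mem' := by simp
  add_mem' := by
    intro X Y hX hY
    simp only [Set.mem_ofPred_eq] at *
    rw [mul_add, Matrix.trace_add, hX, hY, add_zero]
  smul_mem' := by
    intro c X hX
    simp only [Set.mem_ofPred_eq] at *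
    rw [Matrix.mul_smul, Matrix.trace_smul, hX, smul_zero]

theorem mem_tangentSpace_iff (u : SL2) (X : M2) :
    X ∈ tangentSpace u ↔
      u 1 1 * X 0 0 - u 0 1 * X 1 0 + (u 0 0 * X 1 1 - u 1 0 * X 0 1) = 0 := by
  change (((u⁻¹ : SL2) : M2) * X).trace = 0 ↔ _
  rw [Matrix.SpecialLinearGroup.coe_inv, Matrix.adjugate_fin_two, Matrix.trace_fin_two]
  simp [Matrix.mul_apply, Fin.sum_univ_two]
  constructor <;> intro h <;> linear_combination h

/-- Derivatives of `SL(2, ℂ)`-valued maps are tangent to `SL(2, ℂ)`. -/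
theorem fderiv_mem_tangentSpace {𝕜 : Type*} [NontriviallyNormedField 𝕜] [NormedAlgebra 𝕜 ℂ]
    {E : Type*} [NormedAddCommGroup E] [NormedSpace 𝕜 E] (φ : E → SL2) (z v : E) :
    Matrix.of (fderiv 𝕜 (fun x => entries (φ x)) z v) ∈ tangentSpace (φ z) := by
  by_cases h : DifferentiableAt 𝕜 (fun x => entries (φ x)) z
  · have hij : ∀ i j, HasFDerivAt (fun x => (φ x) i j)
        ((ContinuousLinearMap.proj (R := 𝕜) (φ := fun _ : Fin 2 => ℂ) j).comp
          ((ContinuousLinearMap.proj (R := 𝕜) (φ := fun _ : Fin 2 => Fin 2 → ℂ) i).comp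
            (fderiv 𝕜 (fun x => entries (φ x)) z))) z := fun i j =>
      (hasFDerivAt_pi'.1 (hasFDerivAt_pi'.1 h.hasFDerivAt i) j)
    have hdet : ∀ x, (φ x) 0 0 * (φ x) 1 1 - (φ x) 0 1 * (φ x) 1 0 = 1 := fun x => by
      have := (φ x).det_coe
      rwa [Matrix.det_fin_two] at this
    have h1 := (((hij 0 0).mul (hij 1 1)).sub ((hij 0 1).mul (hij 1 0)))
    have h2 : HasFDerivAt (fun x => (φ x) 0 0 * (φ x) 1 1 - (φ x) 0 1 * (φ x) 1 0)
        (0 : E →L[𝕜] ℂ) z := by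
      simp only [hdet]
      exact hasFDerivAt_const _ _
    have h3 := congrArg (fun L : E →L[𝕜] ℂ => L v) (h1.unique h2)
    simp at h3
    rw [mem_tangentSpace_iff]
    simp only [Matrix.of_apply]
    linear_combination h3
  · rw [fderiv_zero_of_not_differentiableAt h]
    exact (tangentSpace (φ z)).zero_mem

/-- A holomorphic local parametrization of `SL(2, ℂ)` (the inverse of a holomorphic chart):
an injective holomorphic immersion of an open set `U ⊆ ℂ³`.
Values of the map outside `U` are irrelevant. -/
structure Param where
  toFun : C3 → SL2
  U : Set C3
  isOpen : IsOpen U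
  holomorphic : DifferentiableOn ℂ (fun z => entries (toFun z)) U
  injective : Set.InjOn toFun U
  immersion : ∀ z ∈ U, Function.Injective (fderiv ℂ (fun x => entries (toFun x)) z)

/-- The tangent vector `dφ_z(v)`. -/
def Param.push (φ : Param) (z v : C3) : tangentSpace (φ.toFun z) :=
  ⟨Matrix.of (fderiv ℂ (fun x => entries (φ.toFun x)) z v),
    fderiv_mem_tangentSpace φ.toFun z v⟩

/-! ### Riemannian metrics, lengths, completeness -/

/-- A smooth Riemannian metric on the real manifold underlying `SL(2, ℂ)`. -/
structure RiemMetric where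
  inner : ∀ u : SL2, tangentSpace u →ₗ[ℝ] tangentSpace u →ₗ[ℝ] ℝ
  symm : ∀ u X Y, inner u X Y = inner u Y X
  pos : ∀ u X, X ≠ 0 → 0 < inner u X X
  smooth : ∀ (φ : Param) (v w : C3),
    ContDiffOn ℝ ∞ (fun z => inner (φ.toFun z) (φ.push z v) (φ.push z w)) φ.U

/-- The velocity `γ'(t)` of a curve in `SL(2, ℂ)`. -/
def velocity (γ : ℝ → SL2) (t : ℝ) : tangentSpace (γ t) :=
  ⟨Matrix.of (fderiv ℝ (fun s => entries (γ s)) t 1), fderiv_mem_tangentSpace γ t 1⟩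

/-- The length of `γ` restricted to `[0, 1]`. -/
def RiemMetric.length (g : RiemMetric) (γ : ℝ → SL2) : ℝ≥0∞ :=
  ∫⁻ t in Set.Icc (0 : ℝ) 1,
    ENNReal.ofReal (Real.sqrt (g.inner (γ t) (velocity γ t) (velocity γ t)))

/-- The Riemannian distance: the infimum of the lengths of `C¹` curves from `u` to `v`. -/
def RiemMetric.edist (g : RiemMetric) (u v : SL2) : ℝ≥0∞ :=
  ⨅ (γ : ℝ → SL2) (_ : ContDiff ℝ 1 (fun t => entries (γ t))) (_ : γ 0 = u) (_ : γ 1 = v),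
    g.length γ

/-- Completeness of the Riemannian distance: every Cauchy sequence converges. -/
def RiemMetric.IsComplete (g : RiemMetric) : Prop :=
  ∀ x : ℕ → SL2,
    (∀ ε : ℝ≥0∞, 0 < ε → ∃ N, ∀ m ≥ N, ∀ n ≥ N, g.edist (x m) (x n) < ε) →
    ∃ y : SL2, Filter.Tendsto (fun n => g.edist (x n) y) Filter.atTop (𝓝 0)

/-! ### Invariance -/

/-- `SU(2)` as a subset of `SL(2, ℂ)`. -/
def SU2 : Set SL2 := {a | (a : M2) ∈ Matrix.unitaryGroup (Fin 2) ℂ}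

/-- The differential `X ↦ a X b⁻¹` of the map `u ↦ a u b⁻¹`. -/
def translate (a b u : SL2) (X : tangentSpace u) : tangentSpace (a * u * b⁻¹) :=
  ⟨(a : M2) * X * ((b⁻¹ : SL2) : M2), by
    change (((a * u * b⁻¹)⁻¹ : SL2) * ((a : M2) * (X : M2) * ((b⁻¹ : SL2) : M2))).trace = 0
    have hX : (((u⁻¹ : SL2) : M2) * (X : M2)).trace = 0 := X.2
    have ha : ((a⁻¹ : SL2) : M2) * (a : M2) = 1 := by
      rw [← Matrix.SpecialLinearGroup.coe_mul, inv_mul_cancel, Matrix.SpecialLinearGroup.coe_one]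
    have hb : ((b⁻¹ : SL2) : M2) * (b : M2) = 1 := by
      rw [← Matrix.SpecialLinearGroup.coe_mul, inv_mul_cancel, Matrix.SpecialLinearGroup.coe_one]
    have h1 : (a * u * b⁻¹)⁻¹ = b * (u⁻¹ * a⁻¹) := by group
    rw [h1, Matrix.SpecialLinearGroup.coe_mul, Matrix.SpecialLinearGroup.coe_mul]
    have h2 : (b : M2) * (((u⁻¹ : SL2) : M2) * ((a⁻¹ : SL2) : M2)) *
        ((a : M2) * (X : M2) * ((b⁻¹ : SL2) : M2)) =
        (b : M2) * (((u⁻¹ : SL2) : M2) * (((a⁻¹ : SL2) : M2) * (a : M2)) * (X : M2)) *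
          ((b⁻¹ : SL2) : M2) := by
      simp only [Matrix.mul_assoc]
    rw [h2, ha, Matrix.mul_one, Matrix.trace_mul_comm, ← Matrix.mul_assoc, hb, Matrix.one_mul, hX]⟩

/-- Invariance under the action `(a, b) · u = a u b⁻¹` of `SU(2) × SU(2)`. -/
def RiemMetric.IsInvariant (g : RiemMetric) : Prop :=
  ∀ a ∈ SU2, ∀ b ∈ SU2, ∀ (u : SL2) (X Y : tangentSpace u),
    g.inner (a * u * b⁻¹) (translate a b u X) (translate a b u Y) = g.inner u X Y

/-! ### Kähler metrics -/

/-- The fundamental form `ω(X, Y) = g(iX, Y)`. -/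
def RiemMetric.omega (g : RiemMetric) (u : SL2) (X Y : tangentSpace u) : ℝ :=
  g.inner u (Complex.I • X) Y

/-- The coefficient `ω(v, w)` of the fundamental form in a holomorphic parametrization,
for constant vector fields `v`, `w` on the coordinate domain. -/
def RiemMetric.omegaCoord (g : RiemMetric) (φ : Param) (v w z : C3) : ℝ :=
  g.omega (φ.toFun z) (φ.push z v) (φ.push z w)

/-- A Kähler metric with respect to the standard complex structure: `g(iX, iY) = g(X, Y)` and
`dω = 0`, where `dω` is evaluated on constant vector fields in holomorphic coordinates. -/
structure RiemMetric.IsKahler (g : RiemMetric) : Prop where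
  hermitian : ∀ (u : SL2) (X Y : tangentSpace u),
    g.inner u (Complex.I • X) (Complex.I • Y) = g.inner u X Y
  closed : ∀ (φ : Param), ∀ z ∈ φ.U, ∀ v₁ v₂ v₃ : C3,
    fderiv ℝ (g.omegaCoord φ v₂ v₃) z v₁ + fderiv ℝ (g.omegaCoord φ v₃ v₁) z v₂ +
      fderiv ℝ (g.omegaCoord φ v₁ v₂) z v₃ = 0

/-- The Wirtinger derivative `∂f/∂z_a = (∂f/∂x_a - i ∂f/∂y_a) / 2`. -/
def dZ (a : Fin 3) (f : C3 → ℂ) (z : C3) : ℂ :=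
  (fderiv ℝ f z (Pi.single a 1) - Complex.I * fderiv ℝ f z (Pi.single a Complex.I)) / 2

/-- The Wirtinger derivative `∂f/∂z̄_a = (∂f/∂x_a + i ∂f/∂y_a) / 2`. -/
def dZbar (a : Fin 3) (f : C3 → ℂ) (z : C3) : ℂ :=
  (fderiv ℝ f z (Pi.single a 1) + Complex.I * fderiv ℝ f z (Pi.single a Complex.I)) / 2

/-- The complex Hessian `∂²F/∂z_a∂z̄_b` of a real function: the coefficients of `∂∂̄F`. -/
def complexHessian (F : C3 → ℝ) (z : C3) (a b : Fin 3) : ℂ :=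
  dZ a (dZbar b (fun x => (F x : ℂ))) z

/-- The Hermitian matrix `g_{ab̄} = g(∂/∂z_a, ∂/∂z̄_b)`, with `g` extended complex bilinearly to
the complexified tangent space.  Since `∂/∂z_a = (∂/∂x_a - i ∂/∂y_a) / 2`, for a Hermitian `g` this
equals `(g(∂/∂x_a, ∂/∂x_b) + i g(∂/∂x_a, ∂/∂y_b)) / 2`, and then
`ω = i ∑ g_{ab̄} dz_a ∧ dz̄_b`. -/
def RiemMetric.hermMatrix (g : RiemMetric) (φ : Param) (z : C3) : Matrix (Fin 3) (Fin 3) ℂ :=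
  Matrix.of fun a b =>
    ((g.inner (φ.toFun z) (φ.push z (Pi.single a 1)) (φ.push z (Pi.single b 1)) : ℝ) +
      Complex.I *
        (g.inner (φ.toFun z) (φ.push z (Pi.single a 1)) (φ.push z (Pi.single b Complex.I)) : ℝ)) / 2

/-- Ricci-flatness of a Kähler metric: the Ricci form, given in holomorphic coordinates by
`-i ∂∂̄ log det (g_{ab̄})`, vanishes. (For a Kähler metric `det (g_{ab̄})` is real and positive.) -/
def RiemMetric.IsRicciFlat (g : RiemMetric) : Prop :=
  ∀ (φ : Param), ∀ z ∈ φ.U, ∀ a b : Fin 3,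
    complexHessian (fun x => Real.log (g.hermMatrix φ x).det.re) z a b = 0

/-- `K` is a Kähler potential of `g`: `K` is smooth and `g_{ab̄} = ∂²K/∂z_a∂z̄_b` in all
holomorphic coordinates, that is, `ω = i ∂∂̄K`. -/
def RiemMetric.HasPotential (g : RiemMetric) (K : SL2 → ℝ) : Prop :=
  ∀ φ : Param, ContDiffOn ℝ ∞ (fun z => K (φ.toFun z)) φ.U ∧
    ∀ z ∈ φ.U, ∀ a b : Fin 3,
      g.hermMatrix φ z a b = complexHessian (fun x => K (φ.toFun x)) z a b

/-- A complete `SU(2) × SU(2)`-invariant Ricci-flat Kähler metric on `SL(2, ℂ)`. -/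
structure RiemMetric.IsCompleteInvariantRicciFlatKahler (g : RiemMetric) : Prop where
  isKahler : g.IsKahler
  isInvariant : g.IsInvariant
  isRicciFlat : g.IsRicciFlat
  isComplete : g.IsComplete

/-! ### The Lie algebra `su(2)` and the polar decomposition -/

/-- The Lie algebra `su(2)` of trace-free skew-Hermitian matrices. -/
def su2 : Set M2 := {h | h.conjTranspose = -h ∧ h.trace = 0}

/-- The `Ad SU(2)`-invariant norm `|h| = √(2 tr (h* h))` on `su(2)`, for which the basis
`iσ_j / 2` (`σ_j` the Pauli matrices) is orthonormal.  It is the normalization for which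
`(ad h)²` has the eigenvalue `-|h|²` on the orthogonal complement of `h`. -/
def su2Norm (h : M2) : ℝ := Real.sqrt (2 * (h.conjTranspose * h).trace.re)

/-- `u = a exp (i h)` with `a ∈ SU(2)` and `h ∈ su(2)`. -/
def IsPolar (u a : SL2) (h : M2) : Prop :=
  a ∈ SU2 ∧ h ∈ su2 ∧ (u : M2) = (a : M2) * NormedSpace.exp (Complex.I • h)

end SL2Kahler

end

open SL2Kahler

/-!
By the Cartan decomposition `SL(2, ℂ) = SU(2) · {diag (e^{t/2}, e^{-t/2})} · SU(2)`, an invariant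
Hermitian metric is determined by its values at `diag (e^{t/2}, e^{-t/2})`.  Invariance under the
diagonal torus makes it diagonal there, with a coefficient `p` in the radial direction and
coefficients `q`, `r` of the upper and the lower matrix unit.  Evaluating `dω = 0` on fundamental
vector fields of the action gives `q = r` and `p eᵗ = 2 (q sinh t)'`.  Ricci-flatness says that the
logarithm of the volume density, a radial function, is pluriharmonic; being smooth, it is constant,
so that `p eᵗ q²`, hence `(q sinh t)² (q sinh t)' / sinh² t`, is constant.  Since `q sinh t`
vanishes at `t = 0`, its cube is a multiple of `sinh (2t) - 2t`, and the metric is unique up to a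
factor.

For existence, the potential is a smooth function of `x = cosh |h|`, which is half the squared
Frobenius norm of `u` and so the restriction of a real polynomial.  The Ricci-flat equation becomes
an ordinary differential equation in `x`.  The metric is complete because the proper function
`log (x + 1)` is Lipschitz.
-/

noncomputable section

namespace SL2Kahler

open scoped Matrix

/-! ### Parametric integrals and holomorphic functions of several variables -/

theorem hasFDerivAt_intervalIntegral_of_continuousOn {𝕜 H E : Type*} [RCLike 𝕜]
    [NormedAddCommGroup H] [NormedSpace 𝕜 H] [NormedAddCommGroup E] [NormedSpace ℝ E]
    [NormedSpace 𝕜 E] {F : H → ℝ → E} {F' : H → ℝ → H →L[𝕜] E} {s : Set H} {x₀ : H} {a b : ℝ}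
    (hs : s ∈ 𝓝 x₀) (hF : ∀ x ∈ s, ContinuousOn (F x) (Set.uIcc a b))
    (hF' : ContinuousOn (Function.uncurry F') (s ×ˢ Set.uIcc a b))
    (hderiv : ∀ x ∈ s, ∀ t ∈ Set.uIcc a b, HasFDerivAt (F · t) (F' x t) x) :
    HasFDerivAt (fun x => ∫ t in a..b, F x t) (∫ t in a..b, F' x₀ t) x₀ := by
  have hF'₀ : ContinuousOn (F' x₀) (Set.uIcc a b) :=
    hF'.comp (f := fun t => (x₀, t)) (by fun_prop) fun t ht => ⟨mem_of_mem_nhds hs, ht⟩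
  obtain ⟨C, hC⟩ := isCompact_uIcc.exists_bound_of_continuousOn hF'₀
  have hbound : ∀ᶠ x in 𝓝 x₀, ∀ t ∈ Set.uIcc a b, (x, t) ∈ s ×ˢ Set.uIcc a b → ‖F' x t‖ < C + 1 :=
    isCompact_uIcc.eventually_forall_of_forall_eventually fun t ht => eventually_nhdsWithin_iff.1 <|
      (hF' (x₀, t) ⟨mem_of_mem_nhds hs, ht⟩).norm.eventually_lt_const
        ((hC t ht).trans_lt (lt_add_one C))
  exact intervalIntegral.hasFDerivAt_integral_of_dominated_of_fderiv_le (𝕜 := 𝕜)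
    (bound := fun _ => C + 1) (Filter.inter_mem hs hbound)
    (Filter.eventually_of_mem hs fun x hx =>
      (hF x hx).intervalIntegrable.aestronglyMeasurable_restrict_uIoc)
    (hF x₀ (mem_of_mem_nhds hs)).intervalIntegrable
    hF'₀.intervalIntegrable.aestronglyMeasurable_restrict_uIoc
    (.of_forall fun t ht x hx =>
      (hx.2 t (Set.uIoc_subset_uIcc ht) ⟨hx.1, Set.uIoc_subset_uIcc ht⟩).le)
    (by simp)
    (.of_forall fun t ht x hx => hderiv x hx.1 t (Set.uIoc_subset_uIcc ht))

section Holomorphic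

variable {E F : Type*} [NormedAddCommGroup E] [NormedSpace ℂ E]
  [NormedAddCommGroup F] [NormedSpace ℂ F] {f : E → F}

theorem hasDerivAt_comp_add_smul {x v : E} {ζ : ℂ} (hf : DifferentiableAt ℂ f (x + ζ • v)) :
    HasDerivAt (fun w : ℂ => f (x + w • v)) (fderiv ℂ f (x + ζ • v) v) ζ := by
  have hline : HasDerivAt (fun w : ℂ => x + w • v) v ζ := by
    simpa using ((hasDerivAt_id ζ).smul_const v).const_add x
  exact hf.hasFDerivAt.comp_hasDerivAt ζ hline

theorem norm_fderiv_le_of_forall_mem_closedBall {x : E} {r C : ℝ} (hr : 0 < r)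
    (hd : ∀ y ∈ Metric.closedBall x r, DifferentiableAt ℂ f y)
    (hC : ∀ y ∈ Metric.closedBall x r, ‖f y‖ ≤ C) : ‖fderiv ℂ f x‖ ≤ C / r := by
  have hx : x ∈ Metric.closedBall x r := Metric.mem_closedBall_self hr.le
  have hC0 : 0 ≤ C := (norm_nonneg _).trans (hC x hx)
  refine ContinuousLinearMap.opNorm_le_bound _ (by positivity) fun v => ?_
  rcases eq_or_ne v 0 with rfl | hv
  · simp
  have hv' : 0 < ‖v‖ := norm_pos_iff.2 hv
  have hmem : ∀ ζ ∈ Metric.closedBall (0 : ℂ) (r / ‖v‖), x + ζ • v ∈ Metric.closedBall x r := by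
    intro ζ hζ
    rw [mem_closedBall_zero_iff] at hζ
    rw [mem_closedBall_iff_norm, add_sub_cancel_left, norm_smul]
    exact (le_div_iff₀ hv').1 hζ
  have hline : DiffContOnCl ℂ (fun ζ : ℂ => f (x + ζ • v)) (Metric.ball 0 (r / ‖v‖)) :=
    DifferentiableOn.diffContOnCl fun ζ hζ => (hasDerivAt_comp_add_smul
      (hd _ (hmem ζ (Metric.closure_ball_subset_closedBall hζ)))
      ).differentiableAt.differentiableWithinAt
  have hcauchy := Complex.norm_deriv_le_of_forall_mem_sphere_norm_le (div_pos hr hv') hline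
    fun ζ hζ => hC _ (hmem ζ (Metric.sphere_subset_closedBall hζ))
  have hderiv : deriv (fun ζ : ℂ => f (x + ζ • v)) 0 = fderiv ℂ f x v := by
    simpa using (hasDerivAt_comp_add_smul (v := v) (ζ := 0) (by simpa using hd x hx)).deriv
  calc ‖fderiv ℂ f x v‖ ≤ C / (r / ‖v‖) := hderiv ▸ hcauchy
    _ = C / r * ‖v‖ := by field_simp

theorem exists_eventually_norm_fderiv_le {z : E} (hf : ∀ᶠ x in 𝓝 z, DifferentiableAt ℂ f x) :
    ∃ C, ∀ᶠ x in 𝓝 z, ‖fderiv ℂ f x‖ ≤ C := by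
  have hbdd : ∀ᶠ x in 𝓝 z, ‖f x‖ < ‖f z‖ + 1 :=
    hf.self_of_nhds.continuousAt.norm.eventually_lt_const (lt_add_one _)
  obtain ⟨r, hr, hball⟩ := Metric.nhds_basis_closedBall.eventually_iff.1 (hf.and hbdd)
  refine ⟨(‖f z‖ + 1) / (r / 2), ?_⟩
  filter_upwards [Metric.closedBall_mem_nhds z (half_pos hr)] with x hx
  have hsub : Metric.closedBall x (r / 2) ⊆ Metric.closedBall z r :=
    Metric.closedBall_subset_closedBall' (by linarith [Metric.mem_closedBall.1 hx])
  exact norm_fderiv_le_of_forall_mem_closedBall (half_pos hr) (fun y hy => (hball (hsub hy)).1)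
    fun y hy => (hball (hsub hy)).2.le

theorem continuousAt_fderiv_of_eventually_differentiableAt {z : E}
    (hf : ∀ᶠ x in 𝓝 z, DifferentiableAt ℂ f x) : ContinuousAt (fderiv ℂ f) z := by
  obtain ⟨C, hC⟩ := exists_eventually_norm_fderiv_le hf
  obtain ⟨r, hr, hball⟩ := Metric.nhds_basis_closedBall.eventually_iff.1 (hf.and hC)
  -- The Cauchy estimate for `w ↦ f (w + (x - z)) - f w`, which is `O(‖x - z‖)` near `z`.
  have hlip : ∀ x ∈ Metric.closedBall z (r / 2),
      ‖fderiv ℂ f x - fderiv ℂ f z‖ ≤ C * ‖x - z‖ / (r / 2) := by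
    intro x hx
    have hmem : ∀ w ∈ Metric.closedBall z (r / 2), w ∈ Metric.closedBall z r ∧
        w + (x - z) ∈ Metric.closedBall z r := by
      intro w hw
      rw [mem_closedBall_iff_norm] at hx hw ⊢
      rw [mem_closedBall_iff_norm]
      refine ⟨by linarith, ?_⟩
      calc ‖w + (x - z) - z‖ = ‖(w - z) + (x - z)‖ := by congr 1; abel
        _ ≤ r := by linarith [norm_add_le (w - z) (x - z)]
    have hdiff : ∀ w ∈ Metric.closedBall z (r / 2),
        HasFDerivAt (fun w => f (w + (x - z)) - f w)
          (fderiv ℂ f (w + (x - z)) - fderiv ℂ f w) w := fun w hw =>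
      ((hasFDerivAt_comp_add_right _).2 (hball (hmem w hw).2).1.hasFDerivAt).sub
        (hball (hmem w hw).1).1.hasFDerivAt
    have hz : z ∈ Metric.closedBall z (r / 2) := Metric.mem_closedBall_self (half_pos hr).le
    have hest := norm_fderiv_le_of_forall_mem_closedBall (C := C * ‖x - z‖) (half_pos hr)
      (fun w hw => (hdiff w hw).differentiableAt) fun w hw => by
        simpa using (convex_closedBall z r).norm_image_sub_le_of_norm_fderiv_le (𝕜 := ℂ)
          (fun y hy => (hball hy).1) (fun y hy => (hball hy).2) (hmem w hw).1 (hmem w hw).2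
    rwa [(hdiff z hz).fderiv, add_sub_cancel] at hest
  rw [ContinuousAt, tendsto_iff_norm_sub_tendsto_zero]
  have hlim : Filter.Tendsto (fun x => C * ‖x - z‖ / (r / 2)) (𝓝 z) (𝓝 0) := by
    have : Continuous fun x => C * ‖x - z‖ / (r / 2) := by fun_prop
    simpa using this.tendsto z
  exact squeeze_zero' (.of_forall fun _ => norm_nonneg _)
    (Filter.eventually_of_mem (Metric.closedBall_mem_nhds z (half_pos hr)) hlip) hlim

variable [CompleteSpace F] {U : Set E}

theorem fderiv_apply_eq_circleIntegral (hU : IsOpen U) (hf : DifferentiableOn ℂ f U) {x v : E}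
    {ρ : ℝ} (hρ : 0 < ρ) (hmem : ∀ ζ ∈ Metric.closedBall (0 : ℂ) ρ, x + ζ • v ∈ U) :
    fderiv ℂ f x v =
      (2 * Real.pi * Complex.I : ℂ)⁻¹ • ∮ ζ in C(0, ρ), (ζ ^ 2)⁻¹ • f (x + ζ • v) := by
  have hline : ∀ ζ : ℂ, x + ζ • v ∈ U →
      HasDerivAt (fun w : ℂ => f (x + w • v)) (fderiv ℂ f (x + ζ • v) v) ζ := fun ζ hζ =>
    hasDerivAt_comp_add_smul (hf.differentiableAt (hU.mem_nhds hζ))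
  have hcauchy := Complex.two_pi_I_inv_smul_circleIntegral_sub_sq_inv_smul_of_differentiable
    (U := {ζ : ℂ | x + ζ • v ∈ U}) (hU.preimage (by fun_prop)) hmem
    (fun ζ hζ => (hline ζ hζ).differentiableAt.differentiableWithinAt) (Metric.mem_ball_self hρ)
  rw [(hline 0 (hmem 0 (Metric.mem_closedBall_self hρ.le))).deriv] at hcauchy
  simpa using hcauchy.symm

theorem exists_forall_mem_closedBall_add_smul_mem (hU : IsOpen U) {z : E} (hz : z ∈ U) (v : E) :
    ∃ ρ > 0, ∀ᶠ x in 𝓝 z, ∀ ζ ∈ Metric.closedBall (0 : ℂ) ρ, x + ζ • v ∈ U := by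
  have hcont : Continuous fun p : E × ℂ => p.1 + p.2 • v := by fun_prop
  have hev : ∀ᶠ p : E × ℂ in 𝓝 z ×ˢ 𝓝 0, p.1 + p.2 • v ∈ U := by
    rw [← nhds_prod_eq]
    exact hcont.continuousAt.eventually_mem (hU.mem_nhds (by simpa using hz))
  obtain ⟨P, hP, Q, hQ, hPQ⟩ := Filter.eventually_prod_iff.1 hev
  obtain ⟨ρ, hρ, hball⟩ := Metric.nhds_basis_closedBall.eventually_iff.1 hQ
  exact ⟨ρ, hρ, hP.mono fun x hx ζ hζ => hPQ hx (hball hζ)⟩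

theorem differentiableOn_fderiv_apply (hU : IsOpen U) (hf : DifferentiableOn ℂ f U) (v : E) :
    DifferentiableOn ℂ (fun z => fderiv ℂ f z v) U := by
  intro z hz
  obtain ⟨ρ, hρ, hmem⟩ := exists_forall_mem_closedBall_add_smul_mem hU hz v
  set c : ℝ → ℂ := fun θ => deriv (circleMap 0 ρ) θ * (circleMap 0 ρ θ ^ 2)⁻¹
  have hcircle : ∀ θ, circleMap 0 ρ θ ∈ Metric.closedBall (0 : ℂ) ρ :=
    circleMap_mem_closedBall 0 hρ.le
  have hc : Continuous c := by
    simp only [c, deriv_circleMap]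
    exact (by fun_prop : Continuous fun θ => circleMap 0 ρ θ * Complex.I).mul
      (((continuous_circleMap 0 ρ).pow 2).inv₀ fun θ => pow_ne_zero _ (circleMap_ne_center hρ.ne'))
  have hf' : ContinuousOn (fderiv ℂ f) U := fun x hx =>
    (continuousAt_fderiv_of_eventually_differentiableAt
      (hf.eventually_differentiableAt (hU.mem_nhds hx))).continuousWithinAt
  have hkey := hasFDerivAt_intervalIntegral_of_continuousOn (𝕜 := ℂ) (a := 0) (b := 2 * Real.pi)
    (F := fun x θ => c θ • f (x + circleMap 0 ρ θ • v))
    (F' := fun x θ => c θ • fderiv ℂ f (x + circleMap 0 ρ θ • v)) hmem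
    (fun x hx => hc.continuousOn.smul
      (hf.continuousOn.comp (by fun_prop) fun θ _ => hx _ (hcircle θ)))
    ((hc.comp continuous_snd).continuousOn.smul
      (hf'.comp (by fun_prop) fun p hp => hp.1 _ (hcircle p.2)))
    fun x hx θ _ => ((hasFDerivAt_comp_add_right _).2
      (hf.differentiableAt (hU.mem_nhds (hx _ (hcircle θ)))).hasFDerivAt).const_smul (c θ)
  refine ((hkey.const_smul (2 * Real.pi * Complex.I : ℂ)⁻¹).congr_of_eventuallyEq
    ?_).differentiableAt.differentiableWithinAt
  filter_upwards [hmem] with x hx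
  simp only [fderiv_apply_eq_circleIntegral hU hf hρ hx, circleIntegral, c, smul_smul,
    Pi.smul_apply]

theorem contDiffOn_of_differentiableOn [FiniteDimensional ℂ E] (hU : IsOpen U)
    (hf : DifferentiableOn ℂ f U) : ContDiffOn ℂ ∞ f U := by
  rw [contDiffOn_infty]
  intro n
  induction n generalizing f with
  | zero => exact contDiffOn_zero.2 hf.continuousOn
  | succ n ih =>
    rw [Nat.cast_succ, contDiffOn_succ_iff_fderiv_of_isOpen hU]
    refine ⟨hf, fun h => absurd h (by simp), contDiffOn_clm_apply.2 fun v =>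
      ih (differentiableOn_fderiv_apply hU hf v)⟩

end Holomorphic

/-! ### The radial profile of the potential -/

/-- The integrals `∫₀¹ sⁿ (2 + (x - 1) s²)^α ds`, used to extend functions of `t` smoothly through
`t = 0` as functions of `x = cosh t`. -/
def radialIntegral (n : ℕ) (α x : ℝ) : ℝ :=
  ∫ s in (0 : ℝ)..1, s ^ n * (2 + (x - 1) * s ^ 2) ^ α

theorem radialBase_pos {x s : ℝ} (hx : -1 < x) (hs : s ∈ Set.uIcc (0 : ℝ) 1) :
    0 < 2 + (x - 1) * s ^ 2 := by
  rw [Set.uIcc_of_le zero_le_one] at hs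
  have hs' : s ^ 2 ≤ 1 := pow_le_one₀ hs.1 hs.2
  nlinarith [mul_nonneg (neg_lt_iff_pos_add.1 hx).le (sq_nonneg s)]

theorem continuousOn_radialIntegrand (n : ℕ) (α : ℝ) :
    ContinuousOn (fun p : ℝ × ℝ => p.2 ^ n * (2 + (p.1 - 1) * p.2 ^ 2) ^ α)
      (Set.Ioi (-1) ×ˢ Set.uIcc 0 1) :=
  ContinuousOn.mul (by fun_prop) (ContinuousOn.rpow_const (by fun_prop) fun _ hp =>
    Or.inl (radialBase_pos hp.1 hp.2).ne')

theorem continuousOn_radialIntegrand_right (n : ℕ) (α : ℝ) {x : ℝ} (hx : -1 < x) :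
    ContinuousOn (fun s : ℝ => s ^ n * (2 + (x - 1) * s ^ 2) ^ α) (Set.uIcc 0 1) :=
  (continuousOn_radialIntegrand n α).comp (f := fun s : ℝ => (x, s)) (by fun_prop)
    fun _ hs => ⟨hx, hs⟩

theorem hasDerivAt_radialIntegral (n : ℕ) (α : ℝ) {x : ℝ} (hx : -1 < x) :
    HasDerivAt (radialIntegral n α) (α * radialIntegral (n + 2) (α - 1) x) x := by
  have hbase : ∀ y s : ℝ, HasDerivAt (fun y : ℝ => 2 + (y - 1) * s ^ 2) (s ^ 2) y := fun y s => by
    simpa using (((hasDerivAt_id y).sub_const 1).mul_const (s ^ 2)).const_add 2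
  have hkey := hasFDerivAt_intervalIntegral_of_continuousOn (𝕜 := ℝ) (a := 0) (b := 1)
    (F := fun y s => s ^ n * (2 + (y - 1) * s ^ 2) ^ α)
    (F' := fun y s =>
      (α * (s ^ (n + 2) * (2 + (y - 1) * s ^ 2) ^ (α - 1))) • (1 : ℝ →L[ℝ] ℝ))
    (isOpen_Ioi.mem_nhds hx) (fun y hy => continuousOn_radialIntegrand_right n α hy)
    ((continuousOn_const.mul (continuousOn_radialIntegrand (n + 2) (α - 1))).smul
      continuousOn_const)
    (fun y hy s hs => by
      rw [hasFDerivAt_iff_hasDerivAt]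
      convert! ((hbase y s).rpow_const (p := α) (Or.inl (radialBase_pos hy hs).ne')).const_mul
        (s ^ n) using 1
      simp only [smul_apply, one_apply_eq_self, smul_eq_mul]
      ring)
  rw [intervalIntegral.integral_smul_const, intervalIntegral.integral_const_mul] at hkey
  convert! hkey.hasDerivAt using 1
  simp [radialIntegral]

theorem contDiffOn_radialIntegral (n : ℕ) (α : ℝ) :
    ContDiffOn ℝ ∞ (radialIntegral n α) (Set.Ioi (-1)) := by
  rw [contDiffOn_infty]
  intro k
  induction k generalizing n α with
  | zero =>
    exact contDiffOn_zero.2 fun x hx =>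
      (hasDerivAt_radialIntegral n α hx).continuousAt.continuousWithinAt
  | succ k ih =>
    rw [Nat.cast_succ, contDiffOn_succ_iff_deriv_of_isOpen isOpen_Ioi]
    refine ⟨fun x hx =>
      (hasDerivAt_radialIntegral n α hx).differentiableAt.differentiableWithinAt,
      fun h => absurd h (by simp), ?_⟩
    exact ((contDiffOn_const (c := α)).mul (ih (n + 2) (α - 1))).congr fun x hx =>
      (hasDerivAt_radialIntegral n α hx).deriv

theorem radialIntegral_pos (n : ℕ) (α : ℝ) {x : ℝ} (hx : -1 < x) : 0 < radialIntegral n α x :=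
  intervalIntegral.intervalIntegral_pos_of_pos_on
    (continuousOn_radialIntegrand_right n α hx).intervalIntegrable
    (fun _ hs => mul_pos (pow_pos hs.1 n) (Real.rpow_pos_of_pos (radialBase_pos hx
      (Set.uIcc_of_le (zero_le_one' ℝ) ▸ Set.Ioo_subset_Icc_self hs)) _)) zero_lt_one

theorem radialIntegral_le (n : ℕ) {α : ℝ} (hα : 0 ≤ α) {x : ℝ} (hx : 1 ≤ x) :
    radialIntegral n α x ≤ (x + 1) ^ α / (n + 1) := by
  have hx' : -1 < x := by linarith
  calc radialIntegral n α x ≤ ∫ s in (0 : ℝ)..1, s ^ n * (x + 1) ^ α := by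
        refine intervalIntegral.integral_mono_on zero_le_one
          (continuousOn_radialIntegrand_right n α hx').intervalIntegrable
          (Continuous.intervalIntegrable (by fun_prop) _ _) fun s hs => ?_
        have hbase := (radialBase_pos hx' (Set.uIcc_of_le (zero_le_one' ℝ) ▸ hs)).le
        have hs' : s ^ 2 ≤ 1 := pow_le_one₀ hs.1 hs.2
        exact mul_le_mul_of_nonneg_left
          (Real.rpow_le_rpow hbase (by nlinarith) hα) (pow_nonneg hs.1 n)
    _ = (x + 1) ^ α / (n + 1) := by
        rw [intervalIntegral.integral_mul_const, integral_pow, one_pow, zero_pow n.succ_ne_zero]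
        ring

theorem radialIntegral_by_parts (n : ℕ) (α : ℝ) {x : ℝ} (hx : -1 < x) :
    (n + 1) * radialIntegral n α x +
      2 * α * (x - 1) * radialIntegral (n + 2) (α - 1) x = (x + 1) ^ α := by
  have hderiv : ∀ s ∈ Set.uIcc (0 : ℝ) 1,
      HasDerivAt (fun s : ℝ => s ^ (n + 1) * (2 + (x - 1) * s ^ 2) ^ α)
        ((n + 1) * (s ^ n * (2 + (x - 1) * s ^ 2) ^ α) +
          2 * α * (x - 1) * (s ^ (n + 2) * (2 + (x - 1) * s ^ 2) ^ (α - 1))) s := by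
    intro s hs
    have hbase : HasDerivAt (fun s : ℝ => 2 + (x - 1) * s ^ 2) ((x - 1) * (2 * s)) s := by
      simpa using ((hasDerivAt_pow 2 s).const_mul (x - 1)).const_add 2
    convert! (hasDerivAt_pow (n + 1) s).mul (hbase.rpow_const (p := α)
      (Or.inl (radialBase_pos hx hs).ne')) using 1
    rw [Nat.add_sub_cancel]
    push_cast
    ring
  have hint : ∀ (k : ℕ) (β c : ℝ), IntervalIntegrable
      (fun s : ℝ => c * (s ^ k * (2 + (x - 1) * s ^ 2) ^ β)) MeasureTheory.volume 0 1 :=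
    fun k β c => (continuousOn_radialIntegrand_right k β hx).intervalIntegrable.const_mul c
  have hftc := intervalIntegral.integral_eq_sub_of_hasDerivAt hderiv
    ((hint n α _).add (hint (n + 2) (α - 1) _))
  rw [intervalIntegral.integral_add (hint n α _) (hint (n + 2) (α - 1) _),
    intervalIntegral.integral_const_mul, intervalIntegral.integral_const_mul] at hftc
  rw [radialIntegral, radialIntegral, hftc]
  norm_num [show 2 + (x - 1) = x + 1 by ring]

/-- The smooth function `f` with `f (cosh t) * sinh t ^ 3 = sinh (2 * t) - 2 * t`.  The formula
comes from `sinh (2 * t) - 2 * t = 4 ∫₀ᵗ sinh² y dy` by the substitution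
`s = sinh (y / 2) / sinh (t / 2)`. -/
def profileCube (x : ℝ) : ℝ := 8 * radialIntegral 2 (1 / 2) x * (x + 1) ^ (-3 / 2 : ℝ)

/-- The derivative of the potential with respect to `cosh |h|`. -/
def profile (x : ℝ) : ℝ := profileCube x ^ (1 / 3 : ℝ)

theorem profileCube_pos {x : ℝ} (hx : -1 < x) : 0 < profileCube x :=
  mul_pos (mul_pos (by norm_num) (radialIntegral_pos 2 _ hx))
    (Real.rpow_pos_of_pos (by linarith) _)

theorem profile_pos {x : ℝ} (hx : -1 < x) : 0 < profile x :=
  Real.rpow_pos_of_pos (profileCube_pos hx) _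

theorem profile_pow_three {x : ℝ} (hx : -1 < x) : profile x ^ 3 = profileCube x := by
  rw [profile, ← Real.rpow_natCast, ← Real.rpow_mul (profileCube_pos hx).le]
  norm_num

theorem contDiffOn_profileCube : ContDiffOn ℝ ∞ profileCube (Set.Ioi (-1)) :=
  (contDiffOn_const.mul (contDiffOn_radialIntegral 2 _)).mul <|
    ContDiffOn.rpow_const_of_ne (by fun_prop) fun _ hx => (neg_lt_iff_pos_add.1 hx).ne'

theorem contDiffOn_profile : ContDiffOn ℝ ∞ profile (Set.Ioi (-1)) :=
  contDiffOn_profileCube.rpow_const_of_ne fun _ hx => (profileCube_pos hx).ne'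

theorem contDiffOn_deriv_profile : ContDiffOn ℝ ∞ (deriv profile) (Set.Ioi (-1)) :=
  contDiffOn_profile.deriv_of_isOpen isOpen_Ioi le_rfl

theorem hasDerivAt_profile {x : ℝ} (hx : -1 < x) : HasDerivAt profile (deriv profile x) x :=
  ((contDiffOn_profile.contDiffAt (isOpen_Ioi.mem_nhds hx)).differentiableAt
    (by simp)).hasDerivAt

theorem hasDerivAt_profileCube {x : ℝ} (hx : -1 < x) :
    HasDerivAt profileCube (deriv profileCube x) x :=
  ((contDiffOn_profileCube.contDiffAt (isOpen_Ioi.mem_nhds hx)).differentiableAt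
    (by simp)).hasDerivAt

theorem profileCube_ode {x : ℝ} (hx : -1 < x) :
    (x ^ 2 - 1) * deriv profileCube x + 3 * x * profileCube x = 4 := by
  have hx1 : 0 < x + 1 := by linarith
  set y := (x + 1) ^ (-5 / 2 : ℝ)
  have hpow : HasDerivAt (fun x : ℝ => (x + 1) ^ (-3 / 2 : ℝ)) (-3 / 2 * y) x := by
    convert! ((hasDerivAt_id x).add_const 1).rpow_const (p := (-3 / 2 : ℝ)) (Or.inl hx1.ne')
      using 1
    norm_num [y]
  have hderiv : deriv profileCube x = _ :=
    (((hasDerivAt_radialIntegral 2 (1 / 2) hx).const_mul 8).mul hpow).deriv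
  have hparts := radialIntegral_by_parts 2 (1 / 2) hx
  have hthree : (x + 1) ^ (-3 / 2 : ℝ) = (x + 1) * y := by
    rw [← Real.rpow_one_add' hx1.le (by norm_num)]
    norm_num
  have hhalf : (x + 1) ^ 2 * y * (x + 1) ^ (1 / 2 : ℝ) = 1 := by
    rw [← Real.rpow_natCast, ← Real.rpow_add hx1, ← Real.rpow_add hx1]
    norm_num
  rw [hderiv, profileCube, hthree]
  linear_combination (8 * (x + 1) ^ 2 * y) * hparts / 2 + 4 * hhalf

/-- The Ricci-flat equation for a potential that is a function of `cosh |h|`. -/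
theorem profile_ode {x : ℝ} (hx : -1 < x) :
    profile x ^ 2 * ((x ^ 2 - 1) * deriv profile x + x * profile x) = 4 / 3 := by
  have hcube : HasDerivAt (fun y => profile y ^ 3) (3 * profile x ^ 2 * deriv profile x) x := by
    simpa using (hasDerivAt_profile hx).fun_pow 3
  have heq : (fun y => profile y ^ 3) =ᶠ[𝓝 x] profileCube := by
    filter_upwards [isOpen_Ioi.mem_nhds hx] with y hy using profile_pow_three hy
  have hode := profileCube_ode hx
  rw [← heq.deriv_eq, hcube.deriv, ← profile_pow_three hx] at hode
  linear_combination hode / 3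

theorem profileCube_le {x : ℝ} (hx : 1 ≤ x) : profileCube x ≤ 4 / 3 := by
  have hx1 : 0 < x + 1 := by linarith
  have hint := radialIntegral_le 2 (α := 1 / 2) (by norm_num) hx
  have hpow : (x + 1) ^ (1 / 2 : ℝ) * (x + 1) ^ (-3 / 2 : ℝ) = (x + 1)⁻¹ := by
    rw [← Real.rpow_add hx1, ← Real.rpow_neg_one]
    norm_num
  calc profileCube x ≤ 8 * ((x + 1) ^ (1 / 2 : ℝ) / (2 + 1)) * (x + 1) ^ (-3 / 2 : ℝ) := by
        have := Real.rpow_pos_of_pos hx1 (-3 / 2 : ℝ)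
        unfold profileCube
        gcongr
        exact_mod_cast hint
    _ = 8 / 3 * (x + 1)⁻¹ := by rw [← hpow]; ring
    _ ≤ 8 / 3 * 2⁻¹ := by gcongr; linarith
    _ = 4 / 3 := by norm_num

theorem one_le_radialHessian {x : ℝ} (hx : 1 ≤ x) :
    1 ≤ (x ^ 2 - 1) * deriv profile x + x * profile x := by
  have hx' : -1 < x := by linarith
  have hpos := profile_pos hx'
  have hode := profile_ode hx'
  have hcube := profileCube_le hx
  rw [← profile_pow_three hx'] at hcube
  have hsq : profile x ^ 2 ≤ 4 / 3 := by
    rcases le_total (profile x) 1 with h | h <;> nlinarith [sq_nonneg (profile x)]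
  by_contra! hlt
  nlinarith [pow_pos hpos 2]

theorem neg_one_lt_cosh (t : ℝ) : -1 < Real.cosh t := by linarith [Real.cosh_pos t]

theorem profileCube_cosh (t : ℝ) :
    profileCube (Real.cosh t) * Real.sinh t ^ 3 = Real.sinh (2 * t) - 2 * t := by
  have hderiv : ∀ s : ℝ, HasDerivAt (fun s =>
      profileCube (Real.cosh s) * Real.sinh s ^ 3 - (Real.sinh (2 * s) - 2 * s)) 0 s := by
    intro s
    have hcube : HasDerivAt (fun s => Real.sinh s ^ 3) (3 * Real.sinh s ^ 2 * Real.cosh s) s := by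
      simpa using (Real.hasDerivAt_sinh s).fun_pow 3
    have hdouble : HasDerivAt (fun s : ℝ => 2 * s) 2 s := by
      simpa using (hasDerivAt_id s).const_mul (2 : ℝ)
    convert! (((hasDerivAt_profileCube (neg_one_lt_cosh s)).comp s
      (Real.hasDerivAt_cosh s)).mul hcube).sub (hdouble.sinh.sub hdouble) using 1
    have hode := profileCube_ode (neg_one_lt_cosh s)
    rw [Real.cosh_sq s] at hode
    rw [Real.cosh_two_mul, Real.cosh_sq s, Function.comp]
    linear_combination (-Real.sinh s ^ 2) * hode
  have hconst := is_const_of_deriv_eq_zero (fun s => (hderiv s).differentiableAt)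
    (fun s => (hderiv s).deriv) t 0
  simpa [sub_eq_zero] using hconst

theorem profile_cosh {t : ℝ} (ht : 0 ≤ t) :
    profile (Real.cosh t) * Real.sinh t = (Real.sinh (2 * t) - 2 * t) ^ (1 / 3 : ℝ) := by
  have hsinh : 0 ≤ Real.sinh t := Real.sinh_nonneg_iff.2 ht
  rw [← profileCube_cosh, Real.mul_rpow (profileCube_pos (neg_one_lt_cosh t)).le
    (pow_nonneg hsinh 3), profile, ← Real.rpow_natCast, ← Real.rpow_mul hsinh]
  norm_num

/-- The Kähler potential as a function of `cosh |h|`. -/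
def radialPotential (x : ℝ) : ℝ := ∫ y in (1 : ℝ)..x, profile y

theorem hasDerivAt_radialPotential {x : ℝ} (hx : -1 < x) :
    HasDerivAt radialPotential (profile x) x := by
  have hcont := contDiffOn_profile.continuousOn
  have hsub : Set.uIcc 1 x ⊆ Set.Ioi (-1) :=
    (Set.ordConnected_Ioi).uIcc_subset (by norm_num) hx
  exact intervalIntegral.integral_hasDerivAt_right (hcont.mono hsub).intervalIntegrable
    (hcont.stronglyMeasurableAtFilter isOpen_Ioi x hx)
    (hcont.continuousAt (isOpen_Ioi.mem_nhds hx))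

theorem contDiffOn_radialPotential : ContDiffOn ℝ ∞ radialPotential (Set.Ioi (-1)) :=
  (contDiffOn_infty_iff_deriv_of_isOpen isOpen_Ioi).2
    ⟨fun _ hx => (hasDerivAt_radialPotential hx).differentiableAt.differentiableWithinAt,
      contDiffOn_profile.congr fun _ hx => (hasDerivAt_radialPotential hx).deriv⟩

theorem radialPotential_cosh {t : ℝ} (ht : 0 ≤ t) :
    radialPotential (Real.cosh t) =
      ∫ s in (0 : ℝ)..t, (Real.sinh (2 * s) - 2 * s) ^ (1 / 3 : ℝ) := by
  have hderiv : ∀ s ∈ Set.uIcc 0 t, HasDerivAt (fun s => radialPotential (Real.cosh s))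
      ((Real.sinh (2 * s) - 2 * s) ^ (1 / 3 : ℝ)) s := by
    intro s hs
    rw [Set.uIcc_of_le ht] at hs
    rw [← profile_cosh hs.1]
    exact (hasDerivAt_radialPotential (neg_one_lt_cosh s)).comp s (Real.hasDerivAt_cosh s)
  rw [intervalIntegral.integral_eq_sub_of_hasDerivAt hderiv
    (Continuous.intervalIntegrable (Continuous.rpow_const (by fun_prop)
      fun _ => Or.inr (by norm_num)) _ _)]
  simp [radialPotential]

/-! ### Real and complex Hessians -/

section Hessian

variable {E : Type*} [NormedAddCommGroup E] [NormedSpace ℝ E]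

theorem differentiableAt_fderiv {F : Type*} [NormedAddCommGroup F] [NormedSpace ℝ F] {f : E → F}
    {z : E} (hf : ContDiffAt ℝ 2 f z) : DifferentiableAt ℝ (fderiv ℝ f) z :=
  (hf.fderiv_right (m := 1) le_rfl).differentiableAt one_ne_zero

/-- The second derivative of a real function as a bilinear form. -/
def realHessian (F : E → ℝ) (z v w : E) : ℝ := fderiv ℝ (fderiv ℝ F) z v w

variable {F : E → ℝ} {z : E}

theorem realHessian_symm (hF : ContDiffAt ℝ 2 F z) (v w : E) :
    realHessian F z v w = realHessian F z w v :=
  hF.isSymmSndFDerivAt (by rw [minSmoothness_of_isRCLikeNormedField]) v w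

theorem fderiv_fderiv_apply (hF : ContDiffAt ℝ 2 F z) (v w : E) :
    fderiv ℝ (fun x => fderiv ℝ F x v) z w = realHessian F z w v := by
  rw [((differentiableAt_fderiv hF).hasFDerivAt.clm_apply (hasFDerivAt_const v z)).fderiv]
  simp [realHessian]

theorem differentiableAt_realHessian (hF : ContDiffAt ℝ 3 F z) (v w : E) :
    DifferentiableAt ℝ (fun x => realHessian F x v w) z :=
  ((differentiableAt_fderiv (hF.fderiv_right (m := 2) le_rfl)).clm_apply
    (differentiableAt_const v)).clm_apply (differentiableAt_const w)

theorem fderiv_realHessian_swap (hF : ContDiffAt ℝ 3 F z) (v w a : E) :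
    fderiv ℝ (fun x => realHessian F x v w) z a = fderiv ℝ (fun x => realHessian F x w v) z a := by
  have heq : (fun x => realHessian F x v w) =ᶠ[𝓝 z] fun x => realHessian F x w v := by
    filter_upwards [(hF.of_le (m := 2) (by norm_num)).eventually (by simp)] with x hx
      using realHessian_symm hx v w
  rw [heq.fderiv_eq]

theorem fderiv_realHessian_left_comm (hF : ContDiffAt ℝ 3 F z) (v w a : E) :
    fderiv ℝ (fun x => realHessian F x v w) z a = fderiv ℝ (fun x => realHessian F x a w) z v := by
  have hdir : ContDiffAt ℝ 2 (fun x => fderiv ℝ F x w) z :=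
    (hF.fderiv_right (m := 2) le_rfl).clm_apply contDiffAt_const
  have heq : ∀ v, (fun x => realHessian F x v w) =ᶠ[𝓝 z]
      fun x => fderiv ℝ (fun x => fderiv ℝ F x w) x v := fun v => by
    filter_upwards [(hF.of_le (m := 2) (by norm_num)).eventually (by simp)] with x hx
      using (fderiv_fderiv_apply hx w v).symm
  rw [(heq v).fderiv_eq, (heq a).fderiv_eq, fderiv_fderiv_apply hdir, fderiv_fderiv_apply hdir,
    realHessian_symm hdir]

theorem fderiv_realHessian_rotate (hF : ContDiffAt ℝ 3 F z) (v w a : E) :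
    fderiv ℝ (fun x => realHessian F x v w) z a = fderiv ℝ (fun x => realHessian F x a v) z w := by
  rw [fderiv_realHessian_swap hF, fderiv_realHessian_left_comm hF]

end Hessian

section ComplexHessian

/-- The real form `i ∂∂̄F` on a complex vector space. -/
def ddbarForm {E : Type*} [NormedAddCommGroup E] [NormedSpace ℂ E] (F : E → ℝ) (z v w : E) : ℝ :=
  (realHessian F z (Complex.I • v) w - realHessian F z v (Complex.I • w)) / 2

theorem ddbarForm_closed {E : Type*} [NormedAddCommGroup E] [NormedSpace ℂ E] {F : E → ℝ} {z : E}
    (hF : ContDiffAt ℝ 3 F z) (v₁ v₂ v₃ : E) :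
    fderiv ℝ (fun x => ddbarForm F x v₂ v₃) z v₁ + fderiv ℝ (fun x => ddbarForm F x v₃ v₁) z v₂ +
      fderiv ℝ (fun x => ddbarForm F x v₁ v₂) z v₃ = 0 := by
  have hform : ∀ v w a, fderiv ℝ (fun x => ddbarForm F x v w) z a =
      (fderiv ℝ (fun x => realHessian F x (Complex.I • v) w) z a -
        fderiv ℝ (fun x => realHessian F x v (Complex.I • w)) z a) / 2 := fun v w a => by
    have h : HasFDerivAt (fun x => ddbarForm F x v w) _ z :=
      ((differentiableAt_realHessian hF (Complex.I • v) w).hasFDerivAt.sub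
        (differentiableAt_realHessian hF v (Complex.I • w)).hasFDerivAt).mul_const (2⁻¹ : ℝ)
    rw [h.fderiv]
    simp only [smul_apply, sub_apply, smul_eq_mul]
    ring
  rw [hform, hform, hform, fderiv_realHessian_rotate hF _ v₃ v₁,
    fderiv_realHessian_rotate hF _ v₁ v₂, fderiv_realHessian_rotate hF _ v₂ v₃]
  ring

theorem single_I (a : Fin 3) :
    (Pi.single a Complex.I : C3) = Complex.I • (Pi.single a 1 : C3) := by
  rw [← Pi.single_smul, smul_eq_mul, mul_one]

theorem dZbar_ofReal {F : C3 → ℝ} {z : C3} (hF : DifferentiableAt ℝ F z) (b : Fin 3) :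
    dZbar b (fun x => (F x : ℂ)) z = ((fderiv ℝ F z (Pi.single b 1) : ℂ) +
      Complex.I * (fderiv ℝ F z (Pi.single b Complex.I) : ℂ)) / 2 := by
  have h : HasFDerivAt (fun x => (F x : ℂ)) (Complex.ofRealCLM.comp (fderiv ℝ F z)) z :=
    Complex.ofRealCLM.hasFDerivAt.comp z hF.hasFDerivAt
  rw [dZbar, h.fderiv]
  rfl

theorem complexHessian_eq {F : C3 → ℝ} {z : C3} (hF : ContDiffAt ℝ 2 F z) (a b : Fin 3) :
    complexHessian F z a b =
      ((realHessian F z (Pi.single a 1) (Pi.single b 1) +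
          realHessian F z (Pi.single a Complex.I) (Pi.single b Complex.I) : ℝ) +
        Complex.I * (realHessian F z (Pi.single a 1) (Pi.single b Complex.I) -
          realHessian F z (Pi.single a Complex.I) (Pi.single b 1) : ℝ)) / 4 := by
  have hbar : dZbar b (fun x => (F x : ℂ)) =ᶠ[𝓝 z] fun x =>
      ((fderiv ℝ F x (Pi.single b 1) : ℂ) +
        Complex.I * (fderiv ℝ F x (Pi.single b Complex.I) : ℂ)) * 2⁻¹ := by
    filter_upwards [hF.eventually (by simp)] with x hx
    rw [dZbar_ofReal (hx.differentiableAt (by simp)), div_eq_mul_inv]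
  have hpartial : ∀ v : C3, HasFDerivAt (fun x => (fderiv ℝ F x v : ℂ))
      (Complex.ofRealCLM.comp (fderiv ℝ (fun x => fderiv ℝ F x v) z)) z := fun v =>
    Complex.ofRealCLM.hasFDerivAt.comp z
      ((differentiableAt_fderiv hF).clm_apply (differentiableAt_const v)).hasFDerivAt
  have hderiv := (((hpartial (Pi.single b 1)).add
    ((hpartial (Pi.single b Complex.I)).const_mul Complex.I)).mul_const
      (2⁻¹ : ℂ)).congr_of_eventuallyEq hbar
  rw [complexHessian, dZ, hderiv.fderiv]
  simp only [smul_apply, add_apply, ContinuousLinearMap.comp_apply, Complex.ofRealCLM_apply,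
    fderiv_fderiv_apply hF, smul_eq_mul, Complex.ofReal_add, Complex.ofReal_sub]
  linear_combination (-(realHessian F z (Pi.single a Complex.I) (Pi.single b Complex.I) : ℂ) / 4) *
    Complex.I_mul_I

theorem hasFDerivAt_log_const_mul_normSq {E : Type*} [NormedAddCommGroup E] [NormedSpace ℂ E]
    {h : E → ℂ} {κ : ℝ} (hκ : κ ≠ 0) {x : E} (hh : DifferentiableAt ℂ h x) (h0 : h x ≠ 0) :
    HasFDerivAt (fun x => Real.log (κ * Complex.normSq (h x)))
      ((2 : ℝ) • Complex.reCLM.comp (((h x)⁻¹ • fderiv ℂ h x).restrictScalars ℝ)) x := by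
  have hd := hh.hasFDerivAt.restrictScalars ℝ
  have hre : HasFDerivAt (fun x => (h x).re) _ x := Complex.reCLM.hasFDerivAt.comp x hd
  have him : HasFDerivAt (fun x => (h x).im) _ x := Complex.imCLM.hasFDerivAt.comp x hd
  have hnormSq : HasFDerivAt (fun x => κ * Complex.normSq (h x)) _ x :=
    ((hre.mul hre).add (him.mul him)).const_mul κ
  have hn : Complex.normSq (h x) ≠ 0 := by simpa using h0
  refine (hnormSq.log (mul_ne_zero hκ hn)).congr_fderiv (ContinuousLinearMap.ext fun v => ?_)
  simp
  field_simp
  ring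

theorem complexHessian_log_normSq {h : C3 → ℂ} {U : Set C3} (hU : IsOpen U)
    (hh : DifferentiableOn ℂ h U) (h0 : ∀ z ∈ U, h z ≠ 0) {κ : ℝ} (hκ : κ ≠ 0) {z : C3}
    (hz : z ∈ U) (a b : Fin 3) :
    complexHessian (fun x => Real.log (κ * Complex.normSq (h x))) z a b = 0 := by
  have hlog : DifferentiableOn ℂ (fun x => (h x)⁻¹ * fderiv ℂ h x (Pi.single b 1)) U :=
    (hh.fun_inv h0).fun_mul (differentiableOn_fderiv_apply hU hh (Pi.single b 1))
  have hbar : dZbar b (fun x => ((Real.log (κ * Complex.normSq (h x)) : ℝ) : ℂ)) =ᶠ[𝓝 z]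
      fun x => (starRingEnd ℂ) ((h x)⁻¹ * fderiv ℂ h x (Pi.single b 1)) := by
    filter_upwards [hU.mem_nhds hz] with x hx
    have hderiv := hasFDerivAt_log_const_mul_normSq hκ (hh.differentiableAt (hU.mem_nhds hx))
      (h0 x hx)
    rw [dZbar_ofReal hderiv.differentiableAt, hderiv.fderiv, single_I]
    apply Complex.ext <;> simp <;> ring
  obtain ⟨L, hL⟩ := hlog.differentiableAt (hU.mem_nhds hz)
  have hconj : HasFDerivAt
      (fun x => (starRingEnd ℂ) ((h x)⁻¹ * fderiv ℂ h x (Pi.single b 1))) _ z :=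
    (Complex.conjCLE : ℂ →L[ℝ] ℂ).hasFDerivAt.comp z (hL.restrictScalars ℝ)
  rw [complexHessian, dZ, hbar.fderiv_eq, hconj.fderiv, single_I]
  simp
  linear_combination ((starRingEnd ℂ) (L (Pi.single a 1))) * Complex.I_mul_I

end ComplexHessian

/-! ### Metrics as forms on matrices -/

theorem SL2.inv_mul_self (u : SL2) : ((u⁻¹ : SL2) : M2) * (u : M2) = 1 := by
  rw [← Matrix.SpecialLinearGroup.coe_mul, inv_mul_cancel, Matrix.SpecialLinearGroup.coe_one]

theorem SL2.mul_inv_self (u : SL2) : (u : M2) * ((u⁻¹ : SL2) : M2) = 1 := by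
  rw [← Matrix.SpecialLinearGroup.coe_mul, mul_inv_cancel, Matrix.SpecialLinearGroup.coe_one]

theorem SL2.det_eq (u : SL2) : u 0 0 * u 1 1 - u 0 1 * u 1 0 = 1 := by
  rw [← Matrix.det_fin_two, u.det_coe]

theorem SL2.trace_inv_translate (a b u : SL2) (A : M2) :
    (((a * u * b⁻¹)⁻¹ : SL2) * ((a : M2) * A * ((b⁻¹ : SL2) : M2))).trace =
      (((u⁻¹ : SL2) : M2) * A).trace := by
  have hinv : (a * u * b⁻¹)⁻¹ = b * u⁻¹ * a⁻¹ := by group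
  calc (((a * u * b⁻¹)⁻¹ : SL2) * ((a : M2) * A * ((b⁻¹ : SL2) : M2))).trace
      = ((b : M2) * (((u⁻¹ : SL2) : M2) * (((a⁻¹ : SL2) : M2) * (a : M2)) * A) *
          ((b⁻¹ : SL2) : M2)).trace := by
        simp only [hinv, Matrix.SpecialLinearGroup.coe_mul, Matrix.mul_assoc]
    _ = (((u⁻¹ : SL2) : M2) * A).trace := by
        rw [SL2.inv_mul_self, Matrix.mul_one, Matrix.trace_mul_comm, ← Matrix.mul_assoc,
          SL2.inv_mul_self, Matrix.one_mul]

theorem mem_tangentSpace {u : SL2} {X : M2} :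
    X ∈ tangentSpace u ↔ (((u⁻¹ : SL2) : M2) * X).trace = 0 := Iff.rfl

/-- The projection of matrices to the tangent space along the line through `u`. -/
def tangentProj (u : SL2) : M2 →ₗ[ℂ] tangentSpace u where
  toFun A := ⟨A - ((((u⁻¹ : SL2) : M2) * A).trace / 2) • (u : M2), by
    rw [mem_tangentSpace, mul_sub, Matrix.mul_smul, SL2.inv_mul_self, Matrix.trace_sub,
      Matrix.trace_smul]
    simp⟩
  map_add' A B := by
    ext1
    simp only [mul_add, Matrix.trace_add, add_div, add_smul, Submodule.coe_add]
    abel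
  map_smul' c A := by
    ext1
    simp only [Matrix.mul_smul, Matrix.trace_smul, smul_eq_mul, Submodule.coe_smul,
      RingHom.id_apply, smul_sub, smul_smul, mul_div_assoc]

theorem coe_tangentProj (u : SL2) (A : M2) :
    (tangentProj u A : M2) = A - ((((u⁻¹ : SL2) : M2) * A).trace / 2) • (u : M2) := rfl

theorem tangentProj_coe (u : SL2) (X : tangentSpace u) : tangentProj u X = X := by
  ext1
  rw [coe_tangentProj, mem_tangentSpace.1 X.2, zero_div, zero_smul, sub_zero]

theorem coe_tangentProj_of_mem {u : SL2} {X : M2} (hX : X ∈ tangentSpace u) :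
    (tangentProj u X : M2) = X :=
  congrArg Subtype.val (tangentProj_coe u ⟨X, hX⟩)

theorem tangentProj_translate (a b u : SL2) (A : M2) :
    tangentProj (a * u * b⁻¹) ((a : M2) * A * ((b⁻¹ : SL2) : M2)) =
      translate a b u (tangentProj u A) := by
  ext1
  change (tangentProj (a * u * b⁻¹) _ : M2) =
    (a : M2) * (tangentProj u A : M2) * ((b⁻¹ : SL2) : M2)
  rw [coe_tangentProj, SL2.trace_inv_translate, coe_tangentProj, mul_sub, sub_mul,
    Matrix.mul_smul, Matrix.smul_mul, Matrix.SpecialLinearGroup.coe_mul,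
    Matrix.SpecialLinearGroup.coe_mul]

/-- The metric as a bilinear form on all matrices. -/
def RiemMetric.form (g : RiemMetric) (u : SL2) : M2 →ₗ[ℝ] M2 →ₗ[ℝ] ℝ :=
  (g.inner u).compl₁₂ ((tangentProj u).restrictScalars ℝ) ((tangentProj u).restrictScalars ℝ)

/-- The Hermitian condition `g(iX, iY) = g(X, Y)`. -/
def RiemMetric.IsHermitian (g : RiemMetric) : Prop :=
  ∀ (u : SL2) (X Y : tangentSpace u),
    g.inner u (Complex.I • X) (Complex.I • Y) = g.inner u X Y

variable {g : RiemMetric}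

theorem RiemMetric.form_apply (u : SL2) (A B : M2) :
    g.form u A B = g.inner u (tangentProj u A) (tangentProj u B) := rfl

theorem RiemMetric.inner_eq_form (u : SL2) (X Y : tangentSpace u) :
    g.inner u X Y = g.form u X Y := by
  rw [RiemMetric.form_apply, tangentProj_coe, tangentProj_coe]

theorem RiemMetric.form_symm (u : SL2) (A B : M2) : g.form u A B = g.form u B A :=
  g.symm u _ _

theorem RiemMetric.form_pos {u : SL2} {A : M2} (hA : A ∈ tangentSpace u) (h0 : A ≠ 0) :
    0 < g.form u A A :=
  g.pos u _ fun h => h0 <| (coe_tangentProj_of_mem hA).symm.trans (congrArg Subtype.val h)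

theorem RiemMetric.IsHermitian.form_I (hg : g.IsHermitian) (u : SL2) (A B : M2) :
    g.form u (Complex.I • A) (Complex.I • B) = g.form u A B := by
  rw [RiemMetric.form_apply, (tangentProj u).map_smul, (tangentProj u).map_smul, hg,
    RiemMetric.form_apply]

theorem RiemMetric.IsHermitian.form_I_left (hg : g.IsHermitian) (u : SL2) (A B : M2) :
    g.form u (Complex.I • A) B = -g.form u A (Complex.I • B) := by
  rw [← hg.form_I u (Complex.I • A) B, smul_smul, Complex.I_mul_I, neg_smul, one_smul, map_neg,
    LinearMap.neg_apply]

theorem RiemMetric.IsInvariant.form_translate (hg : g.IsInvariant) {a b : SL2} (ha : a ∈ SU2)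
    (hb : b ∈ SU2) (u : SL2) (A B : M2) :
    g.form (a * u * b⁻¹) ((a : M2) * A * ((b⁻¹ : SL2) : M2))
      ((a : M2) * B * ((b⁻¹ : SL2) : M2)) = g.form u A B := by
  rw [RiemMetric.form_apply, tangentProj_translate, tangentProj_translate, hg a ha b hb,
    RiemMetric.form_apply]

/-! ### `SU(2)` and the Cartan decomposition -/

theorem mem_SU2_iff {a : SL2} : a ∈ SU2 ↔ (a : M2)ᴴ * (a : M2) = 1 :=
  Matrix.mem_unitaryGroup_iff'

theorem SU2.one_mem : (1 : SL2) ∈ SU2 := by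
  rw [mem_SU2_iff, Matrix.SpecialLinearGroup.coe_one, Matrix.conjTranspose_one, Matrix.mul_one]

theorem SU2.mul_mem {a b : SL2} (ha : a ∈ SU2) (hb : b ∈ SU2) : a * b ∈ SU2 := by
  change ((a * b : SL2) : M2) ∈ Matrix.unitaryGroup (Fin 2) ℂ
  rw [Matrix.SpecialLinearGroup.coe_mul]
  exact Submonoid.mul_mem _ ha hb

theorem SU2.coe_inv {a : SL2} (ha : a ∈ SU2) : ((a⁻¹ : SL2) : M2) = (a : M2)ᴴ :=
  (left_inv_eq_right_inv (mem_SU2_iff.1 ha) (SL2.mul_inv_self a)).symm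

theorem SU2.inv_mem {a : SL2} (ha : a ∈ SU2) : a⁻¹ ∈ SU2 := by
  rw [mem_SU2_iff, SU2.coe_inv ha, Matrix.conjTranspose_conjTranspose, ← SU2.coe_inv ha,
    SL2.mul_inv_self]

theorem SU2.mul_inv_mem_of_gram_eq {u v : SL2} (h : (u : M2)ᴴ * (u : M2) = (v : M2)ᴴ * (v : M2)) :
    u * v⁻¹ ∈ SU2 := by
  have hassoc : ((v⁻¹ : SL2) : M2)ᴴ * (u : M2)ᴴ * ((u : M2) * ((v⁻¹ : SL2) : M2)) =
      ((v⁻¹ : SL2) : M2)ᴴ * ((u : M2)ᴴ * (u : M2)) * ((v⁻¹ : SL2) : M2) := by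
    simp only [Matrix.mul_assoc]
  rw [mem_SU2_iff, Matrix.SpecialLinearGroup.coe_mul, Matrix.conjTranspose_mul, hassoc, h,
    Matrix.mul_assoc, Matrix.mul_assoc, SL2.mul_inv_self, Matrix.mul_one,
    ← Matrix.conjTranspose_mul, SL2.mul_inv_self, Matrix.conjTranspose_one]

/-- Half the squared Frobenius norm, equal to `cosh |h|` for `u = a exp (i h)`. -/
def tau (u : SL2) : ℝ :=
  (Complex.normSq (u 0 0) + Complex.normSq (u 0 1) + Complex.normSq (u 1 0) +
    Complex.normSq (u 1 1)) / 2

theorem trace_gram (u : SL2) : ((u : M2)ᴴ * (u : M2)).trace = ((2 * tau u : ℝ) : ℂ) := by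
  rw [Matrix.trace_fin_two, tau]
  simp only [Matrix.mul_apply, Fin.sum_univ_two, Matrix.conjTranspose_apply, RCLike.star_def,
    ← Complex.normSq_eq_conj_mul_self]
  push_cast
  ring

theorem tau_eq_of_trace_gram_eq {u v : SL2}
    (h : ((u : M2)ᴴ * (u : M2)).trace = ((v : M2)ᴴ * (v : M2)).trace) : tau u = tau v := by
  rw [trace_gram, trace_gram, Complex.ofReal_inj] at h
  linarith

theorem tau_translate {a b : SL2} (ha : a ∈ SU2) (hb : b ∈ SU2) (u : SL2) :
    tau (a * u * b⁻¹) = tau u := by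
  refine tau_eq_of_trace_gram_eq ?_
  calc (((a * u * b⁻¹ : SL2) : M2)ᴴ * ((a * u * b⁻¹ : SL2) : M2)).trace
      = ((b : M2) * ((u : M2)ᴴ * ((a : M2)ᴴ * (a : M2)) * (u : M2)) * (b : M2)ᴴ).trace := by
        simp only [Matrix.SpecialLinearGroup.coe_mul, Matrix.conjTranspose_mul, SU2.coe_inv hb,
          Matrix.conjTranspose_conjTranspose, Matrix.mul_assoc]
    _ = ((u : M2)ᴴ * (u : M2)).trace := by
        rw [mem_SU2_iff.1 ha, Matrix.mul_one, Matrix.trace_mul_comm, ← Matrix.mul_assoc,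
          mem_SU2_iff.1 hb, Matrix.one_mul]

theorem one_le_tau (u : SL2) : 1 ≤ tau u := by
  have hdet := congrArg Complex.re (SL2.det_eq u)
  simp only [Complex.sub_re, Complex.mul_re, Complex.one_re] at hdet
  simp only [tau, Complex.normSq_apply]
  nlinarith [sq_nonneg ((u 0 0).re - (u 1 1).re), sq_nonneg ((u 0 0).im + (u 1 1).im),
    sq_nonneg ((u 0 1).re + (u 1 0).re), sq_nonneg ((u 0 1).im - (u 1 0).im)]

/-- The diagonal matrix `diag (e^{t/2}, e^{-t/2})`. -/
def diagSL (t : ℝ) : SL2 :=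
  ⟨!![(Real.exp (t / 2) : ℂ), 0; 0, (Real.exp (-(t / 2)) : ℂ)], by
    rw [Matrix.det_fin_two]
    simp [← Complex.exp_add]⟩

/-- The Weyl element of `SU(2)`. -/
def weyl : SL2 := ⟨!![0, 1; -1, 0], by rw [Matrix.det_fin_two]; simp⟩

theorem weyl_mem : weyl ∈ SU2 := by
  rw [mem_SU2_iff]
  ext i j
  fin_cases i <;> fin_cases j <;> simp [weyl, Matrix.mul_apply, Fin.sum_univ_two]

theorem diagSL_eq_weyl (t : ℝ) : diagSL t = weyl * diagSL (-t) * weyl⁻¹ := by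
  rw [eq_mul_inv_iff_mul_eq]
  ext i j
  rw [Matrix.SpecialLinearGroup.coe_mul, Matrix.SpecialLinearGroup.coe_mul, Matrix.mul_apply,
    Matrix.mul_apply]
  fin_cases i <;> fin_cases j <;> simp [weyl, diagSL, neg_div]

theorem diagSL_gram (t : ℝ) : (diagSL t : M2)ᴴ * (diagSL t : M2) =
    Matrix.diagonal ![(Real.exp t : ℂ), (Real.exp (-t) : ℂ)] := by
  ext i j
  fin_cases i <;> fin_cases j <;>
    simp [diagSL, Matrix.mul_apply, Fin.sum_univ_two, ← Complex.exp_conj, ← Complex.exp_add,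
      Complex.conj_ofNat]
  ring_nf

theorem tau_diagSL (t : ℝ) : tau (diagSL t) = Real.cosh t := by
  have h := trace_gram (diagSL t)
  rw [diagSL_gram, Matrix.trace_diagonal, Fin.sum_univ_two, Matrix.cons_val_zero,
    Matrix.cons_val_one, Matrix.cons_val_fin_one, ← Complex.ofReal_add, Complex.ofReal_inj] at h
  rw [Real.cosh_eq, h]
  ring

theorem exists_mem_SU2_diagonalize {P : M2} (hP : P.IsHermitian) :
    ∃ l ∈ SU2, (l : M2)ᴴ * P * (l : M2) = Matrix.diagonal fun i => (hP.eigenvalues i : ℂ) := by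
  have hdiag := hP.conjStarAlgAut_star_eigenvectorUnitary
  have hV : (hP.eigenvectorUnitary : M2)ᴴ * (hP.eigenvectorUnitary : M2) = 1 :=
    Matrix.mem_unitaryGroup_iff'.1 hP.eigenvectorUnitary.2
  rw [Unitary.conjStarAlgAut_star_apply, Matrix.star_eq_conjTranspose] at hdiag
  generalize (hP.eigenvectorUnitary : M2) = V at hdiag hV
  have hdetV : star V.det * V.det = 1 := by
    rw [← Matrix.det_conjTranspose, ← Matrix.det_mul, hV, Matrix.det_one]
  set S : M2 := Matrix.diagonal ![1, star V.det] with hS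
  have hconjS : ∀ d : Fin 2 → ℂ, Sᴴ * Matrix.diagonal d * S = Matrix.diagonal d := fun d => by
    rw [hS, Matrix.diagonal_conjTranspose, Matrix.diagonal_mul_diagonal,
      Matrix.diagonal_mul_diagonal]
    congr 1
    ext i
    fin_cases i
    · simp
    · simp only [Fin.mk_one, Pi.star_apply, Matrix.cons_val_one, Matrix.cons_val_fin_one,
        star_star]
      linear_combination d 1 * hdetV
  have hdet : (V * S).det = 1 := by
    rw [Matrix.det_mul, hS, Matrix.det_diagonal, Fin.prod_univ_two]
    simpa [mul_comm] using hdetV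
  refine ⟨⟨V * S, hdet⟩, mem_SU2_iff.2 ?_, ?_⟩
  · calc (V * S)ᴴ * (V * S) = Sᴴ * (Vᴴ * V) * S := by
          simp only [Matrix.conjTranspose_mul, Matrix.mul_assoc]
      _ = 1 := by rw [hV, ← Matrix.diagonal_one, hconjS]
  · calc (V * S)ᴴ * P * (V * S) = Sᴴ * (Vᴴ * P * V) * S := by
          simp only [Matrix.conjTranspose_mul, Matrix.mul_assoc]
      _ = _ := by rw [hdiag, hconjS]; rfl

open scoped ComplexOrder in
theorem exists_kak_real (u : SL2) : ∃ k ∈ SU2, ∃ l ∈ SU2, ∃ t : ℝ, u = k * diagSL t * l⁻¹ := by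
  have hpos := Matrix.posSemidef_conjTranspose_mul_self (u : M2)
  obtain ⟨l, hl, hdiag⟩ := exists_mem_SU2_diagonalize hpos.isHermitian
  have hprod : hpos.isHermitian.eigenvalues 0 * hpos.isHermitian.eigenvalues 1 = 1 := by
    have hdet := hpos.isHermitian.det_eq_prod_eigenvalues
    rw [Matrix.det_mul, Matrix.det_conjTranspose, u.det_coe, star_one, one_mul,
      Fin.prod_univ_two] at hdet
    exact Complex.ofReal_injective ((Complex.ofReal_mul _ _).trans hdet.symm)
  have hfirst : 0 < hpos.isHermitian.eigenvalues 0 :=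
    (hpos.eigenvalues_nonneg 0).lt_of_ne' (left_ne_zero_of_mul_eq_one hprod)
  set t := Real.log (hpos.isHermitian.eigenvalues 0) with ht
  have hgram : ((u * l : SL2) : M2)ᴴ * ((u * l : SL2) : M2) =
      (diagSL t : M2)ᴴ * (diagSL t : M2) := by
    calc ((u * l : SL2) : M2)ᴴ * ((u * l : SL2) : M2)
        = (l : M2)ᴴ * ((u : M2)ᴴ * (u : M2)) * (l : M2) := by
          simp only [Matrix.SpecialLinearGroup.coe_mul, Matrix.conjTranspose_mul,
            Matrix.mul_assoc]
      _ = (diagSL t : M2)ᴴ * (diagSL t : M2) := by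
          rw [hdiag, diagSL_gram, ht, Real.exp_neg, Real.exp_log hfirst,
            inv_eq_of_mul_eq_one_right hprod]
          congr 1
          ext i
          fin_cases i <;> rfl
  exact ⟨u * l * (diagSL t)⁻¹, SU2.mul_inv_mem_of_gram_eq hgram, l, hl, t, by group⟩

theorem exists_kak (u : SL2) :
    ∃ k ∈ SU2, ∃ l ∈ SU2, ∃ t : ℝ, 0 ≤ t ∧ u = k * diagSL t * l⁻¹ := by
  obtain ⟨k, hk, l, hl, t, h⟩ := exists_kak_real u
  rcases le_total 0 t with ht | ht
  · exact ⟨k, hk, l, hl, t, ht, h⟩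
  · refine ⟨k * weyl, SU2.mul_mem hk weyl_mem, l * weyl, SU2.mul_mem hl weyl_mem, -t,
      by linarith, ?_⟩
    rw [h, diagSL_eq_weyl t]
    group

/-! ### The Hermitian form of a metric and its Gram determinant -/

/-- The Hermitian form `½ (g(A, B) + i g(A, iB))`, complex linear in `A` for a Hermitian metric. -/
def RiemMetric.herm (g : RiemMetric) (u : SL2) (A B : M2) : ℂ :=
  ((g.form u A B : ℝ) + Complex.I * (g.form u A (Complex.I • B) : ℝ)) / 2

variable {g : RiemMetric}

theorem RiemMetric.form_eq_herm (u : SL2) (A B : M2) : g.form u A B = 2 * (g.herm u A B).re := by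
  simp [RiemMetric.herm]
  ring

theorem RiemMetric.herm_add_left (u : SL2) (A A' B : M2) :
    g.herm u (A + A') B = g.herm u A B + g.herm u A' B := by
  simp only [RiemMetric.herm, map_add, LinearMap.add_apply]
  push_cast
  ring

theorem RiemMetric.IsHermitian.conj_herm (hg : g.IsHermitian) (u : SL2) (A B : M2) :
    (starRingEnd ℂ) (g.herm u A B) = g.herm u B A := by
  have h : g.form u B (Complex.I • A) = -g.form u A (Complex.I • B) := by
    rw [g.form_symm, hg.form_I_left]
  simp only [RiemMetric.herm, h, g.form_symm u B A]
  simp [map_ofNat]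

theorem complex_smul_eq (c : ℂ) (A : M2) : c • A = c.re • A + c.im • (Complex.I • A) := by
  ext i j
  simp only [Matrix.smul_apply, Matrix.add_apply, smul_eq_mul, Complex.real_smul]
  conv_lhs => rw [← Complex.re_add_im c]
  ring

theorem RiemMetric.IsHermitian.herm_smul_left (hg : g.IsHermitian) (u : SL2) (c : ℂ) (A B : M2) :
    g.herm u (c • A) B = c * g.herm u A B := by
  simp only [RiemMetric.herm, complex_smul_eq c, map_add, LinearMap.add_apply, map_smul,
    LinearMap.smul_apply, hg.form_I, hg.form_I_left, smul_eq_mul]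
  conv_rhs => enter [1]; rw [← Complex.re_add_im c]
  push_cast
  linear_combination ((c.im : ℂ) * (g.form u A (Complex.I • B) : ℂ) / 2) * (-Complex.I_mul_I)

theorem RiemMetric.IsHermitian.herm_smul_right (hg : g.IsHermitian) (u : SL2) (c : ℂ) (A B : M2) :
    g.herm u A (c • B) = (starRingEnd ℂ) c * g.herm u A B := by
  rw [← hg.conj_herm, hg.herm_smul_left, map_mul, hg.conj_herm]

theorem RiemMetric.IsHermitian.herm_add_right (hg : g.IsHermitian) (u : SL2) (A B B' : M2) :
    g.herm u A (B + B') = g.herm u A B + g.herm u A B' := by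
  rw [← hg.conj_herm, g.herm_add_left, map_add, hg.conj_herm, hg.conj_herm]

theorem RiemMetric.IsHermitian.herm_self (hg : g.IsHermitian) (u : SL2) (A : M2) :
    g.herm u A A = (g.form u A A : ℝ) / 2 := by
  have hI : g.form u A (Complex.I • A) = 0 := by
    have h := hg.form_I_left u A A
    rw [g.form_symm] at h
    linarith
  rw [RiemMetric.herm, hI, Complex.ofReal_zero, mul_zero, add_zero]

theorem RiemMetric.IsInvariant.herm_translate (hg : g.IsInvariant) {a b : SL2} (ha : a ∈ SU2)
    (hb : b ∈ SU2) (u : SL2) (A B : M2) :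
    g.herm (a * u * b⁻¹) ((a : M2) * A * ((b⁻¹ : SL2) : M2))
      ((a : M2) * B * ((b⁻¹ : SL2) : M2)) = g.herm u A B := by
  have h : Complex.I • ((a : M2) * B * ((b⁻¹ : SL2) : M2)) =
      (a : M2) * (Complex.I • B) * ((b⁻¹ : SL2) : M2) := by
    rw [Matrix.mul_smul, Matrix.smul_mul]
  simp only [RiemMetric.herm, h, hg.form_translate ha hb]

/-- The standard basis of `sl(2, ℂ)`. -/
def frame : Fin 3 → M2 := ![!![1, 0; 0, -1], !![0, 1; 0, 0], !![0, 0; 1, 0]]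

/-- The coordinates of a trace-free matrix in the standard basis. -/
def frameCoord (ξ : M2) : Fin 3 → ℂ := ![ξ 0 0, ξ 0 1, ξ 1 0]

theorem trace_frame (k : Fin 3) : (frame k).trace = 0 := by
  rw [Matrix.trace_fin_two]
  fin_cases k <;> simp [frame]

theorem mul_frame_mem (u : SL2) (k : Fin 3) : (u : M2) * frame k ∈ tangentSpace u := by
  rw [mem_tangentSpace, ← Matrix.mul_assoc, SL2.inv_mul_self, Matrix.one_mul, trace_frame]

theorem eq_sum_frame {ξ : M2} (h : ξ.trace = 0) : ξ = ∑ k, frameCoord ξ k • frame k := by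
  rw [Matrix.trace_fin_two] at h
  rw [Fin.sum_univ_three]
  ext i j
  fin_cases i <;> fin_cases j <;> simp [frame, frameCoord]
  linear_combination h

/-- The Gram matrix of the metric in the left-invariant holomorphic frame. -/
def RiemMetric.gram (g : RiemMetric) (u : SL2) : Matrix (Fin 3) (Fin 3) ℂ :=
  Matrix.of fun k l => g.herm u ((u : M2) * frame k) ((u : M2) * frame l)

theorem RiemMetric.IsHermitian.herm_gram (hg : g.IsHermitian) (u : SL2) (ξ : Fin 3 → M2)
    (hξ : ∀ a, (ξ a).trace = 0) :
    (Matrix.of fun a b => g.herm u ((u : M2) * ξ a) ((u : M2) * ξ b)) =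
      (Matrix.of fun a k => frameCoord (ξ a) k) * g.gram u *
        (Matrix.of fun a k => frameCoord (ξ a) k)ᴴ := by
  have hexpand : ∀ a, (u : M2) * ξ a = ∑ k, frameCoord (ξ a) k • ((u : M2) * frame k) := by
    intro a
    conv_lhs => rw [eq_sum_frame (hξ a)]
    simp only [Finset.mul_sum, Matrix.mul_smul]
  ext a b
  simp only [Matrix.of_apply, hexpand, Fin.sum_univ_three, g.herm_add_left, hg.herm_add_right,
    hg.herm_smul_left, hg.herm_smul_right, Matrix.mul_apply, Matrix.conjTranspose_apply,
    RiemMetric.gram, RCLike.star_def]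
  ring

theorem RiemMetric.IsHermitian.det_herm (hg : g.IsHermitian) (u : SL2) (ξ : Fin 3 → M2)
    (hξ : ∀ a, (ξ a).trace = 0) :
    (Matrix.of fun a b => g.herm u ((u : M2) * ξ a) ((u : M2) * ξ b)).det =
      (Complex.normSq (Matrix.of fun a k => frameCoord (ξ a) k).det : ℂ) * (g.gram u).det := by
  rw [hg.herm_gram u ξ hξ, Matrix.det_mul, Matrix.det_mul, Matrix.det_conjTranspose,
    ← Complex.mul_conj, RCLike.star_def]
  ring

theorem det_adjoint (l : SL2) :
    (Matrix.of fun a k => frameCoord (((l⁻¹ : SL2) : M2) * frame a * (l : M2)) k).det = 1 := by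
  have hdet := SL2.det_eq l
  rw [Matrix.det_fin_three, Matrix.SpecialLinearGroup.coe_inv, Matrix.adjugate_fin_two]
  simp [frameCoord, frame, Matrix.mul_apply, Fin.sum_univ_two]
  linear_combination ((l 0 0 * l 1 1 - l 0 1 * l 1 0) ^ 2 + (l 0 0 * l 1 1 - l 0 1 * l 1 0) + 1) *
    hdet

theorem RiemMetric.gramDet_translate (hg : g.IsHermitian) (hi : g.IsInvariant) {a b : SL2}
    (ha : a ∈ SU2) (hb : b ∈ SU2) (u : SL2) :
    (g.gram (a * u * b⁻¹)).det = (g.gram u).det := by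
  have hframe : ∀ k, ((a * u * b⁻¹ : SL2) : M2) * frame k =
      (a : M2) * ((u : M2) * (((b⁻¹ : SL2) : M2) * frame k * (b : M2))) * ((b⁻¹ : SL2) : M2) := by
    intro k
    simp only [Matrix.SpecialLinearGroup.coe_mul, Matrix.mul_assoc]
    rw [SL2.mul_inv_self, Matrix.mul_one]
  have hgram : g.gram (a * u * b⁻¹) = Matrix.of fun k l =>
      g.herm u ((u : M2) * (((b⁻¹ : SL2) : M2) * frame k * (b : M2)))
        ((u : M2) * (((b⁻¹ : SL2) : M2) * frame l * (b : M2))) := by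
    ext k l
    simp only [RiemMetric.gram, Matrix.of_apply, hframe, hi.herm_translate ha hb]
  rw [hgram, hg.det_herm, det_adjoint, Complex.normSq_one, Complex.ofReal_one, one_mul]
  intro k
  rw [Matrix.mul_assoc, Matrix.trace_mul_comm, Matrix.mul_assoc, SL2.mul_inv_self, Matrix.mul_one,
    trace_frame]

/-! ### Invariant metrics along the diagonal subgroup -/

/-- The radial tangent vector at `diagSL t` with upper left entry `1`. -/
def radialVec (t : ℝ) : M2 := !![1, 0; 0, -(Real.exp (-t) : ℂ)]

/-- The upper right matrix unit. -/
def upperVec : M2 := !![0, 1; 0, 0]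

/-- The lower left matrix unit. -/
def lowerVec : M2 := !![0, 0; 1, 0]

/-- The radial coefficient of an invariant metric along the diagonal subgroup. -/
def RiemMetric.radialCoeff (g : RiemMetric) (t : ℝ) : ℝ :=
  g.form (diagSL t) (radialVec t) (radialVec t)

/-- The upper off-diagonal coefficient of an invariant metric along the diagonal subgroup. -/
def RiemMetric.upperCoeff (g : RiemMetric) (t : ℝ) : ℝ := g.form (diagSL t) upperVec upperVec

/-- The lower off-diagonal coefficient of an invariant metric along the diagonal subgroup. -/
def RiemMetric.lowerCoeff (g : RiemMetric) (t : ℝ) : ℝ := g.form (diagSL t) lowerVec lowerVec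

theorem exp_neg_half_mul_exp_half (t : ℝ) : Real.exp (-(t / 2)) * Real.exp (t / 2) = 1 := by
  rw [← Real.exp_add, neg_add_cancel, Real.exp_zero]

theorem exp_eq_exp_half_mul_self (t : ℝ) :
    Real.exp t = Real.exp (t / 2) * Real.exp (t / 2) := by
  rw [← Real.exp_add, add_halves]

theorem ofReal_exp_neg_half_mul_exp_half (t : ℝ) :
    (Real.exp (-(t / 2)) : ℂ) * (Real.exp (t / 2) : ℂ) = 1 := by
  exact_mod_cast exp_neg_half_mul_exp_half t

theorem ofReal_exp_eq_exp_half_mul_self (t : ℝ) :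
    (Real.exp t : ℂ) = (Real.exp (t / 2) : ℂ) * (Real.exp (t / 2) : ℂ) := by
  exact_mod_cast exp_eq_exp_half_mul_self t

theorem mem_tangentSpace_diagSL {t : ℝ} {A : M2} :
    A ∈ tangentSpace (diagSL t) ↔ A 1 1 = -(Real.exp (-t) : ℂ) * A 0 0 := by
  have hinv := ofReal_exp_neg_half_mul_exp_half t
  rw [mem_tangentSpace_iff, ofReal_exp_eq_exp_half_mul_self (-t), neg_div]
  simp only [diagSL, Matrix.of_apply, Matrix.cons_val', Matrix.cons_val_zero, Matrix.cons_val_one,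
    Matrix.cons_val_fin_one, zero_mul, sub_zero]
  constructor <;> intro h
  · linear_combination (Real.exp (-(t / 2)) : ℂ) * h - A 1 1 * hinv
  · linear_combination (Real.exp (t / 2) : ℂ) * h - (Real.exp (-(t / 2)) : ℂ) * A 0 0 * hinv

theorem eq_sum_of_mem_tangentSpace_diagSL {t : ℝ} {A : M2} (hA : A ∈ tangentSpace (diagSL t)) :
    A = A 0 0 • radialVec t + A 0 1 • upperVec + A 1 0 • lowerVec := by
  rw [mem_tangentSpace_diagSL] at hA
  ext i j
  fin_cases i <;> fin_cases j <;> simp [-Complex.ofReal_exp, radialVec, upperVec, lowerVec]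
  linear_combination hA

theorem radialVec_mem (t : ℝ) : radialVec t ∈ tangentSpace (diagSL t) := by
  rw [mem_tangentSpace_diagSL]
  simp [radialVec]

theorem upperVec_mem (t : ℝ) : upperVec ∈ tangentSpace (diagSL t) := by
  rw [mem_tangentSpace_diagSL]
  simp [upperVec]

theorem lowerVec_mem (t : ℝ) : lowerVec ∈ tangentSpace (diagSL t) := by
  rw [mem_tangentSpace_diagSL]
  simp [lowerVec]

theorem RiemMetric.radialCoeff_pos (t : ℝ) : 0 < g.radialCoeff t :=
  g.form_pos (radialVec_mem t) fun h => by simpa [radialVec] using congrFun (congrFun h 0) 0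

theorem RiemMetric.upperCoeff_pos (t : ℝ) : 0 < g.upperCoeff t :=
  g.form_pos (upperVec_mem t) fun h => by simpa [upperVec] using congrFun (congrFun h 0) 1

theorem RiemMetric.lowerCoeff_pos (t : ℝ) : 0 < g.lowerCoeff t :=
  g.form_pos (lowerVec_mem t) fun h => by simpa [lowerVec] using congrFun (congrFun h 1) 0

/-- The diagonal element `diag (e^{iθ}, e^{-iθ})` of `SU(2)`. -/
def torusSL (θ : ℝ) : SL2 :=
  ⟨!![Complex.exp (θ * Complex.I), 0; 0, Complex.exp (-(θ * Complex.I))], by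
    rw [Matrix.det_fin_two]
    simp [← Complex.exp_add]⟩

theorem torusSL_mem (θ : ℝ) : torusSL θ ∈ SU2 := by
  rw [mem_SU2_iff]
  ext i j
  fin_cases i <;> fin_cases j <;>
    simp [torusSL, Matrix.mul_apply, Fin.sum_univ_two, ← Complex.exp_conj, ← Complex.exp_add]

theorem torusSL_conj (θ : ℝ) (A : M2) :
    (torusSL θ : M2) * A * (((torusSL θ)⁻¹ : SL2) : M2) =
      !![A 0 0, Complex.exp (2 * θ * Complex.I) * A 0 1;
        Complex.exp (-(2 * θ * Complex.I)) * A 1 0, A 1 1] := by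
  have hinv : Complex.exp (θ * Complex.I) * Complex.exp (-(θ * Complex.I)) = 1 := by
    rw [← Complex.exp_add, add_neg_cancel, Complex.exp_zero]
  have hsq : Complex.exp (2 * θ * Complex.I) = Complex.exp (θ * Complex.I) ^ 2 := by
    rw [← Complex.exp_nat_mul]; push_cast; ring_nf
  have hsq' : Complex.exp (-(2 * θ * Complex.I)) = Complex.exp (-(θ * Complex.I)) ^ 2 := by
    rw [← Complex.exp_nat_mul]; push_cast; ring_nf
  rw [Matrix.SpecialLinearGroup.coe_inv, Matrix.adjugate_fin_two, hsq, hsq']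
  ext i j
  fin_cases i <;> fin_cases j <;>
    simp [torusSL, Matrix.mul_apply, Matrix.vecMul, dotProduct, Fin.sum_univ_two]
  · linear_combination A 0 0 * hinv
  · ring
  · ring
  · linear_combination A 1 1 * hinv

theorem torusSL_conj_diagSL (θ t : ℝ) : torusSL θ * diagSL t * (torusSL θ)⁻¹ = diagSL t := by
  apply Subtype.ext
  rw [Matrix.SpecialLinearGroup.coe_mul, Matrix.SpecialLinearGroup.coe_mul, torusSL_conj]
  ext i j
  fin_cases i <;> fin_cases j <;> simp [diagSL]

theorem RiemMetric.herm_eq_zero_of_stabilizer (hg : g.IsHermitian) (hi : g.IsInvariant)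
    {a u : SL2} (ha : a ∈ SU2) (hu : a * u * a⁻¹ = u) {A B : M2} {c d : ℂ}
    (hA : (a : M2) * A * ((a⁻¹ : SL2) : M2) = c • A)
    (hB : (a : M2) * B * ((a⁻¹ : SL2) : M2) = d • B) (hcd : c * (starRingEnd ℂ) d ≠ 1) :
    g.herm u A B = 0 := by
  have h := hi.herm_translate ha ha u A B
  rw [hu, hA, hB, hg.herm_smul_left, hg.herm_smul_right, ← mul_assoc] at h
  exact (mul_left_eq_self₀.1 h).resolve_left hcd

/-- The quarter-angle element of the torus fixes `diagSL t` and acts on the three vectors with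
the distinct eigenvalues `1`, `i` and `-i`. -/
theorem RiemMetric.herm_diagSL_offDiag (hg : g.IsHermitian) (hi : g.IsInvariant) (t : ℝ) :
    g.herm (diagSL t) (radialVec t) upperVec = 0 ∧
      g.herm (diagSL t) (radialVec t) lowerVec = 0 ∧
      g.herm (diagSL t) upperVec lowerVec = 0 := by
  have hexp : Complex.exp (2 * ((Real.pi / 4 : ℝ) : ℂ) * Complex.I) = Complex.I := by
    rw [show 2 * ((Real.pi / 4 : ℝ) : ℂ) * Complex.I = Real.pi / 2 * Complex.I by push_cast; ring,
      Complex.exp_pi_div_two_mul_I]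
  have hconj : ∀ A : M2, (torusSL (Real.pi / 4) : M2) * A *
      (((torusSL (Real.pi / 4))⁻¹ : SL2) : M2) =
        !![A 0 0, Complex.I * A 0 1; -Complex.I * A 1 0, A 1 1] := fun A => by
    rw [torusSL_conj, Complex.exp_neg, hexp, Complex.inv_I]
  have hradial : (torusSL (Real.pi / 4) : M2) * radialVec t *
      (((torusSL (Real.pi / 4))⁻¹ : SL2) : M2) = (1 : ℂ) • radialVec t := by
    rw [hconj]
    simp [radialVec]
  have hupper : (torusSL (Real.pi / 4) : M2) * upperVec *
      (((torusSL (Real.pi / 4))⁻¹ : SL2) : M2) = Complex.I • upperVec := by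
    rw [hconj]
    simp [upperVec]
  have hlower : (torusSL (Real.pi / 4) : M2) * lowerVec *
      (((torusSL (Real.pi / 4))⁻¹ : SL2) : M2) = (-Complex.I) • lowerVec := by
    rw [hconj]
    simp [lowerVec]
  have hortho := @RiemMetric.herm_eq_zero_of_stabilizer g hg hi _ (diagSL t)
    (torusSL_mem (Real.pi / 4)) (torusSL_conj_diagSL _ t)
  exact ⟨hortho hradial hupper (by simp [Complex.ext_iff]),
    hortho hradial hlower (by simp [Complex.ext_iff]),
    hortho hupper hlower (by simp; norm_num)⟩

theorem RiemMetric.herm_diagSL (hg : g.IsHermitian) (hi : g.IsInvariant) (t : ℝ) {A B : M2}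
    (hA : A ∈ tangentSpace (diagSL t)) (hB : B ∈ tangentSpace (diagSL t)) :
    g.herm (diagSL t) A B = ((g.radialCoeff t : ℂ) * (A 0 0 * (starRingEnd ℂ) (B 0 0)) +
      (g.upperCoeff t : ℂ) * (A 0 1 * (starRingEnd ℂ) (B 0 1)) +
      (g.lowerCoeff t : ℂ) * (A 1 0 * (starRingEnd ℂ) (B 1 0))) / 2 := by
  obtain ⟨hru, hrl, hul⟩ := RiemMetric.herm_diagSL_offDiag hg hi t
  have hur : g.herm (diagSL t) upperVec (radialVec t) = 0 := by rw [← hg.conj_herm, hru, map_zero]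
  have hlr : g.herm (diagSL t) lowerVec (radialVec t) = 0 := by rw [← hg.conj_herm, hrl, map_zero]
  have hlu : g.herm (diagSL t) lowerVec upperVec = 0 := by rw [← hg.conj_herm, hul, map_zero]
  conv_lhs =>
    rw [eq_sum_of_mem_tangentSpace_diagSL hA, eq_sum_of_mem_tangentSpace_diagSL hB]
  simp only [g.herm_add_left, hg.herm_add_right, hg.herm_smul_left, hg.herm_smul_right, hru, hrl,
    hul, hur, hlr, hlu, hg.herm_self, RiemMetric.radialCoeff, RiemMetric.upperCoeff,
    RiemMetric.lowerCoeff]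
  ring

theorem RiemMetric.form_diagSL (hg : g.IsHermitian) (hi : g.IsInvariant) (t : ℝ) {A B : M2}
    (hA : A ∈ tangentSpace (diagSL t)) (hB : B ∈ tangentSpace (diagSL t)) :
    g.form (diagSL t) A B = g.radialCoeff t * (A 0 0 * (starRingEnd ℂ) (B 0 0)).re +
      g.upperCoeff t * (A 0 1 * (starRingEnd ℂ) (B 0 1)).re +
      g.lowerCoeff t * (A 1 0 * (starRingEnd ℂ) (B 1 0)).re := by
  rw [g.form_eq_herm, g.herm_diagSL hg hi t hA hB]
  simp only [Complex.div_ofNat_re, Complex.add_re, Complex.re_ofReal_mul]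
  ring

/-- The volume density of an invariant metric at `diagSL t` in a left-invariant frame. -/
def RiemMetric.volumeDensity (g : RiemMetric) (t : ℝ) : ℝ :=
  g.radialCoeff t * Real.exp t * g.upperCoeff t * g.lowerCoeff t / 8

theorem RiemMetric.volumeDensity_pos (t : ℝ) : 0 < g.volumeDensity t := by
  have := g.radialCoeff_pos t
  have := g.upperCoeff_pos t
  have := g.lowerCoeff_pos t
  unfold RiemMetric.volumeDensity
  positivity

theorem RiemMetric.gramDet_diagSL (hg : g.IsHermitian) (hi : g.IsInvariant) (t : ℝ) :
    (g.gram (diagSL t)).det = (g.volumeDensity t : ℂ) := by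
  have hinv := ofReal_exp_neg_half_mul_exp_half t
  rw [Matrix.det_fin_three, RiemMetric.volumeDensity]
  simp only [RiemMetric.gram, Matrix.of_apply,
    g.herm_diagSL hg hi t (mul_frame_mem _ _) (mul_frame_mem _ _), Complex.ofReal_mul,
    Complex.ofReal_div, Complex.ofReal_ofNat, ofReal_exp_eq_exp_half_mul_self t]
  simp [-Complex.ofReal_exp, frame, diagSL, Matrix.mul_apply, Fin.sum_univ_two,
    Complex.conj_ofReal]
  linear_combination (g.radialCoeff t * g.upperCoeff t * g.lowerCoeff t *
    (Real.exp (t / 2) : ℂ) ^ 2 / 8 *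
    ((Real.exp (t / 2) : ℂ) * (Real.exp (-(t / 2)) : ℂ) + 1) : ℂ) * hinv

/-! ### The Frobenius pairing -/

section Frobenius

variable {m n : Type*} [Fintype m] [Fintype n]

/-- The Frobenius pairing `tr (B* A)` of complex matrices, linear in `A`. -/
def pair (A B : Matrix m n ℂ) : ℂ := (Bᴴ * A).trace

/-- The squared Frobenius norm. -/
def frobSq (A : Matrix m n ℂ) : ℝ := ∑ i, ∑ j, Complex.normSq (A i j)

theorem pair_eq_sum (A B : Matrix m n ℂ) :
    pair A B = ∑ i, ∑ j, A i j * (starRingEnd ℂ) (B i j) := by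
  rw [Finset.sum_comm]
  simp only [pair, Matrix.trace, Matrix.diag_apply, Matrix.mul_apply, Matrix.conjTranspose_apply,
    RCLike.star_def, mul_comm]

theorem pair_self (A : Matrix m n ℂ) : pair A A = (frobSq A : ℂ) := by
  simp only [pair_eq_sum, frobSq, Complex.mul_conj, Complex.ofReal_sum]

theorem frobSq_nonneg (A : Matrix m n ℂ) : 0 ≤ frobSq A :=
  Finset.sum_nonneg fun _ _ => Finset.sum_nonneg fun _ _ => Complex.normSq_nonneg _

theorem normSq_apply_le_frobSq (A : Matrix m n ℂ) (i : m) (j : n) :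
    Complex.normSq (A i j) ≤ frobSq A :=
  (Finset.single_le_sum (f := fun j => Complex.normSq (A i j)) (fun _ _ => Complex.normSq_nonneg _)
    (Finset.mem_univ j)).trans <|
    Finset.single_le_sum (f := fun i => ∑ j, Complex.normSq (A i j))
      (fun _ _ => Finset.sum_nonneg fun _ _ => Complex.normSq_nonneg _) (Finset.mem_univ i)

theorem frobSq_pos {A : Matrix m n ℂ} (h : A ≠ 0) : 0 < frobSq A := by
  contrapose! h
  ext i j
  exact Complex.normSq_eq_zero.1 <|
    ((normSq_apply_le_frobSq A i j).trans h).antisymm (Complex.normSq_nonneg _)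

theorem pair_add_left (A A' B : Matrix m n ℂ) : pair (A + A') B = pair A B + pair A' B := by
  rw [pair, Matrix.mul_add, Matrix.trace_add, pair, pair]

theorem pair_smul_left (c : ℂ) (A B : Matrix m n ℂ) : pair (c • A) B = c * pair A B := by
  rw [pair, Matrix.mul_smul, Matrix.trace_smul, smul_eq_mul, pair]

theorem pair_conj (A B : Matrix m n ℂ) : (starRingEnd ℂ) (pair A B) = pair B A := by
  rw [pair, ← RCLike.star_def, ← Matrix.trace_conjTranspose, Matrix.conjTranspose_mul,
    Matrix.conjTranspose_conjTranspose, pair]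

theorem pair_smul_right (c : ℂ) (A B : Matrix m n ℂ) :
    pair A (c • B) = (starRingEnd ℂ) c * pair A B := by
  rw [← pair_conj, pair_smul_left, map_mul, pair_conj]

theorem pair_add_right (A B B' : Matrix m n ℂ) : pair A (B + B') = pair A B + pair A B' := by
  rw [← pair_conj, pair_add_left, map_add, pair_conj, pair_conj]

theorem normSq_pair_le (A B : Matrix m n ℂ) :
    Complex.normSq (pair A B) ≤ frobSq A * frobSq B := by
  have hsum : ‖pair A B‖ ≤ ∑ p : m × n, ‖A p.1 p.2‖ * ‖B p.1 p.2‖ := by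
    rw [pair_eq_sum, ← Fintype.sum_prod_type']
    refine (norm_sum_le _ _).trans_eq (Finset.sum_congr rfl fun p _ => ?_)
    rw [norm_mul, RCLike.norm_conj]
  simp only [frobSq, Complex.normSq_eq_norm_sq, ← Fintype.sum_prod_type']
  exact (pow_le_pow_left₀ (norm_nonneg _) hsum 2).trans
    (Finset.sum_mul_sq_le_sq_mul_sq _ _ _)

end Frobenius

theorem pair_translate {a b : SL2} (ha : a ∈ SU2) (hb : b ∈ SU2) (A B : M2) :
    pair ((a : M2) * A * ((b⁻¹ : SL2) : M2)) ((a : M2) * B * ((b⁻¹ : SL2) : M2)) = pair A B := by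
  rw [pair, pair, Matrix.conjTranspose_mul, Matrix.conjTranspose_mul, SU2.coe_inv hb,
    Matrix.conjTranspose_conjTranspose]
  calc ((b : M2) * (Bᴴ * (a : M2)ᴴ) * ((a : M2) * A * (b : M2)ᴴ)).trace
      = ((b : M2) * (Bᴴ * ((a : M2)ᴴ * (a : M2)) * A) * (b : M2)ᴴ).trace := by
        simp only [Matrix.mul_assoc]
    _ = (Bᴴ * A).trace := by
        rw [mem_SU2_iff.1 ha, Matrix.mul_one, Matrix.trace_mul_comm, ← Matrix.mul_assoc,
          mem_SU2_iff.1 hb, Matrix.one_mul]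

theorem frobSq_coe (u : SL2) : frobSq (u : M2) = 2 * tau u := by
  simp only [frobSq, Fin.sum_univ_two, tau]
  ring

theorem pair_conjTranspose_inv (u : SL2) (X : M2) :
    pair X ((u⁻¹ : SL2) : M2)ᴴ = (((u⁻¹ : SL2) : M2) * X).trace := by
  rw [pair, Matrix.conjTranspose_conjTranspose]

theorem frobSq_conjTranspose_inv (u : SL2) : frobSq ((u⁻¹ : SL2) : M2)ᴴ = 2 * tau u := by
  rw [Matrix.SpecialLinearGroup.coe_inv, Matrix.adjugate_fin_two, tau]
  simp [frobSq, Fin.sum_univ_two]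
  ring

-- Since `X ⊥ (u⁻¹)*`, the vector `u` may be replaced by its component orthogonal to `(u⁻¹)*`.
theorem tau_mul_normSq_pair_le {u : SL2} {X : M2} (hX : X ∈ tangentSpace u) :
    tau u * Complex.normSq (pair X u) ≤ 2 * (tau u ^ 2 - 1) * frobSq X := by
  set n : M2 := ((u⁻¹ : SL2) : M2)ᴴ with hn
  have hXn : pair X n = 0 := (pair_conjTranspose_inv u X).trans hX
  have hun : pair u n = 2 := by
    rw [hn, pair_conjTranspose_inv, SL2.inv_mul_self, Matrix.trace_one, Fintype.card_fin,
      Nat.cast_ofNat]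
  have hnu : pair n u = 2 := by rw [← pair_conj, hun, map_ofNat]
  have huu : pair (u : M2) u = ((2 * tau u : ℝ) : ℂ) := by rw [pair_self, frobSq_coe]
  have hnn : pair n n = ((2 * tau u : ℝ) : ℂ) := by rw [pair_self, hn, frobSq_conjTranspose_inv]
  set W : M2 := (tau u : ℂ) • (u : M2) + (-1 : ℂ) • n with hW
  have hXW : pair X W = tau u * pair X u := by
    rw [hW, pair_add_right, pair_smul_right, pair_smul_right, hXn, Complex.conj_ofReal, mul_zero,
      add_zero]
  have hWW : frobSq W = 2 * tau u * (tau u ^ 2 - 1) := by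
    rw [← Complex.ofReal_inj, ← pair_self, hW]
    simp only [pair_add_left, pair_add_right, pair_smul_left, pair_smul_right, hun, hnu, huu, hnn,
      Complex.conj_ofReal, map_neg, map_one]
    push_cast
    ring
  have hcs := normSq_pair_le X W
  rw [hXW, hWW, Complex.normSq_mul, Complex.normSq_ofReal] at hcs
  have hpos : 0 < tau u := zero_lt_one.trans_le (one_le_tau u)
  refine le_of_mul_le_mul_left ?_ hpos
  linarith

/-! ### The metric with a radial Kähler potential -/

/-- The real part of the Hermitian form `∂∂̄ (radialPotential ∘ tau)`, as a form on matrices. -/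
def stenzelForm (u : SL2) (A B : M2) : ℝ :=
  profile (tau u) * (pair A B).re +
    deriv profile (tau u) / 2 * (pair A u * (starRingEnd ℂ) (pair B u)).re

theorem neg_one_lt_tau (u : SL2) : -1 < tau u := by linarith [one_le_tau u]

theorem stenzelForm_self (u : SL2) (A : M2) :
    stenzelForm u A A =
      profile (tau u) * frobSq A + deriv profile (tau u) / 2 * Complex.normSq (pair A u) := by
  rw [stenzelForm, pair_self, Complex.mul_conj, Complex.ofReal_re, Complex.ofReal_re]

theorem stenzelForm_symm (u : SL2) (A B : M2) : stenzelForm u A B = stenzelForm u B A := by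
  rw [stenzelForm, stenzelForm, ← pair_conj A B, Complex.conj_re,
    ← Complex.conj_re (pair A u * _), map_mul, Complex.conj_conj, mul_comm (pair B u)]

theorem min_mul_frobSq_le_stenzelForm {u : SL2} {X : M2} (hX : X ∈ tangentSpace u) :
    min (profile (tau u)) (tau u)⁻¹ * frobSq X ≤ stenzelForm u X X := by
  have hN := frobSq_nonneg X
  rw [stenzelForm_self]
  rcases le_total 0 (deriv profile (tau u)) with hd | hd
  · calc min (profile (tau u)) (tau u)⁻¹ * frobSq X
        ≤ profile (tau u) * frobSq X := by gcongr; exact min_le_left _ _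
      _ ≤ _ := le_add_of_nonneg_right (mul_nonneg (by linarith) (Complex.normSq_nonneg _))
  · refine (mul_le_mul_of_nonneg_right (min_le_right _ _) hN).trans ?_
    rw [inv_mul_le_iff₀ (zero_lt_one.trans_le (one_le_tau u))]
    have hcs := mul_le_mul_of_nonpos_left (tau_mul_normSq_pair_le hX) hd
    have hradial := mul_le_mul_of_nonneg_right (one_le_radialHessian (one_le_tau u)) hN
    linarith

theorem stenzelForm_pos {u : SL2} {X : M2} (hX : X ∈ tangentSpace u) (h0 : X ≠ 0) :
    0 < stenzelForm u X X :=
  (mul_pos (lt_min (profile_pos (neg_one_lt_tau u))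
    (inv_pos.2 (zero_lt_one.trans_le (one_le_tau u)))) (frobSq_pos h0)).trans_le
    (min_mul_frobSq_le_stenzelForm hX)

theorem stenzelForm_self_nonneg {u : SL2} {X : M2} (hX : X ∈ tangentSpace u) :
    0 ≤ stenzelForm u X X := by
  rcases eq_or_ne X 0 with rfl | h0
  · simp [stenzelForm, pair]
  · exact (stenzelForm_pos hX h0).le

theorem normSq_pair_le_stenzelForm {u : SL2} {X : M2} (hX : X ∈ tangentSpace u) :
    Complex.normSq (pair X u) ≤ 2 * (tau u + 1) ^ 2 * stenzelForm u X X := by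
  have h1 := one_le_tau u
  have hP := one_le_radialHessian h1
  have hQ := Complex.normSq_nonneg (pair X u)
  have hcs := mul_le_mul_of_nonneg_left (tau_mul_normSq_pair_le hX)
    (profile_pos (neg_one_lt_tau u)).le
  have hnn := stenzelForm_self_nonneg hX
  have h2 : Complex.normSq (pair X u) ≤ 2 * (tau u ^ 2 - 1) * stenzelForm u X X := by
    rw [stenzelForm_self]
    nlinarith
  nlinarith

/-- The inner product given by `stenzelForm` on a tangent space. -/
def stenzelInner (u : SL2) : tangentSpace u →ₗ[ℝ] tangentSpace u →ₗ[ℝ] ℝ :=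
  LinearMap.mk₂ ℝ (fun X Y => stenzelForm u X Y)
    (fun X X' Y => by
      simp only [stenzelForm, Submodule.coe_add, pair_add_left, add_mul, Complex.add_re]
      ring)
    (fun c X Y => by
      have h : ((c • X : tangentSpace u) : M2) = (c : ℂ) • (X : M2) := rfl
      simp only [stenzelForm, h, pair_smul_left, mul_assoc, Complex.re_ofReal_mul, smul_eq_mul]
      ring)
    (fun X Y Y' => by
      simp only [stenzelForm, Submodule.coe_add, pair_add_right, pair_add_left, map_add, mul_add,
        Complex.add_re]
      ring)
    (fun c X Y => by
      have h : ((c • Y : tangentSpace u) : M2) = (c : ℂ) • (Y : M2) := rfl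
      simp only [stenzelForm, h, pair_smul_left, pair_smul_right, map_mul, Complex.conj_ofReal,
        mul_left_comm (pair (X : M2) u), Complex.re_ofReal_mul, smul_eq_mul]
      ring)

/-! ### Calculus in a holomorphic parametrization -/

/-- The differential of a parametrization, as a matrix. -/
def Param.jac (φ : Param) (z v : C3) : M2 :=
  Matrix.of (fderiv ℂ (fun x => entries (φ.toFun x)) z v)

theorem Param.coe_push (φ : Param) (z v : C3) : (φ.push z v : M2) = φ.jac z v := rfl

theorem Param.jac_mem (φ : Param) (z v : C3) : φ.jac z v ∈ tangentSpace (φ.toFun z) :=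
  (φ.push z v).2

theorem Param.jac_smul (φ : Param) (z : C3) (c : ℂ) (v : C3) :
    φ.jac z (c • v) = c • φ.jac z v := by
  rw [Param.jac, map_smul]
  rfl

theorem Param.push_smul (φ : Param) (z : C3) (c : ℂ) (v : C3) :
    φ.push z (c • v) = c • φ.push z v :=
  Subtype.ext (φ.jac_smul z c v)

/-- The second differential of a parametrization, as a matrix. -/
def Param.jac₂ (φ : Param) (z v w : C3) : M2 :=
  Matrix.of (fderiv ℂ (fun x => fderiv ℂ (fun x => entries (φ.toFun x)) x v) z w)

theorem Param.jac₂_smul (φ : Param) {z : C3} (hz : z ∈ φ.U) (c : ℂ) (v w : C3) :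
    φ.jac₂ z (c • v) (c • w) = (c * c) • φ.jac₂ z v w := by
  have hdiff := (differentiableOn_fderiv_apply φ.isOpen φ.holomorphic v).differentiableAt
    (φ.isOpen.mem_nhds hz)
  simp only [Param.jac₂, map_smul, fderiv_fun_const_smul hdiff, smul_apply, smul_smul]
  rfl

theorem Param.differentiableOn_entry (φ : Param) (i j : Fin 2) :
    DifferentiableOn ℂ (fun z => (φ.toFun z : M2) i j) φ.U :=
  differentiableOn_pi.1 (differentiableOn_pi.1 φ.holomorphic i) j

theorem Param.differentiableOn_jac (φ : Param) (v : C3) (i j : Fin 2) :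
    DifferentiableOn ℂ (fun z => φ.jac z v i j) φ.U :=
  differentiableOn_pi.1 (differentiableOn_pi.1
    (differentiableOn_fderiv_apply φ.isOpen φ.holomorphic v) i) j

theorem Param.contDiffOn_entry (φ : Param) (i j : Fin 2) :
    ContDiffOn ℝ ∞ (fun z => (φ.toFun z : M2) i j) φ.U :=
  (contDiffOn_of_differentiableOn φ.isOpen (φ.differentiableOn_entry i j)).restrict_scalars ℝ

theorem Param.contDiffOn_jac (φ : Param) (v : C3) (i j : Fin 2) :
    ContDiffOn ℝ ∞ (fun z => φ.jac z v i j) φ.U :=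
  (contDiffOn_of_differentiableOn φ.isOpen (φ.differentiableOn_jac v i j)).restrict_scalars ℝ

section Smoothness

variable {E : Type*} [NormedAddCommGroup E] [NormedSpace ℝ E] {s : Set E} {k : WithTop ℕ∞}

theorem contDiffOn_conj {f : E → ℂ} (hf : ContDiffOn ℝ k f s) :
    ContDiffOn ℝ k (fun x => (starRingEnd ℂ) (f x)) s :=
  (Complex.conjCLE : ℂ →L[ℝ] ℂ).contDiff.comp_contDiffOn hf

theorem contDiffOn_re {f : E → ℂ} (hf : ContDiffOn ℝ k f s) :
    ContDiffOn ℝ k (fun x => (f x).re) s :=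
  Complex.reCLM.contDiff.comp_contDiffOn hf

theorem hasDerivAt_re {f : ℝ → ℂ} {f' : ℂ} {t : ℝ} (h : HasDerivAt f f' t) :
    HasDerivAt (fun t => (f t).re) f'.re t :=
  Complex.reCLM.hasFDerivAt.comp_hasDerivAt t h

variable {m n : Type*} [Fintype m] [Fintype n]

theorem contDiffOn_pair {A B : E → Matrix m n ℂ} (hA : ∀ i j, ContDiffOn ℝ k (fun x => A x i j) s)
    (hB : ∀ i j, ContDiffOn ℝ k (fun x => B x i j) s) :
    ContDiffOn ℝ k (fun x => pair (A x) (B x)) s := by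
  simp only [pair_eq_sum]
  exact ContDiffOn.sum fun i _ => ContDiffOn.sum fun j _ => (hA i j).mul (contDiffOn_conj (hB i j))

theorem hasDerivAt_pair {A B : ℝ → Matrix m n ℂ} {A' B' : Matrix m n ℂ} {t : ℝ}
    (hA : ∀ i j, HasDerivAt (fun t => A t i j) (A' i j) t)
    (hB : ∀ i j, HasDerivAt (fun t => B t i j) (B' i j) t) :
    HasDerivAt (fun t => pair (A t) (B t)) (pair A' (B t) + pair (A t) B') t := by
  simp only [pair_eq_sum, ← Finset.sum_add_distrib]
  exact HasDerivAt.fun_sum fun i _ => HasDerivAt.fun_sum fun j _ => (hA i j).mul (hB i j).star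

end Smoothness

theorem tau_eq_pair (u : SL2) : tau u = (pair (u : M2) u).re / 2 := by
  rw [pair_self, Complex.ofReal_re, frobSq_coe]
  ring

theorem hasDerivAt_tau {γ : ℝ → SL2} {A : M2} {t : ℝ}
    (h : ∀ i j, HasDerivAt (fun t => (γ t : M2) i j) (A i j) t) :
    HasDerivAt (fun t => tau (γ t)) (pair A (γ t)).re t := by
  simp only [tau_eq_pair]
  convert! (hasDerivAt_re (hasDerivAt_pair h h)).div_const 2 using 1
  rw [Complex.add_re, ← pair_conj A, Complex.conj_re, add_self_div_two]

theorem Param.contDiffOn_tau (φ : Param) : ContDiffOn ℝ ∞ (fun z => tau (φ.toFun z)) φ.U := by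
  simp only [tau_eq_pair]
  exact (contDiffOn_re (contDiffOn_pair φ.contDiffOn_entry φ.contDiffOn_entry)).div_const 2

theorem Param.hasDerivAt_line (φ : Param) {z : C3} (hz : z ∈ φ.U) (w : C3) (i j : Fin 2) :
    HasDerivAt (fun s : ℝ => (φ.toFun (z + s • w) : M2) i j) (φ.jac z w i j) 0 :=
  hasDerivAt_pi.1 (hasDerivAt_pi.1 (((φ.holomorphic.differentiableAt
    (φ.isOpen.mem_nhds hz)).hasFDerivAt.restrictScalars ℝ).hasLineDerivAt w) i) j

theorem Param.hasDerivAt_jac_line (φ : Param) {z : C3} (hz : z ∈ φ.U) (v w : C3) (i j : Fin 2) :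
    HasDerivAt (fun s : ℝ => φ.jac (z + s • w) v i j) (φ.jac₂ z v w i j) 0 :=
  hasDerivAt_pi.1 (hasDerivAt_pi.1 ((((differentiableOn_fderiv_apply φ.isOpen φ.holomorphic
    v).differentiableAt (φ.isOpen.mem_nhds hz)).hasFDerivAt.restrictScalars ℝ).hasLineDerivAt w)
      i) j

/-! ### The Ricci-flat Kähler metric -/

/-- The metric `∂∂̄ (radialPotential ∘ tau)` on `SL(2, ℂ)`. -/
def stenzel : RiemMetric where
  inner := stenzelInner
  symm u X Y := stenzelForm_symm u X Y
  pos _ X hX := stenzelForm_pos X.2 fun h => hX (Subtype.ext h)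
  smooth φ v w := by
    have hprofile : ContDiffOn ℝ ∞ (fun z => profile (tau (φ.toFun z))) φ.U :=
      contDiffOn_profile.comp φ.contDiffOn_tau fun z _ => neg_one_lt_tau _
    have hderiv : ContDiffOn ℝ ∞ (fun z => deriv profile (tau (φ.toFun z))) φ.U :=
      contDiffOn_deriv_profile.comp φ.contDiffOn_tau fun z _ => neg_one_lt_tau _
    have hpair := contDiffOn_re (contDiffOn_pair (φ.contDiffOn_jac v) (φ.contDiffOn_jac w))
    have hradial := contDiffOn_re ((contDiffOn_pair (φ.contDiffOn_jac v) φ.contDiffOn_entry).mul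
      (contDiffOn_conj (contDiffOn_pair (φ.contDiffOn_jac w) φ.contDiffOn_entry)))
    exact (hprofile.mul hpair).add ((hderiv.div_const 2).mul hradial)

theorem stenzel_inner (u : SL2) (X Y : tangentSpace u) :
    stenzel.inner u X Y = stenzelForm u X Y := rfl

theorem stenzel_form {u : SL2} {A B : M2} (hA : A ∈ tangentSpace u) (hB : B ∈ tangentSpace u) :
    stenzel.form u A B = stenzelForm u A B := by
  rw [RiemMetric.form_apply, stenzel_inner, coe_tangentProj_of_mem hA, coe_tangentProj_of_mem hB]

/-- The Kähler potential of `stenzel`. -/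
def potential (u : SL2) : ℝ := radialPotential (tau u)

theorem Param.contDiffOn_potential (φ : Param) :
    ContDiffOn ℝ ∞ (fun z => potential (φ.toFun z)) φ.U :=
  contDiffOn_radialPotential.comp φ.contDiffOn_tau fun _ _ => neg_one_lt_tau _

theorem Param.contDiffAt_potential (φ : Param) {z : C3} (hz : z ∈ φ.U) {k : ℕ∞} :
    ContDiffAt ℝ k (fun z => potential (φ.toFun z)) z :=
  (φ.contDiffOn_potential.contDiffAt (φ.isOpen.mem_nhds hz)).of_le (by exact_mod_cast le_top)

theorem fderiv_eq_of_hasLineDerivAt {E : Type*} [NormedAddCommGroup E] [NormedSpace ℝ E]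
    {F : E → ℝ} {z w : E} {c : ℝ} (hF : DifferentiableAt ℝ F z) (h : HasLineDerivAt ℝ F c z w) :
    fderiv ℝ F z w = c :=
  (hF.hasFDerivAt.hasLineDerivAt w).unique h

theorem Param.fderiv_potential (φ : Param) {z : C3} (hz : z ∈ φ.U) (v : C3) :
    fderiv ℝ (fun x => potential (φ.toFun x)) z v =
      profile (tau (φ.toFun z)) * (pair (φ.jac z v) (φ.toFun z)).re := by
  refine fderiv_eq_of_hasLineDerivAt ((φ.contDiffAt_potential hz (k := 1)).differentiableAt
    one_ne_zero) ?_
  have h := (hasDerivAt_radialPotential (neg_one_lt_tau (φ.toFun (z + (0 : ℝ) • v)))).comp 0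
    (hasDerivAt_tau (φ.hasDerivAt_line hz v))
  rwa [zero_smul, add_zero] at h

theorem Param.realHessian_potential (φ : Param) {z : C3} (hz : z ∈ φ.U) (w v : C3) :
    realHessian (fun x => potential (φ.toFun x)) z w v =
      deriv profile (tau (φ.toFun z)) * (pair (φ.jac z w) (φ.toFun z)).re *
          (pair (φ.jac z v) (φ.toFun z)).re +
        profile (tau (φ.toFun z)) *
          (pair (φ.jac₂ z v w) (φ.toFun z) + pair (φ.jac z v) (φ.jac z w)).re := by
  have hF := φ.contDiffAt_potential hz (k := 2)
  rw [← fderiv_fderiv_apply hF]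
  refine fderiv_eq_of_hasLineDerivAt
    ((differentiableAt_fderiv hF).clm_apply (differentiableAt_const v)) ?_
  have hmem : ∀ᶠ s : ℝ in 𝓝 0, z + s • w ∈ φ.U :=
    ContinuousAt.preimage_mem_nhds (f := fun s : ℝ => z + s • w) (by fun_prop)
      (by simpa using φ.isOpen.mem_nhds hz)
  have hgrad : (fun s : ℝ => fderiv ℝ (fun x => potential (φ.toFun x)) (z + s • w) v) =ᶠ[𝓝 0]
      fun s => profile (tau (φ.toFun (z + s • w))) *
        (pair (φ.jac (z + s • w) v) (φ.toFun (z + s • w))).re := by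
    filter_upwards [hmem] with s hs using φ.fderiv_potential hs v
  refine HasDerivAt.congr_of_eventuallyEq ?_ hgrad
  have h := ((hasDerivAt_profile (neg_one_lt_tau (φ.toFun (z + (0 : ℝ) • w)))).comp 0
    (hasDerivAt_tau (φ.hasDerivAt_line hz w))).mul
    (hasDerivAt_re (hasDerivAt_pair (φ.hasDerivAt_jac_line hz v w) (φ.hasDerivAt_line hz w)))
  simp only [Function.comp_def, zero_smul, add_zero] at h
  exact h

theorem Param.stenzelForm_jac (φ : Param) {z : C3} (hz : z ∈ φ.U) (v w : C3) :
    stenzelForm (φ.toFun z) (φ.jac z v) (φ.jac z w) =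
      (realHessian (fun x => potential (φ.toFun x)) z v w +
        realHessian (fun x => potential (φ.toFun x)) z (Complex.I • v) (Complex.I • w)) / 2 := by
  rw [φ.realHessian_potential hz, φ.realHessian_potential hz, φ.jac₂_smul hz, φ.jac_smul,
    φ.jac_smul]
  simp only [pair_smul_left, pair_smul_right, stenzelForm, ← pair_conj (φ.jac z v) (φ.jac z w)]
  simp
  ring

theorem stenzel_isHermitian : stenzel.IsHermitian := by
  intro u X Y
  simp only [stenzel_inner, Submodule.coe_smul, stenzelForm, pair_smul_left, pair_smul_right]
  simp

theorem stenzel_hasPotential : stenzel.HasPotential potential := by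
  intro φ
  refine ⟨φ.contDiffOn_potential, fun z hz a b => ?_⟩
  rw [complexHessian_eq (φ.contDiffAt_potential hz (k := 2)), RiemMetric.hermMatrix,
    Matrix.of_apply, stenzel_inner, stenzel_inner]
  simp only [Param.coe_push]
  rw [φ.stenzelForm_jac hz, φ.stenzelForm_jac hz, single_I, single_I, smul_smul, Complex.I_mul_I]
  simp only [realHessian, neg_smul, one_smul, map_neg]
  push_cast
  ring

theorem stenzel_omegaCoord (φ : Param) {z : C3} (hz : z ∈ φ.U) (v w : C3) :
    stenzel.omegaCoord φ v w z = ddbarForm (fun x => potential (φ.toFun x)) z v w := by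
  rw [RiemMetric.omegaCoord, RiemMetric.omega, ← φ.push_smul, stenzel_inner, Param.coe_push,
    Param.coe_push, φ.stenzelForm_jac hz, smul_smul, Complex.I_mul_I]
  simp only [ddbarForm, realHessian, neg_smul, one_smul, map_neg, neg_apply]
  ring

theorem stenzel_isKahler : stenzel.IsKahler where
  hermitian := stenzel_isHermitian
  closed φ z hz v₁ v₂ v₃ := by
    have heq : ∀ v w, stenzel.omegaCoord φ v w =ᶠ[𝓝 z]
        fun x => ddbarForm (fun x => potential (φ.toFun x)) x v w := fun v w => by
      filter_upwards [φ.isOpen.mem_nhds hz] with x hx using stenzel_omegaCoord φ hx v w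
    simp only [(heq _ _).fderiv_eq]
    exact ddbarForm_closed (φ.contDiffAt_potential hz (k := 3)) v₁ v₂ v₃

theorem stenzel_isInvariant : stenzel.IsInvariant := by
  intro a ha b hb u X Y
  have htranslate : ∀ X : tangentSpace u, (translate a b u X : M2) =
    (a : M2) * (X : M2) * ((b⁻¹ : SL2) : M2) := fun _ => rfl
  simp only [stenzel_inner, stenzelForm, htranslate, tau_translate ha hb,
    Matrix.SpecialLinearGroup.coe_mul, pair_translate ha hb]

/-! ### Ricci-flatness and the Gram determinant -/

/-- The differential of a parametrization in the left-invariant frame. -/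
def Param.frameJac (φ : Param) (z : C3) : Matrix (Fin 3) (Fin 3) ℂ :=
  Matrix.of fun a k =>
    frameCoord ((((φ.toFun z)⁻¹ : SL2) : M2) * φ.jac z (Pi.single a 1)) k

theorem RiemMetric.hermMatrix_eq (φ : Param) (z : C3) :
    g.hermMatrix φ z = Matrix.of fun a b =>
      g.herm (φ.toFun z) (φ.jac z (Pi.single a 1)) (φ.jac z (Pi.single b 1)) := by
  ext a b
  simp only [RiemMetric.hermMatrix, Matrix.of_apply, RiemMetric.herm, g.inner_eq_form,
    Param.coe_push, single_I, φ.jac_smul]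

theorem RiemMetric.IsHermitian.det_hermMatrix (hg : g.IsHermitian) (φ : Param) (z : C3) :
    (g.hermMatrix φ z).det =
      (Complex.normSq (φ.frameJac z).det : ℂ) * (g.gram (φ.toFun z)).det := by
  have h := hg.det_herm (φ.toFun z)
    (fun a => (((φ.toFun z)⁻¹ : SL2) : M2) * φ.jac z (Pi.single a 1))
    (fun a => mem_tangentSpace.1 (φ.jac_mem z _))
  simp only [← Matrix.mul_assoc, SL2.mul_inv_self, Matrix.one_mul] at h
  rw [g.hermMatrix_eq]
  exact h

theorem Param.frameCoord_jac (φ : Param) (z c : C3) :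
    frameCoord ((((φ.toFun z)⁻¹ : SL2) : M2) * φ.jac z c) = Matrix.vecMul c (φ.frameJac z) := by
  have hjac : φ.jac z c = ∑ a, c a • φ.jac z (Pi.single a 1) := by
    have hc : c = ∑ a, c a • (Pi.single a 1 : C3) := by
      ext i
      simp [Finset.sum_apply, Pi.single_apply]
    conv_lhs => rw [Param.jac, hc, map_sum]
    ext i j
    simp [Param.jac, Finset.sum_apply, Matrix.sum_apply]
  ext k
  rw [hjac, Finset.mul_sum, Matrix.vecMul, dotProduct]
  simp only [Param.frameJac, Matrix.of_apply, Fin.sum_univ_three, Matrix.mul_smul]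
  fin_cases k <;> simp [frameCoord]

theorem Param.frameJac_det_ne_zero (φ : Param) {z : C3} (hz : z ∈ φ.U) :
    (φ.frameJac z).det ≠ 0 := by
  intro hdet
  obtain ⟨c, hc, hker⟩ := Matrix.exists_vecMul_eq_zero_iff.2 hdet
  rw [← φ.frameCoord_jac] at hker
  have hjac : φ.jac z c = 0 := by
    calc φ.jac z c = (φ.toFun z : M2) * ((((φ.toFun z)⁻¹ : SL2) : M2) * φ.jac z c) := by
          rw [← Matrix.mul_assoc, SL2.mul_inv_self, Matrix.one_mul]
      _ = 0 := by
          rw [eq_sum_frame (mem_tangentSpace.1 (φ.jac_mem z c)), hker]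
          simp
  exact hc (φ.immersion z hz ((Matrix.of.injective hjac).trans (map_zero _).symm))

theorem Param.differentiableOn_frameJac (φ : Param) (a k : Fin 3) :
    DifferentiableOn ℂ (fun z => φ.frameJac z a k) φ.U := by
  have hinv : ∀ i j, DifferentiableOn ℂ (fun z => (((φ.toFun z)⁻¹ : SL2) : M2) i j) φ.U := by
    intro i j
    simp only [Matrix.SpecialLinearGroup.coe_inv, Matrix.adjugate_fin_two]
    fin_cases i <;> fin_cases j
    exacts [φ.differentiableOn_entry 1 1, (φ.differentiableOn_entry 0 1).neg,
      (φ.differentiableOn_entry 1 0).neg, φ.differentiableOn_entry 0 0]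
  have hmul : ∀ i j, DifferentiableOn ℂ
      (fun z => ((((φ.toFun z)⁻¹ : SL2) : M2) * φ.jac z (Pi.single a 1)) i j) φ.U := by
    intro i j
    simp only [Matrix.mul_apply]
    exact DifferentiableOn.fun_sum fun l _ => (hinv i l).mul (φ.differentiableOn_jac _ l j)
  simp only [Param.frameJac, Matrix.of_apply]
  fin_cases k
  exacts [hmul 0 0, hmul 0 1, hmul 1 0]

theorem Param.differentiableOn_frameJac_det (φ : Param) :
    DifferentiableOn ℂ (fun z => (φ.frameJac z).det) φ.U := by
  simp only [Matrix.det_fin_three]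
  have := φ.differentiableOn_frameJac
  fun_prop

theorem RiemMetric.isRicciFlat_of_gramDet (hg : g.IsHermitian) {κ : ℝ} (hκ : κ ≠ 0)
    (h : ∀ u, (g.gram u).det = (κ : ℂ)) : g.IsRicciFlat := by
  intro φ z hz a b
  have hlog : (fun x => Real.log (g.hermMatrix φ x).det.re) =
      fun x => Real.log (κ * Complex.normSq (φ.frameJac x).det) := by
    ext1 x
    rw [hg.det_hermMatrix, h, ← Complex.ofReal_mul, Complex.ofReal_re, mul_comm]
  rw [hlog]
  exact complexHessian_log_normSq φ.isOpen φ.differentiableOn_frameJac_det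
    (fun x hx => φ.frameJac_det_ne_zero hx) hκ hz a b

theorem stenzel_upperCoeff (t : ℝ) : stenzel.upperCoeff t = profile (Real.cosh t) := by
  rw [RiemMetric.upperCoeff, stenzel_form (upperVec_mem t) (upperVec_mem t), stenzelForm_self,
    tau_diagSL]
  simp [frobSq, pair_eq_sum, upperVec, diagSL]

theorem stenzel_lowerCoeff (t : ℝ) : stenzel.lowerCoeff t = profile (Real.cosh t) := by
  rw [RiemMetric.lowerCoeff, stenzel_form (lowerVec_mem t) (lowerVec_mem t), stenzelForm_self,
    tau_diagSL]
  simp [frobSq, pair_eq_sum, lowerVec, diagSL]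

theorem stenzel_radialCoeff (t : ℝ) : stenzel.radialCoeff t * Real.exp t =
    2 * (profile (Real.cosh t) * Real.cosh t +
      deriv profile (Real.cosh t) * (Real.cosh t ^ 2 - 1)) := by
  have hnorm : frobSq (radialVec t) = 1 + Real.exp (-t) * Real.exp (-t) := by
    simp [frobSq, radialVec, -Complex.ofReal_exp, Complex.normSq_ofReal]
  have hpair : pair (radialVec t) (diagSL t) =
      ((Real.exp (t / 2) - Real.exp (-t) * Real.exp (-(t / 2)) : ℝ) : ℂ) := by
    simp [pair_eq_sum, radialVec, diagSL, -Complex.ofReal_exp, Complex.conj_ofReal]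
    ring
  have hexp : Real.exp t = Real.exp (t / 2) ^ 2 := by rw [sq, ← Real.exp_add, add_halves]
  have hexp' : Real.exp (-t) = Real.exp (-(t / 2)) ^ 2 := by rw [sq, ← Real.exp_add]; ring_nf
  have hinv : Real.exp (t / 2) * Real.exp (-(t / 2)) = 1 := by
    rw [← Real.exp_add, add_neg_cancel, Real.exp_zero]
  rw [RiemMetric.radialCoeff, stenzel_form (radialVec_mem t) (radialVec_mem t), stenzelForm_self,
    tau_diagSL, hnorm, hpair, Complex.normSq_ofReal]
  generalize profile (Real.cosh t) = p, deriv profile (Real.cosh t) = d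
  rw [Real.cosh_eq, hexp, hexp']
  generalize Real.exp (t / 2) = x, Real.exp (-(t / 2)) = y at *
  linear_combination (p * y ^ 2 * (x * y + 1) + d * (y ^ 4 * (x * y + 1) / 2 -
    (x ^ 2 * y ^ 2 + x * y + 1) - (x * y + 1))) * hinv

theorem stenzel_gramDet (u : SL2) : (stenzel.gram u).det = ((1 / 3 : ℝ) : ℂ) := by
  obtain ⟨k, hk, l, hl, t, -, rfl⟩ := exists_kak u
  rw [stenzel.gramDet_translate stenzel_isHermitian stenzel_isInvariant hk hl,
    stenzel.gramDet_diagSL stenzel_isHermitian stenzel_isInvariant, RiemMetric.volumeDensity,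
    stenzel_radialCoeff, stenzel_upperCoeff, stenzel_lowerCoeff]
  congr 1
  linear_combination profile_ode (neg_one_lt_cosh t) / 4

theorem stenzel_isRicciFlat : stenzel.IsRicciFlat :=
  stenzel.isRicciFlat_of_gramDet stenzel_isHermitian (by norm_num) stenzel_gramDet

/-! ### Completeness -/

theorem hasDerivAt_velocity {γ : ℝ → SL2} (hγ : ContDiff ℝ 1 (fun t => entries (γ t))) (t : ℝ)
    (i j : Fin 2) : HasDerivAt (fun s => (γ s : M2) i j) ((velocity γ t : M2) i j) t :=
  hasDerivAt_pi.1 (hasDerivAt_pi.1 (hγ.differentiable one_ne_zero t).hasDerivAt i) j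

theorem norm_le_sqrt_frobSq {m n : Type*} [Fintype m] [Fintype n] (A : m → n → ℂ) :
    ‖A‖ ≤ √(frobSq (Matrix.of A)) := by
  refine (pi_norm_le_iff_of_nonneg (Real.sqrt_nonneg _)).2 fun i =>
    (pi_norm_le_iff_of_nonneg (Real.sqrt_nonneg _)).2 fun j => Real.le_sqrt_of_sq_le ?_
  rw [← Complex.normSq_eq_norm_sq]
  exact normSq_apply_le_frobSq (Matrix.of A) i j

theorem sqrt_frobSq_le_norm (A : Fin 2 → Fin 2 → ℂ) : √(frobSq (Matrix.of A)) ≤ 2 * ‖A‖ := by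
  have hentry : ∀ i j, Complex.normSq (A i j) ≤ ‖A‖ ^ 2 := fun i j => by
    rw [Complex.normSq_eq_norm_sq]
    exact pow_le_pow_left₀ (norm_nonneg _) ((norm_le_pi_norm (A i) j).trans (norm_le_pi_norm A i)) 2
  refine Real.sqrt_le_iff.2 ⟨by positivity, ?_⟩
  simp only [frobSq, Fin.sum_univ_two, Matrix.of_apply]
  linarith [hentry 0 0, hentry 0 1, hentry 1 0, hentry 1 1]

/-- The speed of a curve. -/
def RiemMetric.speed (g : RiemMetric) (γ : ℝ → SL2) (t : ℝ) : ℝ :=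
  √(g.inner (γ t) (velocity γ t) (velocity γ t))

theorem RiemMetric.length_eq_lintegral_speed (γ : ℝ → SL2) :
    g.length γ = ∫⁻ t in Set.Icc (0 : ℝ) 1, ENNReal.ofReal (g.speed γ t) := rfl

theorem RiemMetric.enorm_sub_le_length {E : Type*} [NormedAddCommGroup E] [NormedSpace ℝ E]
    {γ : ℝ → SL2} {f : ℝ → E} (hf : ContDiff ℝ 1 f) {C : ℝ} (hC : 0 ≤ C)
    (h : ∀ t ∈ Set.Icc (0 : ℝ) 1, ‖deriv f t‖ ≤ C * g.speed γ t) {s : ℝ}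
    (hs : s ∈ Set.Icc (0 : ℝ) 1) :
    ‖f s - f 0‖ₑ ≤ ENNReal.ofReal C * g.length γ := by
  have hsub : Set.Icc 0 s ⊆ Set.Icc (0 : ℝ) 1 := Set.Icc_subset_Icc_right hs.2
  calc ‖f s - f 0‖ₑ ≤ ∫⁻ t in Set.Icc 0 s, ‖deriv f t‖ₑ :=
        enorm_sub_le_lintegral_deriv_of_contDiffOn_Icc hf.contDiffOn hs.1
    _ ≤ ∫⁻ t in Set.Icc 0 s, ENNReal.ofReal C * ENNReal.ofReal (g.speed γ t) := by
        refine MeasureTheory.setLIntegral_mono_ae' measurableSet_Icc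
          (Filter.Eventually.of_forall fun t ht => ?_)
        rw [← ENNReal.ofReal_mul hC, ← ofReal_norm]
        exact ENNReal.ofReal_le_ofReal (h t (hsub ht))
    _ ≤ ∫⁻ t in Set.Icc 0 1, ENNReal.ofReal C * ENNReal.ofReal (g.speed γ t) :=
        MeasureTheory.lintegral_mono_set hsub
    _ = ENNReal.ofReal C * g.length γ := by
        rw [length_eq_lintegral_speed, MeasureTheory.lintegral_const_mul' _ _ ENNReal.ofReal_ne_top]

theorem RiemMetric.edist_lt_iff {u v : SL2} {ε : ℝ≥0∞} :
    g.edist u v < ε ↔ ∃ γ : ℝ → SL2, ContDiff ℝ 1 (fun t => entries (γ t)) ∧ γ 0 = u ∧ γ 1 = v ∧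
      g.length γ < ε := by
  simp only [edist, iInf_lt_iff, exists_prop]

theorem RiemMetric.edist_le_of_speed_le {γ : ℝ → SL2}
    (hγ : ContDiff ℝ 1 (fun t => entries (γ t))) {C : ℝ} (h : ∀ t, g.speed γ t ≤ C) :
    g.edist (γ 0) (γ 1) ≤ ENNReal.ofReal C :=
  calc g.edist (γ 0) (γ 1) ≤ g.length γ :=
        iInf_le_of_le γ (iInf_le_of_le hγ (iInf_le_of_le rfl (iInf_le _ rfl)))
    _ ≤ ∫⁻ _ in Set.Icc (0 : ℝ) 1, ENNReal.ofReal C :=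
        MeasureTheory.lintegral_mono fun t => ENNReal.ofReal_le_ofReal (h t)
    _ = ENNReal.ofReal C := by simp

theorem contDiff_tau {γ : ℝ → SL2} (hγ : ContDiff ℝ 1 (fun t => entries (γ t))) :
    ContDiff ℝ 1 (fun t => tau (γ t)) := by
  have hentry : ∀ i j, ContDiffOn ℝ 1 (fun t => (γ t : M2) i j) Set.univ := fun i j =>
    (contDiff_pi.1 (contDiff_pi.1 hγ i) j).contDiffOn
  simp only [tau_eq_pair, ← contDiffOn_univ]
  exact (contDiffOn_re (contDiffOn_pair hentry hentry)).div_const 2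

theorem abs_re_pair_le_sqrt_stenzelForm {u : SL2} {X : M2} (hX : X ∈ tangentSpace u) :
    |(pair X u).re| ≤ 2 * (tau u + 1) * √(stenzelForm u X X) := by
  have htau := one_le_tau u
  have hS := stenzelForm_self_nonneg hX
  refine abs_le_of_sq_le_sq ?_ (by positivity)
  calc (pair X u).re ^ 2 ≤ Complex.normSq (pair X u) := by
        rw [sq]
        exact Complex.re_sq_le_normSq _
    _ ≤ 2 * (tau u + 1) ^ 2 * stenzelForm u X X := normSq_pair_le_stenzelForm hX
    _ ≤ 4 * (tau u + 1) ^ 2 * stenzelForm u X X := by gcongr; norm_num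
    _ = (2 * (tau u + 1) * √(stenzelForm u X X)) ^ 2 := by rw [mul_pow, Real.sq_sqrt hS]; ring

-- The function `log (tau + 1)` is proper and `2`-Lipschitz, so balls of finite radius are bounded.
theorem tau_add_one_le_of_length_lt_one {γ : ℝ → SL2}
    (hγ : ContDiff ℝ 1 (fun t => entries (γ t))) (hl : stenzel.length γ < 1) {s : ℝ}
    (hs : s ∈ Set.Icc (0 : ℝ) 1) : tau (γ s) + 1 ≤ Real.exp 2 * (tau (γ 0) + 1) := by
  have hpos : ∀ t, 0 < tau (γ t) + 1 := fun t => by linarith [one_le_tau (γ t)]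
  have hsmooth : ContDiff ℝ 1 (fun t => Real.log (tau (γ t) + 1)) :=
    ((contDiff_tau hγ).add contDiff_const).log fun t => (hpos t).ne'
  have hderiv : ∀ t, ‖deriv (fun t => Real.log (tau (γ t) + 1)) t‖ ≤ 2 * stenzel.speed γ t := by
    intro t
    rw [(((hasDerivAt_tau (hasDerivAt_velocity hγ t)).add_const 1).log (hpos t).ne').deriv,
      Real.norm_eq_abs, abs_div, abs_of_pos (hpos t), div_le_iff₀ (hpos t)]
    refine (abs_re_pair_le_sqrt_stenzelForm (velocity γ t).2).trans_eq ?_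
    rw [RiemMetric.speed, stenzel_inner]
    ring
  have hlog : Real.log (tau (γ s) + 1) - Real.log (tau (γ 0) + 1) ≤ 2 := by
    refine (Real.le_norm_self _).trans ((ENNReal.ofReal_le_ofReal_iff zero_le_two).1 ?_)
    rw [ofReal_norm]
    exact (stenzel.enorm_sub_le_length hsmooth zero_le_two (fun t _ => hderiv t) hs).trans
      (mul_le_of_le_one_right' hl.le)
  rw [← Real.log_div (hpos s).ne' (hpos 0).ne', Real.log_le_iff_le_exp (div_pos (hpos s) (hpos 0)),
    div_le_iff₀ (hpos 0)] at hlog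
  exact hlog

theorem exists_sqrt_frobSq_le_sqrt_stenzelForm (R : ℝ) :
    ∃ C > 0, ∀ (u : SL2) (X : M2), X ∈ tangentSpace u → tau u ≤ R →
      √(frobSq X) ≤ C * √(stenzelForm u X X) := by
  have hcont : ContinuousOn (fun x => min (profile x) x⁻¹) (Set.Icc 1 R) :=
    (contDiffOn_profile.continuousOn.mono fun x hx => neg_one_lt_zero.trans_le
      (zero_le_one.trans hx.1)).inf
      (continuousOn_id.inv₀ fun x hx => (zero_lt_one.trans_le hx.1).ne')
  obtain ⟨c, hc, hmin⟩ := isCompact_Icc.exists_forall_le' hcont (a := 0) fun x hx =>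
    lt_min (profile_pos (by linarith [hx.1])) (inv_pos.2 (by linarith [hx.1]))
  refine ⟨(√c)⁻¹, inv_pos.2 (Real.sqrt_pos.2 hc), fun u X hX hu => ?_⟩
  rw [le_inv_mul_iff₀ (Real.sqrt_pos.2 hc), ← Real.sqrt_mul hc.le]
  exact Real.sqrt_le_sqrt <| (mul_le_mul_of_nonneg_right (hmin _ ⟨one_le_tau u, hu⟩)
    (frobSq_nonneg X)).trans (min_mul_frobSq_le_stenzelForm hX)

theorem stenzelForm_self_le (u : SL2) (X : M2) :
    stenzelForm u X X ≤ (|profile (tau u)| + |deriv profile (tau u)| * tau u) * frobSq X := by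
  have hcs := normSq_pair_le X u
  rw [frobSq_coe] at hcs
  have hN := frobSq_nonneg X
  have hZ := Complex.normSq_nonneg (pair X u)
  calc stenzelForm u X X
      = profile (tau u) * frobSq X + deriv profile (tau u) / 2 * Complex.normSq (pair X u) :=
        stenzelForm_self u X
    _ ≤ |profile (tau u)| * frobSq X + |deriv profile (tau u)| / 2 * (frobSq X * (2 * tau u)) := by
        gcongr <;> exact le_abs_self _
    _ = (|profile (tau u)| + |deriv profile (tau u)| * tau u) * frobSq X := by ring

theorem exists_sqrt_stenzelForm_le_sqrt_frobSq (R : ℝ) :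
    ∃ C > 0, ∀ (u : SL2) (X : M2), tau u ≤ R → √(stenzelForm u X X) ≤ C * √(frobSq X) := by
  have hsub : Set.Icc 1 R ⊆ Set.Ioi (-1) := fun x hx =>
    neg_one_lt_zero.trans_le (zero_le_one.trans hx.1)
  have hcont : ContinuousOn (fun x => |profile x| + |deriv profile x| * x) (Set.Icc 1 R) :=
    (contDiffOn_profile.continuousOn.mono hsub).abs.add
      ((contDiffOn_deriv_profile.continuousOn.mono hsub).abs.mul continuousOn_id)
  obtain ⟨C, hC⟩ := isCompact_Icc.exists_bound_of_continuousOn hcont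
  refine ⟨√(max C 1), by positivity, fun u X hu => ?_⟩
  rw [← Real.sqrt_mul (by positivity)]
  exact Real.sqrt_le_sqrt <| (stenzelForm_self_le u X).trans <| mul_le_mul_of_nonneg_right
    (((Real.le_norm_self _).trans (hC _ ⟨one_le_tau u, hu⟩)).trans (le_max_left _ _))
    (frobSq_nonneg X)

theorem exists_enorm_entries_sub_le_edist (R : ℝ) :
    ∃ C > 0, ∀ u v : SL2, tau u ≤ R → stenzel.edist u v < 1 →
      ‖entries v - entries u‖ₑ ≤ ENNReal.ofReal C * stenzel.edist u v := by
  obtain ⟨C, hC, hbound⟩ := exists_sqrt_frobSq_le_sqrt_stenzelForm (Real.exp 2 * (R + 1))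
  refine ⟨C, hC, fun u v hu huv => ?_⟩
  have hC0 : ENNReal.ofReal C ≠ 0 := by simpa using hC
  rw [mul_comm, ← ENNReal.div_le_iff hC0 ENNReal.ofReal_ne_top]
  refine le_of_forall_gt fun ε hε => ?_
  obtain ⟨γ, hγ, rfl, rfl, hl⟩ := RiemMetric.edist_lt_iff.1 (lt_min hε huv)
  refine lt_of_le_of_lt ?_ (hl.trans_le (min_le_left _ _))
  rw [ENNReal.div_le_iff hC0 ENNReal.ofReal_ne_top, mul_comm]
  refine stenzel.enorm_sub_le_length hγ hC.le (fun t ht => ?_) ⟨zero_le_one, le_rfl⟩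
  have htau : tau (γ t) ≤ Real.exp 2 * (R + 1) :=
    calc tau (γ t) ≤ tau (γ t) + 1 := by linarith
      _ ≤ Real.exp 2 * (tau (γ 0) + 1) :=
        tau_add_one_le_of_length_lt_one hγ (hl.trans_le (min_le_right _ _)) ht
      _ ≤ Real.exp 2 * (R + 1) := by gcongr
  exact (norm_le_sqrt_frobSq _).trans (hbound (γ t) _ (velocity γ t).2 htau)

/-- The holomorphic retraction of `GL(2, ℂ)` onto `SL(2, ℂ)` which divides the first row by the
determinant. It carries short segments of matrices to short curves in `SL(2, ℂ)`. -/
def detNormalize (A : Fin 2 → Fin 2 → ℂ) : Fin 2 → Fin 2 → ℂ :=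
  ![(Matrix.of A).det⁻¹ • A 0, A 1]

theorem det_detNormalize {A : Fin 2 → Fin 2 → ℂ} (h : (Matrix.of A).det ≠ 0) :
    (Matrix.of (detNormalize A)).det = 1 := by
  rw [Matrix.det_fin_two] at h ⊢
  simp only [detNormalize, Matrix.det_fin_two, Matrix.of_apply, Matrix.cons_val_zero,
    Matrix.cons_val_one, Pi.smul_apply, smul_eq_mul] at h ⊢
  field_simp

theorem detNormalize_entries (u : SL2) : detNormalize (entries u) = entries u := by
  have hdet : (Matrix.of (entries u)).det = 1 := u.det_coe
  ext i j
  fin_cases i <;> simp [detNormalize, hdet]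

theorem contDiff_det : ContDiff ℝ ∞ fun A : Fin 2 → Fin 2 → ℂ => (Matrix.of A).det := by
  simp only [Matrix.det_fin_two, Matrix.of_apply]
  fun_prop

theorem contDiffAt_detNormalize {A : Fin 2 → Fin 2 → ℂ} (h : (Matrix.of A).det ≠ 0) :
    ContDiffAt ℝ ∞ detNormalize A := by
  refine contDiffAt_pi.2 fun i => ?_
  fin_cases i
  · exact (contDiff_det.contDiffAt.inv h).smul (contDiff_apply ℝ (Fin 2 → ℂ) 0).contDiffAt
  · exact (contDiff_apply ℝ (Fin 2 → ℂ) 1).contDiffAt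

theorem exists_ball_detNormalize (y : SL2) : ∃ (K : NNReal) (r : ℝ), 0 < r ∧
    LipschitzOnWith K detNormalize (Metric.ball (entries y) r) ∧
    ∀ A ∈ Metric.ball (entries y) r, (Matrix.of A).det ≠ 0 ∧
      frobSq (Matrix.of (detNormalize A)) < 2 * (tau y + 1) := by
  have hdet : (Matrix.of (entries y)).det ≠ 0 := by
    rw [show (Matrix.of (entries y)).det = 1 from y.det_coe]
    exact one_ne_zero
  have hsmooth := contDiffAt_detNormalize hdet
  obtain ⟨K, t, ht, hK⟩ := (hsmooth.of_le (m := 1)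
    (by exact_mod_cast le_top)).exists_lipschitzOnWith
  have hfrob : Continuous fun A : Fin 2 → Fin 2 → ℂ => frobSq (Matrix.of A) := by
    simp only [frobSq, Matrix.of_apply]
    fun_prop
  have hlt : frobSq (Matrix.of (detNormalize (entries y))) < 2 * (tau y + 1) := by
    rw [detNormalize_entries, show frobSq (Matrix.of (entries y)) = 2 * tau y from frobSq_coe y]
    linarith
  obtain ⟨r, hr, hball⟩ := Metric.mem_nhds_iff.1 <| Filter.inter_mem ht <|
    (contDiff_det.continuous.continuousAt.eventually_ne hdet).and <|
      (hfrob.continuousAt.comp hsmooth.continuousAt).eventually_lt_const hlt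
  exact ⟨K, r, hr, hK.mono fun A hA => (hball hA).1, fun A hA => (hball hA).2⟩

-- Competitors for the distance are `C¹` on all of `ℝ`, so the parameter of a segment has to be
-- confined to `[0, 1]` smoothly.
theorem exists_contDiff_lipschitzWith_step : ∃ σ : ℝ → ℝ,
    ContDiff ℝ ∞ σ ∧ LipschitzWith 2 σ ∧ σ 0 = 0 ∧ σ 1 = 1 ∧ ∀ t, σ t ∈ Set.Icc 0 1 := by
  refine ⟨fun t => (1 - Real.cos (Real.pi * t)) / 2, by fun_prop,
    lipschitzWith_of_nnnorm_deriv_le (by fun_prop) fun t => ?_, by simp, by simp,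
    fun t => ⟨by linarith [Real.cos_le_one (Real.pi * t)],
      by linarith [Real.neg_one_le_cos (Real.pi * t)]⟩⟩
  have hderiv : HasDerivAt (fun t => (1 - Real.cos (Real.pi * t)) / 2)
      (Real.sin (Real.pi * t) * Real.pi / 2) t := by
    convert! ((((hasDerivAt_id t).const_mul Real.pi).cos).const_sub 1).div_const 2 using 1
    simp
  rw [hderiv.deriv, ← NNReal.coe_le_coe, coe_nnnorm, Real.norm_eq_abs, abs_div, abs_mul,
    abs_of_pos Real.pi_pos, abs_two, NNReal.coe_ofNat, div_le_iff₀ zero_lt_two]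
  calc |Real.sin (Real.pi * t)| * Real.pi ≤ 1 * 4 := by
        gcongr
        · exact Real.abs_sin_le_one _
        · exact Real.pi_le_four
    _ = 2 * 2 := by norm_num

theorem exists_short_curve (y : SL2) : ∃ (C r : ℝ), 0 < r ∧
    ∀ u : SL2, dist (entries u) (entries y) < r → ∃ γ : ℝ → SL2,
      ContDiff ℝ 1 (fun t => entries (γ t)) ∧ γ 0 = u ∧ γ 1 = y ∧
      ∀ t, tau (γ t) ≤ tau y + 1 ∧
        ‖deriv (fun t => entries (γ t)) t‖ ≤ C * dist (entries u) (entries y) := by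
  obtain ⟨K, r, hr, hK, hball⟩ := exists_ball_detNormalize y
  obtain ⟨σ, hσ, hσLip, hσ0, hσ1, hσmem⟩ := exists_contDiff_lipschitzWith_step
  refine ⟨K * 2, r, hr, fun u hu => ?_⟩
  set A : ℝ → Fin 2 → Fin 2 → ℂ := fun t => AffineMap.lineMap (entries u) (entries y) (σ t) with hA
  have hmem : ∀ t, A t ∈ Metric.ball (entries y) r := fun t =>
    (convex_ball _ _).lineMap_mem (Metric.mem_ball.2 hu) (Metric.mem_ball_self hr) (hσmem t)
  have hALip : LipschitzWith (nndist (entries u) (entries y) * 2) A :=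
    (lipschitzWith_lineMap (entries u) (entries y)).comp hσLip
  have hNLip : LipschitzWith (K * (nndist (entries u) (entries y) * 2)) (detNormalize ∘ A) :=
    lipschitzOnWith_univ.1 (hK.comp hALip.lipschitzOnWith fun t _ => hmem t)
  have hAsmooth : ContDiff ℝ ∞ A := by
    simp only [hA, AffineMap.lineMap_apply_module']
    fun_prop
  have hNsmooth : ContDiff ℝ ∞ (detNormalize ∘ A) := contDiff_iff_contDiffAt.2 fun t =>
    (contDiffAt_detNormalize (hball _ (hmem t)).1).comp t hAsmooth.contDiffAt
  refine ⟨fun t => ⟨Matrix.of (detNormalize (A t)), det_detNormalize (hball _ (hmem t)).1⟩,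
    hNsmooth.of_le (by exact_mod_cast le_top), Subtype.ext ?_, Subtype.ext ?_, fun t => ⟨?_, ?_⟩⟩
  · simp only [hA, hσ0, AffineMap.lineMap_apply_zero, detNormalize_entries]
    rfl
  · simp only [hA, hσ1, AffineMap.lineMap_apply_one, detNormalize_entries]
    rfl
  · exact le_of_mul_le_mul_left ((frobSq_coe _).symm.trans_le (hball _ (hmem t)).2.le) zero_lt_two
  · refine (norm_deriv_le_of_lipschitz hNLip).trans_eq ?_
    push_cast
    ring

theorem tendsto_edist_of_tendsto_entries {x : ℕ → SL2} {y : SL2}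
    (h : Filter.Tendsto (fun n => entries (x n)) Filter.atTop (𝓝 (entries y))) :
    Filter.Tendsto (fun n => stenzel.edist (x n) y) Filter.atTop (𝓝 0) := by
  obtain ⟨C, r, hr, hcurve⟩ := exists_short_curve y
  obtain ⟨M, hM, hbound⟩ := exists_sqrt_stenzelForm_le_sqrt_frobSq (tau y + 1)
  have hdist := tendsto_iff_dist_tendsto_zero.1 h
  have hle : ∀ᶠ n in Filter.atTop, stenzel.edist (x n) y ≤
      ENNReal.ofReal (M * (2 * (C * dist (entries (x n)) (entries y)))) := by
    filter_upwards [hdist.eventually_lt_const hr] with n hn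
    obtain ⟨γ, hγ, h0, h1, hγC⟩ := hcurve (x n) hn
    rw [← h0, ← h1]
    refine stenzel.edist_le_of_speed_le hγ fun t => ?_
    refine (hbound (γ t) _ (hγC t).1).trans ?_
    gcongr
    rw [h0, h1]
    exact (sqrt_frobSq_le_norm _).trans (mul_le_mul_of_nonneg_left (hγC t).2 zero_le_two)
  refine tendsto_of_tendsto_of_tendsto_of_le_of_le' tendsto_const_nhds ?_
    (Filter.Eventually.of_forall fun _ => zero_le) hle
  simpa using ENNReal.tendsto_ofReal (((hdist.const_mul C).const_mul 2).const_mul M)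

theorem isClosed_range_entries : IsClosed (Set.range entries) := by
  have hrange : Set.range entries = {A | (Matrix.of A).det = 1} :=
    Set.ext fun A => ⟨by rintro ⟨u, rfl⟩; exact u.det_coe, fun hA => ⟨⟨Matrix.of A, hA⟩, rfl⟩⟩
  rw [hrange]
  exact isClosed_eq contDiff_det.continuous continuous_const

theorem stenzel_isComplete : stenzel.IsComplete := by
  intro x hx
  obtain ⟨N, hN⟩ := hx 1 one_pos
  have hbound : ∀ m ≥ N, tau (x m) ≤ Real.exp 2 * (tau (x N) + 1) := by
    intro m hm
    obtain ⟨γ, hγ, h0, h1, hl⟩ := RiemMetric.edist_lt_iff.1 (hN N le_rfl m hm)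
    rw [← h0, ← h1]
    linarith [tau_add_one_le_of_length_lt_one hγ hl ⟨zero_le_one, le_rfl⟩]
  obtain ⟨C, hC, hCdist⟩ := exists_enorm_entries_sub_le_edist (Real.exp 2 * (tau (x N) + 1))
  have hC0 : ENNReal.ofReal C ≠ 0 := by simpa using hC
  have hcauchy : CauchySeq fun n => entries (x n) := by
    refine EMetric.cauchySeq_iff.2 fun ε hε => ?_
    obtain ⟨N', hN'⟩ := hx (ε / ENNReal.ofReal C) (ENNReal.div_pos hε.ne' ENNReal.ofReal_ne_top)
    refine ⟨max N N', fun m hm n hn => ?_⟩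
    replace hm := max_le_iff.1 hm
    replace hn := max_le_iff.1 hn
    rw [edist_eq_enorm_sub]
    refine (hCdist _ _ (hbound n hn.1) (hN n hn.1 m hm.1)).trans_lt ?_
    rw [mul_comm]
    exact (ENNReal.lt_div_iff_mul_lt (.inl hC0) (.inl ENNReal.ofReal_ne_top)).1
      (hN' n hn.2 m hm.2)
  obtain ⟨Y, hY⟩ := cauchySeq_tendsto_of_complete hcauchy
  obtain ⟨y, rfl⟩ := isClosed_range_entries.mem_of_tendsto hY
    (Filter.Eventually.of_forall fun n => Set.mem_range_self (x n))
  exact ⟨y, tendsto_edist_of_tendsto_entries hY⟩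

/-! ### The chart of matrices with nonzero upper left entry -/

/-- The matrix of determinant one with three given entries. -/
def chartMat (z : C3) : M2 := !![z 0, z 1; z 2, (1 + z 1 * z 2) / z 0]

/-- The differential of `chartMat`. -/
def chartJac (z v : C3) : M2 :=
  !![v 0, v 1; v 2, ((v 1 * z 2 + z 1 * v 2) * z 0 - (1 + z 1 * z 2) * v 0) / z 0 ^ 2]

theorem chartMat_det {z : C3} (h : z 0 ≠ 0) : (chartMat z).det = 1 := by
  rw [chartMat, Matrix.det_fin_two_of, mul_div_cancel₀ _ h, add_sub_cancel_right]

open Classical in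
/-- `chartMat` with values in `SL(2, ℂ)`; its value `1` where `z 0 = 0` is a placeholder. -/
def chartFun (z : C3) : SL2 := if h : z 0 ≠ 0 then ⟨chartMat z, chartMat_det h⟩ else 1

theorem coe_chartFun {z : C3} (h : z 0 ≠ 0) : (chartFun z : M2) = chartMat z := by
  simp [chartFun, h]

theorem isOpen_chart : IsOpen {z : C3 | z 0 ≠ 0} :=
  isOpen_ne.preimage (continuous_apply 0)

theorem entries_chartFun_eventuallyEq {z : C3} (h : z 0 ≠ 0) :
    (fun z => entries (chartFun z)) =ᶠ[𝓝 z] fun z i j => chartMat z i j := by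
  filter_upwards [isOpen_chart.mem_nhds h] with x hx
  ext i j
  exact congrFun (congrFun (coe_chartFun hx) i) j

theorem differentiableAt_chartMat {z : C3} (h : z 0 ≠ 0) :
    DifferentiableAt ℂ (fun z i j => chartMat z i j) z := by
  refine differentiableAt_pi.2 fun i => differentiableAt_pi.2 fun j => ?_
  fin_cases i <;> fin_cases j
  · exact (differentiable_apply 0).differentiableAt
  · exact (differentiable_apply 1).differentiableAt
  · exact (differentiable_apply 2).differentiableAt
  · change DifferentiableAt ℂ (fun z : C3 => (1 + z 1 * z 2) / z 0) z
    fun_prop (disch := exact h)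

theorem fderiv_chartFun {z : C3} (h : z 0 ≠ 0) (v : C3) :
    Matrix.of (fderiv ℂ (fun z => entries (chartFun z)) z v) = chartJac z v := by
  rw [(entries_chartFun_eventuallyEq h).fderiv_eq]
  have hcoord : ∀ i, HasDerivAt (fun w : ℂ => (z + w • v) i) (v i) 0 := fun i => by
    simpa using ((hasDerivAt_id (0 : ℂ)).mul_const (v i)).const_add (z i)
  have h0 : (z + (0 : ℂ) • v) 0 ≠ 0 := by simpa using h
  ext i j
  refine (hasDerivAt_pi.1 (hasDerivAt_pi.1
    ((differentiableAt_chartMat h).hasFDerivAt.hasLineDerivAt v) i) j).unique ?_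
  fin_cases i <;> fin_cases j
  · exact hcoord 0
  · exact hcoord 1
  · exact hcoord 2
  · convert! (((hcoord 1).mul (hcoord 2)).const_add 1).div (hcoord 0) h0 using 1
    simp [chartJac]

/-- The chart of matrices with nonzero upper left entry. -/
def chart : Param where
  toFun := chartFun
  U := {z | z 0 ≠ 0}
  isOpen := isOpen_chart
  holomorphic _ hz := ((differentiableAt_chartMat hz).congr_of_eventuallyEq
    (entries_chartFun_eventuallyEq hz)).differentiableWithinAt
  injective := by
    intro z hz w hw h
    have hmat : chartMat z = chartMat w := by
      rw [← coe_chartFun hz, ← coe_chartFun hw, h]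
    ext i
    fin_cases i
    · exact congrFun (congrFun hmat 0) 0
    · exact congrFun (congrFun hmat 0) 1
    · exact congrFun (congrFun hmat 1) 0
  immersion := by
    refine fun z hz => (injective_iff_map_eq_zero _).2 fun v hv => ?_
    have hjac := fderiv_chartFun hz v
    rw [hv] at hjac
    ext i
    fin_cases i
    · exact (congrFun (congrFun hjac 0) 0).symm
    · exact (congrFun (congrFun hjac 0) 1).symm
    · exact (congrFun (congrFun hjac 1) 0).symm

theorem mem_chart {z : C3} : z ∈ chart.U ↔ z 0 ≠ 0 := Iff.rfl

theorem chart_toFun {z : C3} (h : z 0 ≠ 0) : (chart.toFun z : M2) = chartMat z := coe_chartFun h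

theorem chart_jac {z : C3} (h : z 0 ≠ 0) (v : C3) : chart.jac z v = chartJac z v :=
  fderiv_chartFun h v

/-- The coordinates of a matrix in `chart`. -/
def chartCoord (A : M2) : C3 := ![A 0 0, A 0 1, A 1 0]

theorem chart_chartCoord {u : SL2} (h : u 0 0 ≠ 0) : chart.toFun (chartCoord u) = u := by
  apply Subtype.ext
  rw [chart_toFun (by simpa [chartCoord] using h)]
  have hcorner : (1 + u 0 1 * u 1 0) / u 0 0 = u 1 1 := by
    rw [div_eq_iff h]
    linear_combination -SL2.det_eq u
  ext i j
  fin_cases i <;> fin_cases j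
  exacts [rfl, rfl, rfl, hcorner]

/-- The coordinates of `diagSL t`. -/
def diagCoord (t : ℝ) : C3 := ![(Real.exp (t / 2) : ℂ), 0, 0]

theorem diagCoord_mem (t : ℝ) : diagCoord t ∈ chart.U := by
  simp [mem_chart, diagCoord]

theorem chart_diagCoord (t : ℝ) : chart.toFun (diagCoord t) = diagSL t := by
  have h : diagCoord t = chartCoord (diagSL t) := by
    ext i
    fin_cases i <;> simp [diagCoord, chartCoord, diagSL]
  rw [h, chart_chartCoord]
  simp [diagSL]

theorem chart_jac_diagCoord (t : ℝ) (v : C3) :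
    chart.jac (diagCoord t) v = !![v 0, v 1; v 2, -(Real.exp (-t) : ℂ) * v 0] := by
  rw [chart_jac (diagCoord_mem t)]
  have hexp : (Real.exp (-t) : ℂ) = ((Real.exp (t / 2) : ℂ) ^ 2)⁻¹ := by
    rw [← Complex.ofReal_pow, ← Real.exp_nat_mul, ← Complex.ofReal_inv, ← Real.exp_neg]
    push_cast
    ring_nf
  ext i j
  fin_cases i <;> fin_cases j <;> simp [chartJac, diagCoord, -Complex.ofReal_exp, hexp]
  ring

theorem contDiff_diagCoord : ContDiff ℝ ∞ diagCoord := by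
  have hexp : ContDiff ℝ ∞ fun t : ℝ => Real.exp (t / 2) := by fun_prop
  refine contDiff_pi.2 fun i => ?_
  fin_cases i
  · exact Complex.ofRealCLM.contDiff.comp hexp
  · exact contDiff_const
  · exact contDiff_const

theorem RiemMetric.contDiff_form_chart_jac (v w : C3) :
    ContDiff ℝ ∞ fun t => g.form (diagSL t) (chart.jac (diagCoord t) v)
      (chart.jac (diagCoord t) w) := by
  have h := (g.smooth chart v w).comp_contDiff contDiff_diagCoord diagCoord_mem
  simp only [g.inner_eq_form, Param.coe_push, Function.comp_def, chart_diagCoord] at h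
  exact h

theorem chart_jac_diagCoord_radial (t : ℝ) :
    chart.jac (diagCoord t) ![1, 0, 0] = radialVec t := by
  simp [chart_jac_diagCoord, radialVec]

theorem chart_jac_diagCoord_upper (t : ℝ) :
    chart.jac (diagCoord t) ![0, 1, 0] = upperVec := by
  simp [chart_jac_diagCoord, upperVec]

theorem chart_jac_diagCoord_lower (t : ℝ) :
    chart.jac (diagCoord t) ![0, 0, 1] = lowerVec := by
  simp [chart_jac_diagCoord, lowerVec]

theorem RiemMetric.contDiff_radialCoeff (g : RiemMetric) : ContDiff ℝ ∞ g.radialCoeff := by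
  have h := g.contDiff_form_chart_jac ![1, 0, 0] ![1, 0, 0]
  simp only [chart_jac_diagCoord_radial] at h
  exact h

theorem RiemMetric.contDiff_upperCoeff (g : RiemMetric) : ContDiff ℝ ∞ g.upperCoeff := by
  have h := g.contDiff_form_chart_jac ![0, 1, 0] ![0, 1, 0]
  simp only [chart_jac_diagCoord_upper] at h
  exact h

theorem RiemMetric.contDiff_lowerCoeff (g : RiemMetric) : ContDiff ℝ ∞ g.lowerCoeff := by
  have h := g.contDiff_form_chart_jac ![0, 0, 1] ![0, 0, 1]
  simp only [chart_jac_diagCoord_lower] at h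
  exact h

/-! ### The fundamental form along orbits -/

/-- The fundamental form of an invariant metric on pairs of tangent vectors at `diagSL t`. -/
def RiemMetric.diagOmega (g : RiemMetric) (t : ℝ) (A B : M2) : ℝ :=
  -(g.radialCoeff t * (A 0 0 * (starRingEnd ℂ) (B 0 0)).im +
    g.upperCoeff t * (A 0 1 * (starRingEnd ℂ) (B 0 1)).im +
    g.lowerCoeff t * (A 1 0 * (starRingEnd ℂ) (B 1 0)).im)

theorem RiemMetric.omegaCoord_eq_form (φ : Param) (v w z : C3) :
    g.omegaCoord φ v w z = g.form (φ.toFun z) (Complex.I • φ.jac z v) (φ.jac z w) := by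
  rw [RiemMetric.omegaCoord, RiemMetric.omega, g.inner_eq_form]
  rfl

theorem RiemMetric.differentiableAt_omegaCoord (g : RiemMetric) (φ : Param) (v w : C3) {z : C3}
    (hz : z ∈ φ.U) : DifferentiableAt ℝ (g.omegaCoord φ v w) z := by
  have h := ((g.smooth φ (Complex.I • v) w).contDiffAt (φ.isOpen.mem_nhds hz)).differentiableAt
    (by simp)
  simp only [φ.push_smul] at h
  exact h

theorem translate_inv_mem {k l u : SL2} {A : M2} (hA : A ∈ tangentSpace (k * u * l⁻¹)) :
    ((k⁻¹ : SL2) : M2) * A * (l : M2) ∈ tangentSpace u := by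
  have h := mem_tangentSpace.1 hA
  rw [show (k * u * l⁻¹)⁻¹ = l * u⁻¹ * k⁻¹ by group, Matrix.SpecialLinearGroup.coe_mul,
    Matrix.SpecialLinearGroup.coe_mul, Matrix.mul_assoc, Matrix.mul_assoc,
    Matrix.trace_mul_comm] at h
  rw [mem_tangentSpace, ← h]
  simp only [Matrix.mul_assoc]

theorem translate_inv_cancel (k l : SL2) (A : M2) :
    (k : M2) * (((k⁻¹ : SL2) : M2) * A * (l : M2)) * ((l⁻¹ : SL2) : M2) = A := by
  simp only [Matrix.mul_assoc, SL2.mul_inv_self, Matrix.mul_one]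
  rw [← Matrix.mul_assoc, SL2.mul_inv_self, Matrix.one_mul]

theorem RiemMetric.IsInvariant.form_translate_inv (hi : g.IsInvariant) {k l : SL2} (hk : k ∈ SU2)
    (hl : l ∈ SU2) (u : SL2) (A B : M2) :
    g.form (k * u * l⁻¹) A B =
      g.form u (((k⁻¹ : SL2) : M2) * A * (l : M2)) (((k⁻¹ : SL2) : M2) * B * (l : M2)) := by
  have h := hi.form_translate hk hl u (((k⁻¹ : SL2) : M2) * A * (l : M2))
    (((k⁻¹ : SL2) : M2) * B * (l : M2))
  rwa [translate_inv_cancel, translate_inv_cancel] at h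

theorem RiemMetric.omegaCoord_orbit (hg : g.IsHermitian) (hi : g.IsInvariant) {k l : SL2}
    (hk : k ∈ SU2) (hl : l ∈ SU2) {t : ℝ} {φ : Param} {z : C3}
    (hz : φ.toFun z = k * diagSL t * l⁻¹) (v w : C3) :
    g.omegaCoord φ v w z =
      g.diagOmega t (((k⁻¹ : SL2) : M2) * φ.jac z v * (l : M2))
        (((k⁻¹ : SL2) : M2) * φ.jac z w * (l : M2)) := by
  have hmem : ∀ v, ((k⁻¹ : SL2) : M2) * φ.jac z v * (l : M2) ∈ tangentSpace (diagSL t) :=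
    fun v => translate_inv_mem (hz ▸ φ.jac_mem z v)
  rw [g.omegaCoord_eq_form, hz, hi.form_translate_inv hk hl, Matrix.mul_smul, Matrix.smul_mul,
    g.form_diagSL hg hi t (Submodule.smul_mem _ _ (hmem v)) (hmem w), RiemMetric.diagOmega]
  simp
  ring

theorem hasDerivAt_matrix_mul {A B : ℝ → M2} {A' B' : M2} {s : ℝ}
    (hA : ∀ i j, HasDerivAt (fun s => A s i j) (A' i j) s)
    (hB : ∀ i j, HasDerivAt (fun s => B s i j) (B' i j) s) (i j : Fin 2) :
    HasDerivAt (fun s => (A s * B s) i j) ((A' * B s + A s * B') i j) s := by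
  simp only [Matrix.mul_apply, Matrix.add_apply, Fin.sum_univ_two]
  convert! ((hA i 0).mul (hB 0 j)).add ((hA i 1).mul (hB 1 j)) using 1
  ring

/-- The inverse of a matrix in `SL(2, ℂ)` is its adjugate, which is linear in the entries. -/
theorem hasDerivAt_inv {k : ℝ → SL2} {α : M2} {s : ℝ}
    (hk : ∀ i j, HasDerivAt (fun s => (k s : M2) i j) (α i j) s) (i j : Fin 2) :
    HasDerivAt (fun s => (((k s)⁻¹ : SL2) : M2) i j) (α.adjugate i j) s := by
  simp only [Matrix.SpecialLinearGroup.coe_inv, Matrix.adjugate_fin_two]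
  fin_cases i <;> fin_cases j
  · exact hk 1 1
  · exact (hk 0 1).neg
  · exact (hk 1 0).neg
  · exact hk 0 0

theorem RiemMetric.hasDerivAt_diagOmega (g : RiemMetric) (t : ℝ) {A B : ℝ → M2} {A' B' : M2}
    {s : ℝ} (hA : ∀ i j, HasDerivAt (fun s => A s i j) (A' i j) s)
    (hB : ∀ i j, HasDerivAt (fun s => B s i j) (B' i j) s) :
    HasDerivAt (fun s => g.diagOmega t (A s) (B s))
      (g.diagOmega t A' (B s) + g.diagOmega t (A s) B') s := by
  have hentry : ∀ i j, HasDerivAt (fun s => (A s i j * (starRingEnd ℂ) (B s i j)).im) _ s :=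
    fun i j => Complex.imCLM.hasFDerivAt.comp_hasDerivAt s ((hA i j).mul (hB i j).star)
  convert! ((((hentry 0 0).const_mul (g.radialCoeff t)).add
    ((hentry 0 1).const_mul (g.upperCoeff t))).add
      ((hentry 1 0).const_mul (g.lowerCoeff t))).neg using 1
  simp only [RiemMetric.diagOmega, Complex.imCLM_apply, Complex.add_im, starRingEnd_apply]
  ring

/-- `k` is a curve in `SU(2)` which passes through `1` at time `0` with velocity `α`. -/
structure IsSU2Curve (k : ℝ → SL2) (α : M2) : Prop where
  mem : ∀ s, k s ∈ SU2
  zero : k 0 = 1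
  hasDerivAt : ∀ i j, HasDerivAt (fun s => (k s : M2) i j) (α i j) 0

/-- The coordinates in `chart` of the velocity of the curve `k s * diagSL t * (l s)⁻¹` at `s = 0`,
where `k` and `l` are curves through `1` with velocities `α` and `β`. -/
def orbitVec (α β : M2) (t : ℝ) : C3 :=
  chartCoord (α * (diagSL t : M2) + (diagSL t : M2) * β.adjugate)

/-- The coordinates in `chart` of the curve `k s * diagSL t * (l s)⁻¹`. -/
def orbitCurve (k l : ℝ → SL2) (t s : ℝ) : C3 := chartCoord (k s * diagSL t * (l s)⁻¹ : SL2)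

section Orbit

variable {k l : ℝ → SL2} {α β : M2}

theorem orbitCurve_zero (hk : IsSU2Curve k α) (hl : IsSU2Curve l β) (t : ℝ) :
    orbitCurve k l t 0 = diagCoord t := by
  rw [orbitCurve, hk.zero, hl.zero, one_mul, inv_one, mul_one]
  ext i
  fin_cases i <;> simp [chartCoord, diagCoord, diagSL]

theorem hasDerivAt_orbitCurve (hk : IsSU2Curve k α) (hl : IsSU2Curve l β) (t : ℝ) :
    HasDerivAt (orbitCurve k l t) (orbitVec α β t) 0 := by
  have hentry : ∀ i j, HasDerivAt (fun s => ((k s * diagSL t * (l s)⁻¹ : SL2) : M2) i j)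
      ((α * (diagSL t : M2) + (diagSL t : M2) * β.adjugate) i j) 0 := fun i j => by
    have hleft := hasDerivAt_matrix_mul (B' := 0) hk.hasDerivAt fun i j =>
      hasDerivAt_const 0 ((diagSL t : M2) i j)
    convert! hasDerivAt_matrix_mul hleft (hasDerivAt_inv hl.hasDerivAt) i j using 1
    simp [hk.zero, hl.zero]
  rw [hasDerivAt_pi]
  intro i
  fin_cases i
  exacts [hentry 0 0, hentry 0 1, hentry 1 0]

theorem eventually_orbitCurve_mem_chart (hk : IsSU2Curve k α) (hl : IsSU2Curve l β) (t : ℝ) :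
    ∀ᶠ s in 𝓝 0, orbitCurve k l t s ∈ chart.U :=
  (hasDerivAt_orbitCurve hk hl t).continuousAt.eventually_mem
    (chart.isOpen.mem_nhds (orbitCurve_zero hk hl t ▸ diagCoord_mem t))

/-- Only the lower right entry of the Jacobian of `chart` varies with the base point. -/
theorem exists_hasDerivAt_jac_orbitCurve (hk : IsSU2Curve k α) (hl : IsSU2Curve l β)
    (t : ℝ) (v : C3) :
    ∃ d : ℂ, ∀ i j, HasDerivAt (fun s => chart.jac (orbitCurve k l t s) v i j)
      ((!![0, 0; 0, d] : M2) i j) 0 := by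
  have hcorner : DifferentiableAt ℝ (fun s => chart.jac (orbitCurve k l t s) v 1 1) 0 := by
    refine DifferentiableAt.comp 0 (g := fun z => chart.jac z v 1 1) ?_
      (hasDerivAt_orbitCurve hk hl t).differentiableAt
    rw [orbitCurve_zero hk hl]
    exact ((chart.contDiffOn_jac v 1 1).contDiffAt
      (chart.isOpen.mem_nhds (diagCoord_mem t))).differentiableAt (by simp)
  have hconst : ∀ i j, (∀ z, chartJac z v i j = chartJac 0 v i j) →
      HasDerivAt (fun s => chart.jac (orbitCurve k l t s) v i j) 0 0 := fun i j hij => by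
    refine (hasDerivAt_const (0 : ℝ) (chartJac 0 v i j)).congr_of_eventuallyEq ?_
    filter_upwards [eventually_orbitCurve_mem_chart hk hl t] with s hs
    rw [chart_jac hs, hij]
  refine ⟨deriv (fun s => chart.jac (orbitCurve k l t s) v 1 1) 0, fun i j => ?_⟩
  fin_cases i <;> fin_cases j
  exacts [hconst 0 0 fun z => rfl, hconst 0 1 fun z => rfl, hconst 1 0 fun z => rfl,
    hcorner.hasDerivAt]

theorem exists_hasDerivAt_pullback_jac_orbitCurve (hk : IsSU2Curve k α) (hl : IsSU2Curve l β)
    (t : ℝ) (v : C3) :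
    ∃ d : ℂ, ∀ i j, HasDerivAt
      (fun s => ((((k s)⁻¹ : SL2) : M2) * chart.jac (orbitCurve k l t s) v * (l s : M2)) i j)
      ((α.adjugate * chart.jac (diagCoord t) v + chart.jac (diagCoord t) v * β +
        !![0, 0; 0, d]) i j) 0 := by
  obtain ⟨d, hd⟩ := exists_hasDerivAt_jac_orbitCurve hk hl t v
  refine ⟨d, fun i j => ?_⟩
  convert! hasDerivAt_matrix_mul (hasDerivAt_matrix_mul (hasDerivAt_inv hk.hasDerivAt) hd)
    hl.hasDerivAt i j using 1
  simp only [hk.zero, hl.zero, orbitCurve_zero hk hl, inv_one,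
    Matrix.SpecialLinearGroup.coe_one, Matrix.one_mul, Matrix.mul_one, add_right_comm]

/-- By invariance, `ω` at the point `k s * diagSL t * (l s)⁻¹` of the orbit is `diagOmega` of the
vectors translated back to `diagSL t`; the unknown corner entry of their derivatives drops out. -/
theorem RiemMetric.fderiv_omegaCoord_orbit (hk : IsSU2Curve k α) (hl : IsSU2Curve l β)
    (hg : g.IsHermitian) (hi : g.IsInvariant) (t : ℝ) (v w : C3) :
    fderiv ℝ (g.omegaCoord chart v w) (diagCoord t) (orbitVec α β t) =
      g.diagOmega t (α.adjugate * chart.jac (diagCoord t) v + chart.jac (diagCoord t) v * β)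
          (chart.jac (diagCoord t) w) +
        g.diagOmega t (chart.jac (diagCoord t) v)
          (α.adjugate * chart.jac (diagCoord t) w + chart.jac (diagCoord t) w * β) := by
  have hchain : HasDerivAt (fun s => g.omegaCoord chart v w (orbitCurve k l t s))
      (fderiv ℝ (g.omegaCoord chart v w) (diagCoord t) (orbitVec α β t)) 0 := by
    rw [← orbitCurve_zero hk hl t]
    refine HasFDerivAt.comp_hasDerivAt (l := g.omegaCoord chart v w) 0 ?_
      (hasDerivAt_orbitCurve hk hl t)
    exact (g.differentiableAt_omegaCoord chart v w
      (orbitCurve_zero hk hl t ▸ diagCoord_mem t)).hasFDerivAt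
  have htranslate : (fun s => g.omegaCoord chart v w (orbitCurve k l t s)) =ᶠ[𝓝 0] fun s =>
      g.diagOmega t ((((k s)⁻¹ : SL2) : M2) * chart.jac (orbitCurve k l t s) v * (l s : M2))
        ((((k s)⁻¹ : SL2) : M2) * chart.jac (orbitCurve k l t s) w * (l s : M2)) := by
    filter_upwards [eventually_orbitCurve_mem_chart hk hl t] with s hs
    exact g.omegaCoord_orbit hg hi (hk.mem s) (hl.mem s) (chart_chartCoord hs) v w
  obtain ⟨d, hv⟩ := exists_hasDerivAt_pullback_jac_orbitCurve hk hl t v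
  obtain ⟨e, hw⟩ := exists_hasDerivAt_pullback_jac_orbitCurve hk hl t w
  rw [hchain.unique ((g.hasDerivAt_diagOmega t hv hw).congr_of_eventuallyEq htranslate)]
  simp only [hk.zero, hl.zero, orbitCurve_zero hk hl, inv_one,
    Matrix.SpecialLinearGroup.coe_one, Matrix.one_mul, Matrix.mul_one]
  simp [RiemMetric.diagOmega]

end Orbit

/-! ### The equations of a closed invariant fundamental form -/

/-- The element `cos s + w sin s` of `SU(2)`, where the complex number `w` of modulus one stands
for the skew-Hermitian matrix with off-diagonal entries `w` and `-w̄`. -/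
def rot (w : Circle) (s : ℝ) : SL2 :=
  ⟨!![(Real.cos s : ℂ), w * (Real.sin s : ℂ); -(starRingEnd ℂ) w * (Real.sin s : ℂ),
      (Real.cos s : ℂ)], by
    have hw : (w : ℂ) * (starRingEnd ℂ) w = 1 := by simp [Complex.mul_conj]
    have hcs : (Real.cos s : ℂ) ^ 2 + (Real.sin s : ℂ) ^ 2 = 1 := by
      exact_mod_cast Real.cos_sq_add_sin_sq s
    rw [Matrix.det_fin_two_of]
    linear_combination (Real.sin s : ℂ) ^ 2 * hw + hcs⟩

/-- The velocity of `rot w` at time `0`. -/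
def rotVelocity (w : Circle) : M2 := !![0, w; -(starRingEnd ℂ) w, 0]

/-- The velocity of `torusSL` at time `0`. -/
def torusVelocity : M2 := !![Complex.I, 0; 0, -Complex.I]

theorem isSU2Curve_one : IsSU2Curve (fun _ => 1) 0 where
  mem _ := SU2.one_mem
  zero := rfl
  hasDerivAt _ _ := hasDerivAt_const _ _

theorem isSU2Curve_rot (w : Circle) : IsSU2Curve (rot w) (rotVelocity w) where
  mem s := by
    have hw : (w : ℂ) * (starRingEnd ℂ) w = 1 := by simp [Complex.mul_conj]
    have hcs : (Real.cos s : ℂ) ^ 2 + (Real.sin s : ℂ) ^ 2 = 1 := by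
      exact_mod_cast Real.cos_sq_add_sin_sq s
    rw [mem_SU2_iff]
    ext i j
    fin_cases i <;> fin_cases j <;>
      simp [rot, Matrix.mul_apply, Fin.sum_univ_two, -Complex.ofReal_cos, -Complex.ofReal_sin,
        Complex.conj_ofReal]
    · linear_combination (Real.sin s : ℂ) ^ 2 * hw + hcs
    · ring
    · ring
    · linear_combination (Real.sin s : ℂ) ^ 2 * hw + hcs
  zero := by
    ext i j
    fin_cases i <;> fin_cases j <;> simp [rot]
  hasDerivAt i j := by
    have hcos : HasDerivAt (fun s : ℝ => (Real.cos s : ℂ)) 0 0 := by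
      simpa using (Real.hasDerivAt_cos 0).ofReal_comp
    have hsin : ∀ c : ℂ, HasDerivAt (fun s : ℝ => c * (Real.sin s : ℂ)) c 0 := fun c => by
      simpa using (Real.hasDerivAt_sin 0).ofReal_comp.const_mul c
    fin_cases i <;> fin_cases j
    exacts [hcos, hsin _, hsin _, hcos]

theorem isSU2Curve_torusSL : IsSU2Curve torusSL torusVelocity where
  mem := torusSL_mem
  zero := by
    ext i j
    fin_cases i <;> fin_cases j <;> simp [torusSL]
  hasDerivAt i j := by
    have hexp : HasDerivAt (fun θ : ℝ => Complex.exp (θ * Complex.I)) Complex.I 0 := by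
      simpa using ((hasDerivAt_id (0 : ℝ)).ofReal_comp.mul_const Complex.I).cexp
    have hexp_neg : HasDerivAt (fun θ : ℝ => Complex.exp (-(θ * Complex.I))) (-Complex.I) 0 := by
      simpa using ((hasDerivAt_id (0 : ℝ)).ofReal_comp.mul_const Complex.I).neg.cexp
    fin_cases i <;> fin_cases j
    exacts [hexp, hasDerivAt_const _ _, hasDerivAt_const _ _, hexp_neg]

theorem orbitVec_torus_left (t : ℝ) :
    orbitVec torusVelocity 0 t = ![Complex.I * (Real.exp (t / 2) : ℂ), 0, 0] := by
  ext i
  fin_cases i <;> simp [orbitVec, torusVelocity, chartCoord, diagSL]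

theorem orbitVec_rot_left (w : Circle) (t : ℝ) :
    orbitVec (rotVelocity w) 0 t = ![0, w * (Real.exp (-(t / 2)) : ℂ),
      -(starRingEnd ℂ) w * (Real.exp (t / 2) : ℂ)] := by
  ext i
  fin_cases i <;> simp [orbitVec, rotVelocity, chartCoord, diagSL]

theorem orbitVec_rot_right (w : Circle) (t : ℝ) :
    orbitVec 0 (rotVelocity w) t = ![0, -(w * (Real.exp (t / 2) : ℂ)),
      (starRingEnd ℂ) w * (Real.exp (-(t / 2)) : ℂ)] := by
  ext i
  fin_cases i <;>
    simp [orbitVec, rotVelocity, chartCoord, diagSL, Matrix.adjugate_fin_two, mul_comm]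

/-- The fundamental vector fields `Z`, `V`, `W` of `torusSL` and of a rotation acting from the left
and of the same rotation acting from the right satisfy `dω (Z, V, W) = 2 (upper - lower)`. -/
theorem RiemMetric.upperCoeff_eq_lowerCoeff (hk : g.IsKahler) (hi : g.IsInvariant) (t : ℝ) :
    g.upperCoeff t = g.lowerCoeff t := by
  have hinv := exp_neg_half_mul_exp_half t
  have hinv' : Real.exp (-t) * (Real.exp (t / 2) * Real.exp (t / 2)) = 1 := by
    rw [← exp_eq_exp_half_mul_self, ← Real.exp_add, neg_add_cancel, Real.exp_zero]
  have hZ : fderiv ℝ (g.omegaCoord chart (orbitVec (rotVelocity 1) 0 t)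
      (orbitVec 0 (rotVelocity 1) t)) (diagCoord t) (orbitVec torusVelocity 0 t) = 0 := by
    rw [g.fderiv_omegaCoord_orbit isSU2Curve_torusSL isSU2Curve_one hk.hermitian hi,
      orbitVec_rot_left, orbitVec_rot_right, chart_jac_diagCoord, chart_jac_diagCoord]
    simp [RiemMetric.diagOmega, torusVelocity, Matrix.adjugate_fin_two, -Complex.ofReal_exp]
    ring
  have hV : fderiv ℝ (g.omegaCoord chart (orbitVec 0 (rotVelocity 1) t)
      (orbitVec torusVelocity 0 t)) (diagCoord t) (orbitVec (rotVelocity 1) 0 t) =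
        g.lowerCoeff t - g.upperCoeff t - g.radialCoeff t := by
    rw [g.fderiv_omegaCoord_orbit (isSU2Curve_rot 1) isSU2Curve_one hk.hermitian hi,
      orbitVec_rot_right, orbitVec_torus_left, chart_jac_diagCoord, chart_jac_diagCoord]
    simp [RiemMetric.diagOmega, rotVelocity, Matrix.adjugate_fin_two, -Complex.ofReal_exp]
    linear_combination (g.lowerCoeff t - g.radialCoeff t) * hinv - g.upperCoeff t * hinv'
  have hW : fderiv ℝ (g.omegaCoord chart (orbitVec torusVelocity 0 t)
      (orbitVec (rotVelocity 1) 0 t)) (diagCoord t) (orbitVec 0 (rotVelocity 1) t) =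
        g.lowerCoeff t - g.upperCoeff t + g.radialCoeff t := by
    rw [g.fderiv_omegaCoord_orbit isSU2Curve_one (isSU2Curve_rot 1) hk.hermitian hi,
      orbitVec_rot_left, orbitVec_torus_left, chart_jac_diagCoord, chart_jac_diagCoord]
    simp [RiemMetric.diagOmega, rotVelocity, -Complex.ofReal_exp]
    linear_combination (g.radialCoeff t - g.upperCoeff t) * hinv + g.lowerCoeff t * hinv'
  have hclosed := hk.closed chart (diagCoord t) (diagCoord_mem t) (orbitVec torusVelocity 0 t)
    (orbitVec (rotVelocity 1) 0 t) (orbitVec 0 (rotVelocity 1) t)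
  rw [hZ, hV, hW] at hclosed
  linarith

theorem hasDerivAt_diagCoord (t : ℝ) :
    HasDerivAt diagCoord ![((Real.exp (t / 2) / 2 : ℝ) : ℂ), 0, 0] t := by
  have hexp : HasDerivAt (fun t : ℝ => Real.exp (t / 2)) (Real.exp (t / 2) / 2) t := by
    convert! ((hasDerivAt_id t).div_const 2).exp using 1
    simp [div_eq_mul_inv]
  rw [hasDerivAt_pi]
  intro i
  fin_cases i
  exacts [hexp.ofReal_comp, hasDerivAt_const _ _, hasDerivAt_const _ _]

theorem RiemMetric.fderiv_omegaCoord_diag (hg : g.IsHermitian) (hi : g.IsInvariant) (t : ℝ)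
    (v w : C3) :
    fderiv ℝ (g.omegaCoord chart v w) (diagCoord t) ![((Real.exp (t / 2) / 2 : ℝ) : ℂ), 0, 0] =
      -(deriv g.radialCoeff t * (v 0 * (starRingEnd ℂ) (w 0)).im +
        deriv g.upperCoeff t * (v 1 * (starRingEnd ℂ) (w 1)).im +
        deriv g.lowerCoeff t * (v 2 * (starRingEnd ℂ) (w 2)).im) := by
  have hderiv : ∀ {f : ℝ → ℝ} (c : ℝ), ContDiff ℝ ∞ f →
      HasDerivAt (fun t => f t * c) (deriv f t * c) t := fun c hf =>
    (hf.differentiable (by simp) t).hasDerivAt.mul_const c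
  have hcoeff := (((hderiv (v 0 * (starRingEnd ℂ) (w 0)).im g.contDiff_radialCoeff).add
    (hderiv (v 1 * (starRingEnd ℂ) (w 1)).im g.contDiff_upperCoeff)).add
      (hderiv (v 2 * (starRingEnd ℂ) (w 2)).im g.contDiff_lowerCoeff)).neg
  refine ((g.differentiableAt_omegaCoord chart v w (diagCoord_mem t)).hasFDerivAt.comp_hasDerivAt
    t (hasDerivAt_diagCoord t)).unique
      (hcoeff.congr_of_eventuallyEq (Filter.Eventually.of_forall fun s => ?_))
  have horbit := g.omegaCoord_orbit hg hi SU2.one_mem SU2.one_mem (t := s) (φ := chart)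
    (z := diagCoord s) (by simp [chart_diagCoord]) v w
  rw [Function.comp_apply, horbit]
  simp [chart_jac_diagCoord, RiemMetric.diagOmega]

/-- The element `i` of the unit circle. -/
def circleI : Circle := ⟨Complex.I, by simp [Submonoid.unitSphere]⟩

/-- The identity `dω (∂ₜ, V, W) = 0` for the fundamental vector fields `V` and `W` of two rotations
acting from the left. -/
theorem RiemMetric.radialCoeff_mul_exp (hk : g.IsKahler) (hi : g.IsInvariant) (t : ℝ) :
    g.radialCoeff t * Real.exp t =
      2 * (deriv g.upperCoeff t * Real.sinh t + g.upperCoeff t * Real.cosh t) := by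
  have hinv := exp_neg_half_mul_exp_half t
  have hlower : g.lowerCoeff = g.upperCoeff :=
    funext fun t => (g.upperCoeff_eq_lowerCoeff hk hi t).symm
  have hT : fderiv ℝ (g.omegaCoord chart (orbitVec (rotVelocity 1) 0 t)
      (orbitVec (rotVelocity circleI) 0 t)) (diagCoord t)
        ![((Real.exp (t / 2) / 2 : ℝ) : ℂ), 0, 0] = -2 * deriv g.upperCoeff t * Real.sinh t := by
    rw [g.fderiv_omegaCoord_diag hk.hermitian hi, orbitVec_rot_left, orbitVec_rot_left, hlower,
      Real.sinh_eq, exp_eq_exp_half_mul_self t, exp_eq_exp_half_mul_self (-t), neg_div]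
    simp [circleI, -Complex.ofReal_exp]
    ring
  have hV : fderiv ℝ (g.omegaCoord chart (orbitVec (rotVelocity circleI) 0 t)
      ![((Real.exp (t / 2) / 2 : ℝ) : ℂ), 0, 0]) (diagCoord t) (orbitVec (rotVelocity 1) 0 t) =
        g.radialCoeff t * Real.exp t / 2 - g.upperCoeff t * Real.cosh t := by
    rw [g.fderiv_omegaCoord_orbit (isSU2Curve_rot 1) isSU2Curve_one hk.hermitian hi,
      orbitVec_rot_left, chart_jac_diagCoord, chart_jac_diagCoord, Real.cosh_eq,
      exp_eq_exp_half_mul_self t, exp_eq_exp_half_mul_self (-t), neg_div]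
    simp [RiemMetric.diagOmega, rotVelocity, circleI, hlower, Complex.conj_ofNat,
      Complex.div_ofNat_re, -Complex.ofReal_exp]
    linear_combination -g.upperCoeff t * Real.exp (-(t / 2)) ^ 2 / 2 * hinv
  have hW : fderiv ℝ (g.omegaCoord chart ![((Real.exp (t / 2) / 2 : ℝ) : ℂ), 0, 0]
      (orbitVec (rotVelocity 1) 0 t)) (diagCoord t) (orbitVec (rotVelocity circleI) 0 t) =
        g.radialCoeff t * Real.exp t / 2 - g.upperCoeff t * Real.cosh t := by
    rw [g.fderiv_omegaCoord_orbit (isSU2Curve_rot circleI) isSU2Curve_one hk.hermitian hi,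
      orbitVec_rot_left, chart_jac_diagCoord, chart_jac_diagCoord, Real.cosh_eq,
      exp_eq_exp_half_mul_self t, exp_eq_exp_half_mul_self (-t), neg_div]
    simp [RiemMetric.diagOmega, rotVelocity, circleI, hlower, Complex.div_ofNat_re,
      -Complex.ofReal_exp]
    linear_combination -g.upperCoeff t * Real.exp (-(t / 2)) ^ 2 / 2 * hinv
  have hclosed := hk.closed chart (diagCoord t) (diagCoord_mem t)
    ![((Real.exp (t / 2) / 2 : ℝ) : ℂ), 0, 0] (orbitVec (rotVelocity 1) 0 t)
    (orbitVec (rotVelocity circleI) 0 t)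
  rw [hT, hV, hW] at hclosed
  linarith

/-! ### The Ricci-flat equation -/

section LineDerivatives

theorem realHessian_self {E : Type*} [NormedAddCommGroup E] [NormedSpace ℝ E] {F : E → ℝ} {z : E}
    (hF : ContDiffAt ℝ 2 F z) (v : E) :
    realHessian F z v v = deriv (deriv fun s : ℝ => F (z + s • v)) 0 := by
  have hline : ∀ s : ℝ, HasDerivAt (fun s : ℝ => z + s • v) v s := fun s => by
    simpa using ((hasDerivAt_id s).smul_const v).const_add z
  have hz : z + (0 : ℝ) • v = z := by simp
  have htendsto : Filter.Tendsto (fun s : ℝ => z + s • v) (𝓝 0) (𝓝 z) := by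
    simpa using (hline 0).continuousAt.tendsto
  have hderiv : (deriv fun s : ℝ => F (z + s • v)) =ᶠ[𝓝 0]
      fun s => fderiv ℝ F (z + s • v) v := by
    filter_upwards [htendsto.eventually (hF.eventually (by simp))] with s hs
    exact ((hs.differentiableAt (by simp)).hasFDerivAt.comp_hasDerivAt s (hline s)).deriv
  have hsecond : DifferentiableAt ℝ (fun x => fderiv ℝ F x v) (z + (0 : ℝ) • v) := by
    rw [hz]
    exact (differentiableAt_fderiv hF).clm_apply (differentiableAt_const v)
  have hcomp := (hsecond.hasFDerivAt.comp_hasDerivAt 0 (hline 0)).deriv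
  rw [hz, fderiv_fderiv_apply hF] at hcomp
  exact (hderiv.deriv_eq.trans hcomp).symm

theorem deriv_deriv_comp_sqrt {f : ℝ → ℝ} (hf : ContDiff ℝ 2 f) {r : ℝ} (hr : 0 < r) (c : ℝ) :
    deriv (deriv fun s : ℝ => f (√(r ^ 2 + s ^ 2)) + c) 0 = deriv f r / r := by
  have hsqrt : ∀ s : ℝ, HasDerivAt (fun s : ℝ => √(r ^ 2 + s ^ 2)) (s / √(r ^ 2 + s ^ 2)) s :=
    fun s => by
      have hpos : 0 < r ^ 2 + s ^ 2 := by positivity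
      convert! (((hasDerivAt_id s).pow 2).const_add (r ^ 2)).sqrt hpos.ne' using 1
      simp
      field_simp
  have hfirst : (deriv fun s : ℝ => f (√(r ^ 2 + s ^ 2)) + c) =
      fun s => s * (deriv f (√(r ^ 2 + s ^ 2)) / √(r ^ 2 + s ^ 2)) := by
    ext s
    have hcomp := ((hf.differentiable (by simp) _).hasDerivAt.comp s (hsqrt s)).add_const c
    exact hcomp.deriv.trans (by ring)
  have hderiv : Differentiable ℝ (deriv f) :=
    (contDiff_succ_iff_deriv (n := 1).1 hf).2.2.differentiable one_ne_zero
  have hquot : DifferentiableAt ℝ (fun s => deriv f (√(r ^ 2 + s ^ 2)) / √(r ^ 2 + s ^ 2)) 0 :=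
    ((hderiv _).comp 0 (hsqrt 0).differentiableAt).div (hsqrt 0).differentiableAt (by positivity)
  rw [hfirst, ((hasDerivAt_id' (0 : ℝ)).fun_mul hquot.hasDerivAt).deriv]
  simp [Real.sqrt_sq hr.le]

theorem complexHessian_self {F : C3 → ℝ} {z : C3} (hF : ContDiffAt ℝ 2 F z) (a : Fin 3) :
    complexHessian F z a a = ((realHessian F z (Pi.single a 1) (Pi.single a 1) +
      realHessian F z (Pi.single a Complex.I) (Pi.single a Complex.I) : ℝ) : ℂ) / 4 := by
  rw [complexHessian_eq hF, realHessian_symm hF (Pi.single a Complex.I) (Pi.single a 1), sub_self,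
    Complex.ofReal_zero, mul_zero, add_zero]

end LineDerivatives

theorem frameJac_chart_det {x y : ℂ} (hx : x ≠ 0) :
    (chart.frameJac ![x, y, 0]).det = x⁻¹ := by
  have hz : (![x, y, 0] : C3) 0 ≠ 0 := hx
  rw [Matrix.det_fin_three]
  simp only [Param.frameJac, Matrix.of_apply, frameCoord, Matrix.SpecialLinearGroup.coe_inv,
    chart_toFun hz, chart_jac hz]
  simp [chartMat, chartJac, Matrix.adjugate_fin_two]
  field_simp

theorem tau_chart {x y : ℂ} (hx : x ≠ 0) :
    tau (chart.toFun ![x, y, 0]) =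
      (Complex.normSq x + Complex.normSq y + (Complex.normSq x)⁻¹) / 2 := by
  have hz : (![x, y, 0] : C3) 0 ≠ 0 := hx
  rw [tau, chart_toFun hz]
  simp [chartMat]

theorem exists_cosh_eq_tau (u : SL2) : ∃ t, Real.cosh t = tau u := by
  obtain ⟨k, hk, l, hl, t, -, rfl⟩ := exists_kak u
  exact ⟨t, by rw [tau_translate hk hl, tau_diagSL]⟩

theorem RiemMetric.exists_gramDet_eq_diagSL (hg : g.IsHermitian) (hi : g.IsInvariant) (u : SL2) :
    ∃ s, 0 ≤ s ∧ Real.cosh s = tau u ∧ (g.gram u).det = (g.gram (diagSL s)).det := by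
  obtain ⟨k, hk, l, hl, s, hs, rfl⟩ := exists_kak u
  exact ⟨s, hs, by rw [tau_translate hk hl, tau_diagSL], g.gramDet_translate hg hi hk hl _⟩

theorem RiemMetric.gramDet_eq_of_tau_eq (hg : g.IsHermitian) (hi : g.IsInvariant) {u v : SL2}
    (h : tau u = tau v) : (g.gram u).det = (g.gram v).det := by
  obtain ⟨s, hs, hus, hu⟩ := g.exists_gramDet_eq_diagSL hg hi u
  obtain ⟨r, hr, hvr, hv⟩ := g.exists_gramDet_eq_diagSL hg hi v
  rw [hu, hv, Real.cosh_strictMonoOn.injOn hs hr (by rw [hus, hvr, h])]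

theorem RiemMetric.contDiffOn_det_hermMatrix (g : RiemMetric) (φ : Param) :
    ContDiffOn ℝ ∞ (fun z => (g.hermMatrix φ z).det.re) φ.U := by
  have hentry : ∀ a b, ContDiffOn ℝ ∞ (fun z => g.hermMatrix φ z a b) φ.U := by
    intro a b
    simp only [RiemMetric.hermMatrix, Matrix.of_apply]
    have hre := Complex.ofRealCLM.contDiff.comp_contDiffOn
      (g.smooth φ (Pi.single a 1) (Pi.single b 1))
    have him := Complex.ofRealCLM.contDiff.comp_contDiffOn
      (g.smooth φ (Pi.single a 1) (Pi.single b Complex.I))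
    exact (hre.add (contDiffOn_const.mul him)).div_const 2
  refine contDiffOn_re ?_
  simp only [Matrix.det_fin_three]
  fun_prop

/-- The logarithm of the volume density of `g` in the coordinates `chart`. -/
def RiemMetric.logVolume (g : RiemMetric) (z : C3) : ℝ := Real.log (g.hermMatrix chart z).det.re

theorem RiemMetric.det_hermMatrix_chart (hg : g.IsHermitian) (hi : g.IsInvariant) {x y : ℂ}
    (hx : x ≠ 0) {t : ℝ}
    (ht : Real.cosh t = (Complex.normSq x + Complex.normSq y + (Complex.normSq x)⁻¹) / 2) :
    (g.hermMatrix chart ![x, y, 0]).det.re = (Complex.normSq x)⁻¹ * g.volumeDensity t := by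
  have htau : tau (chart.toFun ![x, y, 0]) = tau (diagSL t) := by
    rw [tau_chart hx, tau_diagSL, ht]
  rw [hg.det_hermMatrix, frameJac_chart_det hx, g.gramDet_eq_of_tau_eq hg hi htau,
    g.gramDet_diagSL hg hi, ← Complex.ofReal_mul, Complex.ofReal_re, Complex.normSq_inv]

theorem RiemMetric.logVolume_eq (hg : g.IsHermitian) (hi : g.IsInvariant) {x y : ℂ}
    (hx : x ≠ 0) {t : ℝ}
    (ht : Real.cosh t = (Complex.normSq x + Complex.normSq y + (Complex.normSq x)⁻¹) / 2) :
    g.logVolume ![x, y, 0] = Real.log (g.volumeDensity t) - Real.log (Complex.normSq x) := by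
  rw [RiemMetric.logVolume, g.det_hermMatrix_chart hg hi hx ht,
    Real.log_mul (inv_pos.2 (Complex.normSq_pos.2 hx)).ne' (g.volumeDensity_pos t).ne',
    Real.log_inv]
  ring

theorem RiemMetric.contDiffAt_logVolume (hg : g.IsHermitian) (hi : g.IsInvariant) {x y : ℂ}
    (hx : x ≠ 0) : ContDiffAt ℝ ∞ g.logVolume ![x, y, 0] := by
  obtain ⟨t, ht⟩ := exists_cosh_eq_tau (chart.toFun ![x, y, 0])
  refine ((g.contDiffOn_det_hermMatrix chart).contDiffAt
    (chart.isOpen.mem_nhds (x := ![x, y, 0]) hx)).log ?_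
  rw [g.det_hermMatrix_chart hg hi hx (ht.trans (tau_chart hx))]
  exact (mul_pos (inv_pos.2 (Complex.normSq_pos.2 hx)) (g.volumeDensity_pos t)).ne'

theorem RiemMetric.contDiff_logVolume_line (hg : g.IsHermitian) (hi : g.IsInvariant) :
    ContDiff ℝ ∞ fun s : ℝ => g.logVolume ![1, (s : ℂ), 0] := by
  refine contDiff_iff_contDiffAt.2 fun s => ContDiffAt.comp
    (f := fun s : ℝ => (![1, (s : ℂ), 0] : C3)) s (g.contDiffAt_logVolume hg hi one_ne_zero)
    (contDiffAt_pi.2 fun i => ?_)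
  fin_cases i
  exacts [contDiffAt_const, Complex.ofRealCLM.contDiff.contDiffAt, contDiffAt_const]

/-- `(e, y, 0)` and `(1, √((e - e⁻¹) ^ 2 + |y| ^ 2), 0)` have the same value of `tau`. -/
theorem RiemMetric.logVolume_chart (hg : g.IsHermitian) (hi : g.IsInvariant) {e : ℝ} (he : e ≠ 0)
    (y : ℂ) :
    g.logVolume ![(e : ℂ), y, 0] =
      g.logVolume ![1, (√((e - e⁻¹) ^ 2 + Complex.normSq y) : ℂ), 0] +
        -Real.log (Complex.normSq e) := by
  have hx : (e : ℂ) ≠ 0 := Complex.ofReal_ne_zero.2 he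
  obtain ⟨t, ht⟩ := exists_cosh_eq_tau (chart.toFun ![(e : ℂ), y, 0])
  rw [tau_chart hx] at ht
  have hone : Real.cosh t = (Complex.normSq 1 +
      Complex.normSq (√((e - e⁻¹) ^ 2 + Complex.normSq y) : ℂ) + (Complex.normSq 1)⁻¹) / 2 := by
    rw [ht, Complex.normSq_ofReal, Complex.normSq_ofReal, Complex.normSq_one, Real.mul_self_sqrt
      (add_nonneg (sq_nonneg _) (Complex.normSq_nonneg y))]
    field_simp
    ring
  rw [g.logVolume_eq hg hi hx ht, g.logVolume_eq hg hi one_ne_zero hone, Complex.normSq_one,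
    Real.log_one]
  ring

theorem exists_pos_sub_inv_eq (r : ℝ) : ∃ e : ℝ, 0 < e ∧ e - e⁻¹ = r := by
  refine ⟨Real.exp (Real.arsinh (r / 2)), Real.exp_pos _, ?_⟩
  have h := Real.sinh_arsinh (r / 2)
  rw [Real.sinh_eq, Real.exp_neg] at h
  linarith

/-- The complex Hessian of `log det` in the direction of the second coordinate at `(e, 0, 0)` is
half the derivative of a radial function, divided by the radius `r = e - e⁻¹`. -/
theorem RiemMetric.deriv_logVolume_line (hg : g.IsHermitian) (hi : g.IsInvariant)
    (hr : g.IsRicciFlat) {r : ℝ} (hr₀ : 0 < r) :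
    deriv (fun s : ℝ => g.logVolume ![1, (s : ℂ), 0]) r = 0 := by
  obtain ⟨e, he, rfl⟩ := exists_pos_sub_inv_eq r
  have hx : (e : ℂ) ≠ 0 := Complex.ofReal_ne_zero.2 he.ne'
  have hsmooth : ContDiffAt ℝ 2 g.logVolume ![(e : ℂ), 0, 0] :=
    (g.contDiffAt_logVolume hg hi hx).of_le ENat.LEInfty.out
  have hhess : ∀ c : ℂ, Complex.normSq c = 1 →
      realHessian g.logVolume ![(e : ℂ), 0, 0] (Pi.single 1 c) (Pi.single 1 c) =
        deriv (fun s : ℝ => g.logVolume ![1, (s : ℂ), 0]) (e - e⁻¹) / (e - e⁻¹) := by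
    intro c hc
    rw [realHessian_self hsmooth, ← deriv_deriv_comp_sqrt
      ((g.contDiff_logVolume_line hg hi).of_le ENat.LEInfty.out) hr₀
      (-Real.log (Complex.normSq e))]
    have hline : ∀ s : ℝ, ![(e : ℂ), 0, 0] + s • (Pi.single 1 c : C3) = ![(e : ℂ), s * c, 0] := by
      intro s
      ext i
      fin_cases i <;> simp
    have hnormSq : ∀ s : ℝ, Complex.normSq (s * c) = s ^ 2 := fun s => by
      rw [Complex.normSq_mul, hc, Complex.normSq_ofReal, mul_one, sq]
    simp only [hline, g.logVolume_chart hg hi he.ne', hnormSq]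
  have hflat := hr chart ![(e : ℂ), 0, 0] hx 1 1
  rw [show (fun x => Real.log (g.hermMatrix chart x).det.re) = g.logVolume from rfl,
    complexHessian_self hsmooth, hhess 1 Complex.normSq_one, hhess Complex.I Complex.normSq_I,
    div_eq_zero_iff, Complex.ofReal_eq_zero, add_self_eq_zero, div_eq_zero_iff] at hflat
  simpa [hr₀.ne'] using hflat

theorem cosh_eq_exp_half_sub_sq (t : ℝ) :
    Real.cosh t = (1 + (Real.exp (t / 2) - Real.exp (-(t / 2))) ^ 2 + 1) / 2 := by
  rw [Real.cosh_eq, exp_eq_exp_half_mul_self t, exp_eq_exp_half_mul_self (-t), neg_div]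
  linear_combination exp_neg_half_mul_exp_half t

theorem RiemMetric.volumeDensity_eq (hg : g.IsHermitian) (hi : g.IsInvariant)
    (hr : g.IsRicciFlat) {s t : ℝ} (hs : 0 < s) (ht : 0 < t) :
    g.volumeDensity s = g.volumeDensity t := by
  have hval : ∀ t : ℝ, g.logVolume ![1, ((Real.exp (t / 2) - Real.exp (-(t / 2)) : ℝ) : ℂ), 0] =
      Real.log (g.volumeDensity t) := fun t => by
    rw [g.logVolume_eq hg hi one_ne_zero (t := t), Complex.normSq_one, Real.log_one, sub_zero]
    rw [Complex.normSq_one, Complex.normSq_ofReal, inv_one, cosh_eq_exp_half_sub_sq, sq]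
  have hpos : ∀ t : ℝ, 0 < t → Real.exp (t / 2) - Real.exp (-(t / 2)) ∈ Set.Ioi (0 : ℝ) :=
    fun t ht => sub_pos.2 (Real.exp_lt_exp.2 (by linarith))
  have hconst := isOpen_Ioi.is_const_of_deriv_eq_zero isPreconnected_Ioi
    ((g.contDiff_logVolume_line hg hi).differentiable (by simp)).differentiableOn
    (fun r hr₀ => g.deriv_logVolume_line hg hi hr hr₀) (hpos s hs) (hpos t ht)
  rw [hval, hval] at hconst
  exact Real.log_injOn_pos (g.volumeDensity_pos s) (g.volumeDensity_pos t) hconst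

/-! ### Uniqueness -/

theorem RiemMetric.hasDerivAt_upperCoeff_mul_sinh (hk : g.IsKahler) (hi : g.IsInvariant) (t : ℝ) :
    HasDerivAt (fun t => g.upperCoeff t * Real.sinh t) (g.radialCoeff t * Real.exp t / 2) t := by
  convert! (g.contDiff_upperCoeff.differentiable (by simp) t).hasDerivAt.mul
    (Real.hasDerivAt_sinh t) using 1
  rw [g.radialCoeff_mul_exp hk hi]
  ring

theorem RiemMetric.volumeDensity_eq_upperCoeff_sq (hk : g.IsKahler) (hi : g.IsInvariant) (t : ℝ) :
    g.volumeDensity t = g.radialCoeff t * Real.exp t * g.upperCoeff t ^ 2 / 8 := by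
  rw [RiemMetric.volumeDensity, ← g.upperCoeff_eq_lowerCoeff hk hi]
  ring

/-- Both sides have derivative `12 * g.volumeDensity 1 * sinh t ^ 2`. -/
theorem RiemMetric.upperCoeff_mul_sinh_pow_three (hk : g.IsKahler) (hi : g.IsInvariant)
    (hr : g.IsRicciFlat) {t : ℝ} (ht : 0 ≤ t) :
    (g.upperCoeff t * Real.sinh t) ^ 3 =
      3 * g.volumeDensity 1 * (Real.sinh (2 * t) - 2 * t) := by
  have hleft : ∀ s, 0 ≤ s → HasDerivAt (fun s => (g.upperCoeff s * Real.sinh s) ^ 3)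
      (12 * g.volumeDensity 1 * Real.sinh s ^ 2) s := by
    intro s hs
    convert! (g.hasDerivAt_upperCoeff_mul_sinh hk hi s).pow 3 using 1
    rcases hs.eq_or_lt with rfl | hs
    · simp
    · rw [← g.volumeDensity_eq hk.hermitian hi hr hs one_pos,
        g.volumeDensity_eq_upperCoeff_sq hk hi]
      push_cast
      ring
  have hright : ∀ s : ℝ, HasDerivAt (fun s =>
      3 * g.volumeDensity 1 * (Real.sinh (2 * s) - 2 * s))
      (12 * g.volumeDensity 1 * Real.sinh s ^ 2) s := by
    intro s
    convert! ((((hasDerivAt_id s).const_mul 2).sinh).sub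
      ((hasDerivAt_id s).const_mul 2)).const_mul (3 * g.volumeDensity 1) using 1
    simp only [id_eq, Real.cosh_two_mul, Real.cosh_sq]
    ring
  have hdiff : ∀ s, 0 ≤ s → HasDerivAt (fun s => (g.upperCoeff s * Real.sinh s) ^ 3 -
      3 * g.volumeDensity 1 * (Real.sinh (2 * s) - 2 * s)) 0 s := fun s hs => by
    simpa only [sub_self] using (hleft s hs).fun_sub (hright s)
  have hconst := constant_of_has_deriv_right_zero (a := 0) (b := t)
    (fun s hs => (hdiff s hs.1).continuousAt.continuousWithinAt)
    (fun s hs => (hdiff s hs.1).hasDerivWithinAt) t ⟨ht, le_rfl⟩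
  simpa [sub_eq_zero] using hconst

section Comparison

variable {g₀ : RiemMetric} {c : ℝ}

theorem RiemMetric.upperCoeff_eq_mul (hk : g.IsKahler) (hi : g.IsInvariant) (hr : g.IsRicciFlat)
    (hk₀ : g₀.IsKahler) (hi₀ : g₀.IsInvariant) (hr₀ : g₀.IsRicciFlat) (hc : 0 < c)
    (hvol : g.volumeDensity 1 = c ^ 3 * g₀.volumeDensity 1) {t : ℝ} (ht : 0 < t) :
    g.upperCoeff t = c * g₀.upperCoeff t := by
  have hsinh : 0 < Real.sinh t := Real.sinh_pos_iff.2 ht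
  have hcube : (g.upperCoeff t * Real.sinh t) ^ 3 = (c * g₀.upperCoeff t * Real.sinh t) ^ 3 := by
    rw [g.upperCoeff_mul_sinh_pow_three hk hi hr ht.le, hvol, mul_assoc c, mul_pow c,
      g₀.upperCoeff_mul_sinh_pow_three hk₀ hi₀ hr₀ ht.le]
    ring
  have hpos := g.upperCoeff_pos t
  have hpos₀ := g₀.upperCoeff_pos t
  exact mul_right_cancel₀ hsinh.ne'
    ((pow_left_inj₀ (by positivity) (by positivity) three_ne_zero).1 hcube)

theorem RiemMetric.radialCoeff_eq_mul (hk : g.IsKahler) (hi : g.IsInvariant) (hr : g.IsRicciFlat)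
    (hk₀ : g₀.IsKahler) (hi₀ : g₀.IsInvariant) (hr₀ : g₀.IsRicciFlat) (hc : 0 < c)
    (hvol : g.volumeDensity 1 = c ^ 3 * g₀.volumeDensity 1) {t : ℝ} (ht : 0 < t) :
    g.radialCoeff t = c * g₀.radialCoeff t := by
  have hdensity : g.volumeDensity t = c ^ 3 * g₀.volumeDensity t := by
    rw [g.volumeDensity_eq hk.hermitian hi hr ht one_pos, hvol,
      g₀.volumeDensity_eq hk₀.hermitian hi₀ hr₀ ht one_pos]
  rw [g.volumeDensity_eq_upperCoeff_sq hk hi, g₀.volumeDensity_eq_upperCoeff_sq hk₀ hi₀,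
    RiemMetric.upperCoeff_eq_mul hk hi hr hk₀ hi₀ hr₀ hc hvol ht] at hdensity
  have hpos₀ := g₀.upperCoeff_pos t
  have hne : c ^ 2 * Real.exp t * g₀.upperCoeff t ^ 2 ≠ 0 := by positivity
  apply mul_right_cancel₀ hne
  linear_combination 8 * hdensity

end Comparison

theorem RiemMetric.exists_coeff_eq_mul {g₀ : RiemMetric} (hk : g.IsKahler) (hi : g.IsInvariant)
    (hr : g.IsRicciFlat) (hk₀ : g₀.IsKahler) (hi₀ : g₀.IsInvariant) (hr₀ : g₀.IsRicciFlat) :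
    ∃ c : ℝ, 0 < c ∧ ∀ t, 0 ≤ t →
      g.radialCoeff t = c * g₀.radialCoeff t ∧ g.upperCoeff t = c * g₀.upperCoeff t := by
  have hratio : 0 < g.volumeDensity 1 / g₀.volumeDensity 1 :=
    div_pos (g.volumeDensity_pos 1) (g₀.volumeDensity_pos 1)
  obtain ⟨c, hc, hc₃⟩ : ∃ c : ℝ, 0 < c ∧ c ^ 3 = g.volumeDensity 1 / g₀.volumeDensity 1 :=
    ⟨_, Real.rpow_pos_of_pos hratio _, Real.rpow_inv_natCast_pow hratio.le three_ne_zero⟩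
  have hvol : g.volumeDensity 1 = c ^ 3 * g₀.volumeDensity 1 := by
    rw [hc₃, div_mul_cancel₀ _ (g₀.volumeDensity_pos 1).ne']
  have hextend : ∀ {f f₀ : ℝ → ℝ}, Continuous f → Continuous f₀ → (∀ t, 0 < t → f t = c * f₀ t) →
      ∀ t, 0 ≤ t → f t = c * f₀ t := by
    intro f f₀ hf hf₀ h t ht
    have hclosure := Set.EqOn.closure (s := Set.Ioi 0) h hf (hf₀.const_mul c)
    rw [closure_Ioi] at hclosure
    exact hclosure ht
  exact ⟨c, hc, fun t ht =>
    ⟨hextend g.contDiff_radialCoeff.continuous g₀.contDiff_radialCoeff.continuous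
      (fun _ => RiemMetric.radialCoeff_eq_mul hk hi hr hk₀ hi₀ hr₀ hc hvol) t ht,
    hextend g.contDiff_upperCoeff.continuous g₀.contDiff_upperCoeff.continuous
      (fun _ => RiemMetric.upperCoeff_eq_mul hk hi hr hk₀ hi₀ hr₀ hc hvol) t ht⟩⟩

theorem RiemMetric.exists_inner_eq_mul {g₀ : RiemMetric} (hk : g.IsKahler) (hi : g.IsInvariant)
    (hr : g.IsRicciFlat) (hk₀ : g₀.IsKahler) (hi₀ : g₀.IsInvariant) (hr₀ : g₀.IsRicciFlat) :
    ∃ c : ℝ, 0 < c ∧ ∀ (u : SL2) (X Y : tangentSpace u), g.inner u X Y = c * g₀.inner u X Y := by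
  obtain ⟨c, hc, hcoeff⟩ := RiemMetric.exists_coeff_eq_mul hk hi hr hk₀ hi₀ hr₀
  have hdiag : ∀ t, 0 ≤ t → ∀ A ∈ tangentSpace (diagSL t), ∀ B ∈ tangentSpace (diagSL t),
      g.form (diagSL t) A B = c * g₀.form (diagSL t) A B := by
    intro t ht A hA B hB
    rw [g.form_diagSL hk.hermitian hi t hA hB, g₀.form_diagSL hk₀.hermitian hi₀ t hA hB,
      ← g.upperCoeff_eq_lowerCoeff hk hi, ← g₀.upperCoeff_eq_lowerCoeff hk₀ hi₀,
      (hcoeff t ht).1, (hcoeff t ht).2]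
    ring
  refine ⟨c, hc, fun u X Y => ?_⟩
  obtain ⟨k, hk, l, hl, t, ht, rfl⟩ := exists_kak u
  rw [g.inner_eq_form, g₀.inner_eq_form, hi.form_translate_inv hk hl, hi₀.form_translate_inv hk hl,
    hdiag t ht _ (translate_inv_mem X.2) _ (translate_inv_mem Y.2)]

/-! ### The polar decomposition -/

section ConjDiagonal

variable {n : Type*} [Fintype n] [DecidableEq n] {V : Matrix n n ℂ}

theorem exp_conj_diagonal (hV : Vᴴ * V = 1) (d : n → ℂ) :
    NormedSpace.exp (V * Matrix.diagonal d * Vᴴ) =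
      V * Matrix.diagonal (fun i => Complex.exp (d i)) * Vᴴ := by
  have hunit : IsUnit V := IsUnit.of_mul_eq_one _ (mul_eq_one_comm.1 hV)
  rw [← Matrix.inv_eq_left_inv hV, Matrix.exp_conj V _ hunit, Matrix.exp_diagonal]
  congr 3
  ext i
  rw [Pi.coe_exp, Complex.exp_eq_exp_ℂ]

theorem trace_conj_diagonal (hV : Vᴴ * V = 1) (d : n → ℂ) :
    (V * Matrix.diagonal d * Vᴴ).trace = ∑ i, d i := by
  rw [Matrix.trace_mul_comm, ← Matrix.mul_assoc, hV, Matrix.one_mul, Matrix.trace_diagonal]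

theorem conj_diagonal_mul_self (hV : Vᴴ * V = 1) (d : n → ℂ) :
    V * Matrix.diagonal d * Vᴴ * (V * Matrix.diagonal d * Vᴴ) =
      V * Matrix.diagonal (fun i => d i * d i) * Vᴴ := by
  calc _ = V * Matrix.diagonal d * (Vᴴ * V) * Matrix.diagonal d *
        Vᴴ := by simp only [Matrix.mul_assoc]
    _ = _ := by rw [hV, Matrix.mul_one, Matrix.mul_assoc V, Matrix.diagonal_mul_diagonal]

theorem isHermitian_conj_diagonal (V : Matrix n n ℂ) (x : n → ℝ) :
    (V * Matrix.diagonal (fun i => (x i : ℂ)) * Vᴴ).IsHermitian :=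
  Matrix.isHermitian_mul_mul_conjTranspose V
    (Matrix.isHermitian_diagonal_of_self_adjoint _ (funext fun i => Complex.conj_ofReal (x i)))

end ConjDiagonal

theorem exists_conj_diagonal_of_trace_eq_zero {B : M2} (hB : B.IsHermitian) (htr : B.trace = 0) :
    ∃ V : M2, Vᴴ * V = 1 ∧ ∃ x : ℝ,
      B = V * Matrix.diagonal (fun i => ((![x, -x] i : ℝ) : ℂ)) * Vᴴ := by
  have hV := Matrix.mem_unitaryGroup_iff'.1 hB.eigenvectorUnitary.2
  have hspec : B = hB.eigenvectorUnitary * Matrix.diagonal (fun i => (hB.eigenvalues i : ℂ)) *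
      (hB.eigenvectorUnitary : M2)ᴴ := by
    conv_lhs => rw [hB.spectral_theorem, Unitary.conjStarAlgAut_apply]
    rfl
  have hsum : (hB.eigenvalues 0 : ℂ) + hB.eigenvalues 1 = 0 := by
    have htrace := hB.trace_eq_sum_eigenvalues
    rw [htr, Fin.sum_univ_two] at htrace
    exact htrace.symm
  have hneg : hB.eigenvalues 1 = -hB.eigenvalues 0 := by
    exact_mod_cast eq_neg_of_add_eq_zero_right hsum
  have heigen : hB.eigenvalues = ![hB.eigenvalues 0, -hB.eigenvalues 0] := by
    ext i
    fin_cases i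
    exacts [rfl, hneg]
  exact ⟨_, hV, hB.eigenvalues 0, heigen ▸ hspec⟩

theorem isHermitian_I_smul {h : M2} (hh : h ∈ su2) : (Complex.I • h).IsHermitian := by
  rw [Matrix.IsHermitian, Matrix.conjTranspose_smul, hh.1]
  simp

theorem su2Norm_eq_of_conj_diagonal {V h : M2} (hh : h ∈ su2) (hV : Vᴴ * V = 1)
    {x : ℝ} (hx : Complex.I • h =
      V * Matrix.diagonal (fun i => ((![x, -x] i : ℝ) : ℂ)) * Vᴴ) :
    su2Norm h = |2 * x| := by
  have hsq : hᴴ * h = (Complex.I • h) * (Complex.I • h) := by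
    rw [Matrix.smul_mul, Matrix.mul_smul, smul_smul, Complex.I_mul_I, hh.1]
    simp
  rw [su2Norm, hsq, hx, conj_diagonal_mul_self hV, trace_conj_diagonal hV, ← Real.sqrt_sq_eq_abs]
  congr 1
  simp
  ring

theorem gram_mul_of_mem_SU2 {a : SL2} (ha : a ∈ SU2) {E : M2} (hE : E.IsHermitian) :
    ((a : M2) * E)ᴴ * ((a : M2) * E) = E * E := by
  rw [Matrix.conjTranspose_mul, hE.eq, Matrix.mul_assoc, ← Matrix.mul_assoc _ (a : M2),
    mem_SU2_iff.1 ha, Matrix.one_mul]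

theorem IsPolar.tau_eq {u a : SL2} {h : M2} (hu : IsPolar u a h) :
    tau u = Real.cosh (su2Norm h) := by
  obtain ⟨ha, hh, hpolar⟩ := hu
  have hherm := isHermitian_I_smul hh
  obtain ⟨V, hV, x, hx⟩ := exists_conj_diagonal_of_trace_eq_zero hherm
    (by rw [Matrix.trace_smul, hh.2, smul_zero])
  have hgram : (u : M2)ᴴ * (u : M2) = V * Matrix.diagonal (fun i =>
      Complex.exp (![x, -x] i : ℝ) * Complex.exp (![x, -x] i : ℝ)) * Vᴴ := by
    rw [hpolar, gram_mul_of_mem_SU2 ha hherm.exp, hx, exp_conj_diagonal hV,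
      conj_diagonal_mul_self hV]
  have htrace := trace_gram u
  rw [hgram, trace_conj_diagonal hV, Fin.sum_univ_two] at htrace
  have htau : Real.exp x * Real.exp x + Real.exp (-x) * Real.exp (-x) = 2 * tau u := by
    exact_mod_cast htrace
  rw [su2Norm_eq_of_conj_diagonal hh hV hx, Real.cosh_abs, Real.cosh_eq, two_mul, neg_add,
    Real.exp_add, Real.exp_add, htau]
  ring

theorem exists_isPolar (u : SL2) : ∃ (a : SL2) (h : M2), IsPolar u a h := by
  obtain ⟨k, hk, l, hl, t, -, rfl⟩ := exists_kak u
  have hl' := mem_SU2_iff.1 hl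
  set x : Fin 2 → ℝ := ![t / 2, -(t / 2)] with hx
  set B : M2 := l * Matrix.diagonal (fun i => (x i : ℂ)) * (l : M2)ᴴ with hB
  have hherm : B.IsHermitian := isHermitian_conj_diagonal _ x
  have hI : Complex.I • (-Complex.I • B) = B := by
    rw [smul_smul]
    simp
  refine ⟨k * l⁻¹, -Complex.I • B, SU2.mul_mem hk (SU2.inv_mem hl), ⟨?_, ?_⟩, ?_⟩
  · rw [Matrix.conjTranspose_smul, hherm.eq]
    simp
  · rw [Matrix.trace_smul, hB, trace_conj_diagonal hl']
    simp [hx]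
  · have hdiag : (Matrix.diagonal fun i => Complex.exp (x i)) = (diagSL t : M2) := by
      ext i j
      fin_cases i <;> fin_cases j <;> simp [hx, diagSL]
    have hu : k * diagSL t * l⁻¹ = k * l⁻¹ * (l * diagSL t * l⁻¹) := by group
    rw [hI, exp_conj_diagonal hl', hdiag, ← SU2.coe_inv hl, ← Matrix.SpecialLinearGroup.coe_mul,
      ← Matrix.SpecialLinearGroup.coe_mul, ← Matrix.SpecialLinearGroup.coe_mul, hu]

end SL2Kahler

end

theorem theoremC_general :
    (∀ u : SL2, ∃ (a : SL2) (h : M2), IsPolar u a h) ∧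
    ∃ K : SL2 → ℝ,
      (∀ (u a : SL2) (h : M2), IsPolar u a h →
        K u = ∫ t in (0 : ℝ)..su2Norm h, (Real.sinh (2 * t) - 2 * t) ^ (1 / 3 : ℝ)) ∧
      ∃ g₀ : RiemMetric,
        g₀.HasPotential K ∧
        g₀.IsCompleteInvariantRicciFlatKahler ∧
        ∀ g : RiemMetric, g.IsKahler → g.IsInvariant → g.IsRicciFlat →
          ∃ c : ℝ, 0 < c ∧ ∀ (u : SL2) (X Y : tangentSpace u),
            g.inner u X Y = c * g₀.inner u X Y := by
  refine ⟨exists_isPolar, potential, fun u a h hu => ?_, stenzel, stenzel_hasPotential,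
    ⟨stenzel_isKahler, stenzel_isInvariant, stenzel_isRicciFlat, stenzel_isComplete⟩,
    fun g hk hi hr => g.exists_inner_eq_mul hk hi hr stenzel_isKahler stenzel_isInvariant
      stenzel_isRicciFlat⟩
  rw [potential, hu.tau_eq, radialPotential_cosh (t := su2Norm h) (Real.sqrt_nonneg _)]

theorem theoremC :
    -- the polar decomposition exists and determines the potential as a function on `SL(2, ℂ)`
    (∀ u : SL2, ∃ (a : SL2) (h : M2), IsPolar u a h) ∧
    ∃ K : SL2 → ℝ,
      (∀ (u a : SL2) (h : M2), IsPolar u a h →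
        K u = ∫ t in (0 : ℝ)..su2Norm h, (Real.sinh (2 * t) - 2 * t) ^ (1 / 3 : ℝ)) ∧
      ∃ g₀ : RiemMetric,
        g₀.HasPotential K ∧
        g₀.IsCompleteInvariantRicciFlatKahler ∧
        ∀ g : RiemMetric, g.IsCompleteInvariantRicciFlatKahler →
          ∃ c : ℝ, 0 < c ∧ ∀ (u : SL2) (X Y : tangentSpace u),
            g.inner u X Y = c * g₀.inner u X Y :=
  let ⟨hpolar, K, hK, g₀, hpot, hg₀, huniq⟩ := theoremC_general
  ⟨hpolar, K, hK, g₀, hpot, hg₀, fun g hg => huniq g hg.isKahler hg.isInvariant hg.isRicciFlat⟩
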